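/- **Setting.** Let $m,n\ge 1$ be integers, $F:\mathbb R^m\to\mathbb R$ smooth, $\vec f=(f_1,\dots,f_m)=\nabla F$. For $a<b$ a function $\vec u\in H^1((a,b)\times\mathbb R^n;\mathbb R^m)$ (weak derivatives in $t$ and $x$) is a *variational solution* of $\partial_t\vec u-\Delta\vec u=\vec f(\vec u)$ in $(a,b)\times\mathbb R^n$ if $u_if_i(\vec u)$ $(i=1,\dots,m)$ and $F(\vec u)$ belong to $L^1((a,b)\times\mathbb R^n)$, $\vec f(\vec u)\in L^1_{loc}$, the system holds in the sense of distributions, and for almost every small $\delta>0$ and every $\psi=(\psi_0,\dots,\psi_n)\in C^1(\mathbb R^{n+1};\mathbb R^{n+1})$ vanishing for $|x|$ large (uniformly in $t$), with $\partial_0=\partial_t$ and $e:=|\nabla\vec u|^2-2F(\vec u)$, $$\int_{a+\delta}^{b-\delta}\!\int_{\mathbb R^n}\Big[e\sum_{k=0}^n\partial_k\psi_k-2\sum_{j=1}^n\sum_{k=0}^n\partial_j\vec u\cdot\partial_k\vec u\,\partial_j\psi_k-2\sum_{k=0}^n\partial_t\vec u\cdot\partial_k\vec u\,\psi_k\Big]dx\,dt-\int_{\mathbb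 R^n}(e\,\psi_0)(b-\delta,x)\,dx+\int_{\mathbb R^n}(e\,\psi_0)(a+\delta,x)\,dx=0 .$$ For $T\in\mathbb R$, $x_0\in\mathbb R^n$ put $T_r^-=(T-4r^2,T-r^2)\times\mathbb R^n$, $T_r^+=(T+r^2,T+4r^2)\times\mathbb R^n$, $$G(t,x)=4\pi(T-t)\,|4\pi(T-t)|^{-\frac n2-1}\exp\Big(-\frac{|x-x_0|^2}{4(T-t)}\Big)\qquad(t\ne T),$$ $$\Psi^\pm(r)=r^{-2\beta}\int_{T_r^\pm}(|\nabla\vec u|^2-2F(\vec u))\,G-\frac\beta2 r^{-2\beta}\int_{T_r^\pm}\frac{1}{T-t}|\vec u|^2G .$$ **Theorem 3.3.** Let $t_1<t_2$, $t_1\le T\le t_2$, $x_0\in\mathbb R^n$, $\beta\in\mathbb R$. Let $\vec u$ be a variational solution in $(t_1,T)\times\mathbb R^n$ if $t_1<T$, and in $(T,t_2)\times\mathbb R^n$ if $T<t_2$. Put $r_-=\frac{\sqrt{T-t_1}}4$, $r_+=\frac{\sqrt{t_2-T}}4$. All integrals in the following assumptions are assumed to converge absolutely (the inner one in (i) for almost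 every $t$). Assume: (i) for every $\delta>0$, with $I_\delta=(t_1,T-\delta)\cup(T+\delta,t_2)$, $$\operatorname*{ess\,sup}_{t\in I_\delta}\int_{\mathbb R^n}e^{-\frac{|x-x_0|^2}{4(T-t)}}(|\nabla\vec u|^2-2F(\vec u))(t,x)\,dx<\infty,\qquad \int_{I_\delta}\int_{\mathbb R^n}e^{-\frac{|x-x_0|^2}{4(T-t)}}(|\partial_t\vec u|^2+|\vec u|^2)\,dx\,dt<\infty;$$ (ii) for both signs and all $0<r<r_\pm$, $$\int_{T_r^\pm}\big[2(\beta-1)F(\vec u)-\beta\,\vec u\cdot\vec f(\vec u)\big]G\ge0;$$ (iii) for both signs, $$\sup_{0<r<r_\pm}r^{-2\beta}\Big(\Big|\int_{T_r^\pm}\frac1{T-t}|\vec u|^2G\Big|+\Big|\int_{T_r^\pm}|\nabla\vec u|^2G\Big|+\Big|\int_{T_r^\pm}2F(\vec u)G\Big|\Big)<\infty$$ (for a sign with $r_\pm=0$, (ii) and (iii) are void). Let $\rho_k>0$, $\rho_k\to0$, $\vec u_k(t,x)=\rho_k^{-\beta}\vec u(T+\rho_k^2t,x_0+\rho_kx)$,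 and let $U\subset\mathbb R\times\mathbb R^n$ be the union of $(-\infty,0)\times\mathbb R^n$ (if $t_1<T$) and $(0,\infty)\times\mathbb R^n$ (if $T<t_2$). Then: 1. If $t_1<T$, then $\Psi^-$ is nondecreasing on $(0,r_-)$ and $\Psi^-(r)$ decreases to a finite limit $M^-(\vec u,(T,x_0))$ as $r\searrow0$. If $T<t_2$, then $\Psi^+$ is nondecreasing on $(0,r_+)$ and $\Psi^+(r)$ decreases to a finite limit $M^+(\vec u,(T,x_0))$ as $r\searrow0$. 2. For every open $D\subset\subset U$ there is $k(D)$ such that $(\vec u_k)_{k\ge k(D)}$ is bounded in $H^1(D)$. 3. If a subsequence of $(\vec u_k)$ converges to $\vec u_0$ weakly in $H^1(D)$ for every open $D\subset\subset U$, then for every $\lambda>0$ $$\vec u_0(\lambda^2t,\lambda x)=\lambda^\beta\,\vec u_0(t,x)\qquad\text{for almost every }(t,x)\in U .$$ -/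

import Mathlib

open MeasureTheory Filter Topology Set
open scoped ContDiff RealInnerProductSpace

noncomputable section

/-- Space-time `ℝ × ℝⁿ`; a point is `z = (t, x)`. -/
abbrev SpaceTime (n : ℕ) : Type := ℝ × EuclideanSpace ℝ (Fin n)

namespace ParabolicSystem

variable {n m : ℕ}

/-- The coordinate directions of space-time: index `0` is time, index `j.succ` is `x_j`. -/
def dir : Fin (n + 1) → SpaceTime n :=
  Fin.cons (1, 0) fun j => (0, EuclideanSpace.single j 1)

/-- The classical partial derivative `∂_k φ` (`∂_0 = ∂_t`) of a scalar function. -/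
def pd (k : Fin (n + 1)) (φ : SpaceTime n → ℝ) (z : SpaceTime n) : ℝ :=
  fderiv ℝ φ z (dir k)

/-- `φ ∈ C_c^∞(U)`. -/
structure IsTest (U : Set (SpaceTime n)) (φ : SpaceTime n → ℝ) : Prop where
  smooth : ContDiff ℝ ∞ φ
  compact : HasCompactSupport φ
  subset : tsupport φ ⊆ U

/-- `Du = (∂_0 u, …, ∂_n u)` are the weak first derivatives of `u` in `U`. -/
def HasWeakGrad (U : Set (SpaceTime n)) (u : SpaceTime n → EuclideanSpace ℝ (Fin m))
    (Du : Fin (n + 1) → SpaceTime n → EuclideanSpace ℝ (Fin m)) : Prop :=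
  ∀ (k : Fin (n + 1)) (φ : SpaceTime n → ℝ), IsTest U φ →
    ∫ z in U, pd k φ z • u z = -∫ z in U, φ z • Du k z

/-- `u ∈ H¹(U; ℝᵐ)`, with weak space-time gradient `Du`. -/
structure MemH1 (U : Set (SpaceTime n)) (u : SpaceTime n → EuclideanSpace ℝ (Fin m))
    (Du : Fin (n + 1) → SpaceTime n → EuclideanSpace ℝ (Fin m)) : Prop where
  memLp : MemLp u 2 (volume.restrict U)
  memLp_grad : ∀ k, MemLp (Du k) 2 (volume.restrict U)
  weakGrad : HasWeakGrad U u Du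

theorem IsTest.memLp {U : Set (SpaceTime n)} {φ : SpaceTime n → ℝ} (h : IsTest U φ) :
    MemLp φ 2 (volume.restrict U) :=
  (h.smooth.continuous.memLp_of_hasCompactSupport h.compact).restrict U

theorem IsTest.memLp_pd {U : Set (SpaceTime n)} {φ : SpaceTime n → ℝ} (h : IsTest U φ)
    (k : Fin (n + 1)) : MemLp (pd k φ) 2 (volume.restrict U) := by
  have hc : Continuous (pd k φ) :=
    (h.smooth.continuous_fderiv (by simp)).clm_apply continuous_const
  have hs : HasCompactSupport (pd k φ) := h.compact.fderiv_apply ℝ (dir k)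
  exact (hc.memLp_of_hasCompactSupport hs).restrict U

theorem integrable_smul_of_memLp {U : Set (SpaceTime n)} {g : SpaceTime n → ℝ}
    {v : SpaceTime n → EuclideanSpace ℝ (Fin m)} (hg : MemLp g 2 (volume.restrict U))
    (hv : MemLp v 2 (volume.restrict U)) : IntegrableOn (fun z => g z • v z) U :=
  memLp_one_iff_integrable.1 (hv.smul hg)

/-- The Hilbert space `H¹(D; ℝᵐ)`: component `0` is the function, component `k.succ` is its weak
derivative `∂_k`. The norm is `(‖u‖² + ∑_k ‖∂_k u‖²)^{1/2}` with the norms of `L²(D)`. -/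
def H1 (D : Set (SpaceTime n)) (m : ℕ) :
    Submodule ℝ (PiLp 2 fun _ : Fin (n + 2) =>
      Lp (EuclideanSpace ℝ (Fin m)) 2 (volume.restrict D)) where
  carrier := {p | HasWeakGrad D (p 0) fun k => p k.succ}
  zero_mem' := by
    intro k φ _
    have h0 : ⇑(0 : Lp (EuclideanSpace ℝ (Fin m)) 2 (volume.restrict D))
        =ᵐ[volume.restrict D] 0 := Lp.coeFn_zero _ _ _
    have e1 : ∫ z in D, pd k φ z •
        (0 : Lp (EuclideanSpace ℝ (Fin m)) 2 (volume.restrict D)) z = 0 := by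
      apply integral_eq_zero_of_ae
      filter_upwards [h0] with z hz
      rw [hz]
      simp
    have e2 : ∫ z in D, φ z •
        (0 : Lp (EuclideanSpace ℝ (Fin m)) 2 (volume.restrict D)) z = 0 := by
      apply integral_eq_zero_of_ae
      filter_upwards [h0] with z hz
      rw [hz]
      simp
    simp only [PiLp.zero_apply, e1, e2, neg_zero]
  add_mem' := by
    intro p q hp hq k φ hφ
    have key : ∀ (g : SpaceTime n → ℝ), MemLp g 2 (volume.restrict D) → ∀ i : Fin (n + 2),
        ∫ z in D, g z • (p + q) i z = (∫ z in D, g z • p i z) + ∫ z in D, g z • q i z := by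
      intro g hg i
      rw [← integral_add (integrable_smul_of_memLp hg (Lp.memLp (p i)))
        (integrable_smul_of_memLp hg (Lp.memLp (q i)))]
      apply integral_congr_ae
      filter_upwards [Lp.coeFn_add (p i) (q i)] with z hz
      rw [PiLp.add_apply, hz, Pi.add_apply, smul_add]
    rw [key _ (hφ.memLp_pd k), key _ hφ.memLp, hp k φ hφ, hq k φ hφ, neg_add]
  smul_mem' := by
    intro c p hp k φ hφ
    have key : ∀ (g : SpaceTime n → ℝ) (i : Fin (n + 2)),
        ∫ z in D, g z • (c • p) i z = c • ∫ z in D, g z • p i z := by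
      intro g i
      rw [← integral_smul]
      apply integral_congr_ae
      filter_upwards [Lp.coeFn_smul c (p i)] with z hz
      rw [PiLp.smul_apply, hz, Pi.smul_apply, smul_comm]
    rw [key, key, hp k φ hφ, smul_neg]

/-- The function `v` belongs, on `D`, to the class `w ∈ H¹(D; ℝᵐ)`. -/
def Represents {D : Set (SpaceTime n)} (w : H1 D m)
    (v : SpaceTime n → EuclideanSpace ℝ (Fin m)) : Prop :=
  ⇑(w.1 0) =ᵐ[volume.restrict D] v

/-- `v_k` is bounded in `H¹(D; ℝᵐ)` for `k ≥ k(D)`. -/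
def EventuallyBoundedH1 (D : Set (SpaceTime n))
    (v : ℕ → SpaceTime n → EuclideanSpace ℝ (Fin m)) : Prop :=
  ∃ (k₀ : ℕ) (C : ℝ), ∀ k ≥ k₀, ∃ w : H1 D m, Represents w (v k) ∧ ‖w‖ ≤ C

/-- `v_k ⇀ v₀` weakly in `H¹(D; ℝᵐ)`, where `v_k ∈ H¹(D; ℝᵐ)` is only required for large `k`. -/
def WeaklyConvergesH1 (D : Set (SpaceTime n))
    (v : ℕ → SpaceTime n → EuclideanSpace ℝ (Fin m))
    (v₀ : SpaceTime n → EuclideanSpace ℝ (Fin m)) : Prop :=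
  ∃ (w : ℕ → H1 D m) (w₀ : H1 D m),
    (∀ᶠ k in atTop, Represents (w k) (v k)) ∧ Represents w₀ v₀ ∧
      ∀ L : StrongDual ℝ (H1 D m), Tendsto (fun k => L (w k)) atTop (𝓝 (L w₀))

/-- `D ⊂⊂ U` for an open set `D`. -/
def CompactlyInside (D U : Set (SpaceTime n)) : Prop :=
  IsOpen D ∧ IsCompact (closure D) ∧ closure D ⊆ U

/-- The layer `(a, b) × ℝⁿ`. -/
def strip (n : ℕ) (a b : ℝ) : Set (SpaceTime n) := Ioo a b ×ˢ univ

/-- `T_r^-(T) = (T - 4r², T - r²) × ℝⁿ`. -/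
def layerMinus (n : ℕ) (T r : ℝ) : Set (SpaceTime n) := strip n (T - 4 * r ^ 2) (T - r ^ 2)

/-- `T_r^+(T) = (T + r², T + 4r²) × ℝⁿ`. -/
def layerPlus (n : ℕ) (T r : ℝ) : Set (SpaceTime n) := strip n (T + r ^ 2) (T + 4 * r ^ 2)

/-- The backward heat kernel `G_{(T,x₀)}(t,x)`, `t ≠ T`; it is negative for `t > T`. -/
def heatKernel (T : ℝ) (x₀ : EuclideanSpace ℝ (Fin n)) (z : SpaceTime n) : ℝ :=
  4 * Real.pi * (T - z.1) * |4 * Real.pi * (T - z.1)| ^ (-(n : ℝ) / 2 - 1) *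
    Real.exp (-‖z.2 - x₀‖ ^ 2 / (4 * (T - z.1)))

/-- `|∇u|²`, the sum over the space derivatives only. -/
def gradSq (Du : Fin (n + 1) → SpaceTime n → EuclideanSpace ℝ (Fin m)) (z : SpaceTime n) : ℝ :=
  ∑ j : Fin n, ‖Du j.succ z‖ ^ 2

/-- The energy density `|∇u|² - 2F(u)`. -/
def energy (F : EuclideanSpace ℝ (Fin m) → ℝ) (u : SpaceTime n → EuclideanSpace ℝ (Fin m))
    (Du : Fin (n + 1) → SpaceTime n → EuclideanSpace ℝ (Fin m)) (z : SpaceTime n) : ℝ :=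
  gradSq Du z - 2 * F (u z)

/-- `u`, with weak gradient `Du`, is a variational solution of `∂_t u - Δu = ∇F(u)` in
`(a, b) × ℝⁿ`. -/
structure IsVariationalSolution (F : EuclideanSpace ℝ (Fin m) → ℝ) (a b : ℝ)
    (u : SpaceTime n → EuclideanSpace ℝ (Fin m))
    (Du : Fin (n + 1) → SpaceTime n → EuclideanSpace ℝ (Fin m)) : Prop where
  memH1 : MemH1 (strip n a b) u Du
  integrable_uf : ∀ i, IntegrableOn (fun z => u z i * gradient F (u z) i) (strip n a b)
  integrable_F : IntegrableOn (fun z => F (u z)) (strip n a b)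
  /-- `f(u)` is a distribution, and the system holds in the sense of distributions. -/
  locallyIntegrable_f : LocallyIntegrableOn (fun z => gradient F (u z)) (strip n a b)
  distributional : ∀ φ : SpaceTime n → ℝ, IsTest (strip n a b) φ →
    ∫ z in strip n a b, (pd 0 φ z + ∑ j : Fin n, pd j.succ (pd j.succ φ) z) • u z =
      -∫ z in strip n a b, φ z • gradient F (u z)
  /-- The first variation with respect to domain variations in space and time vanishes. -/
  firstVariation : ∃ δ₀ > 0, ∀ᵐ δ ∂(volume.restrict (Ioo (0 : ℝ) δ₀)),
    ∀ ψ : Fin (n + 1) → SpaceTime n → ℝ, (∀ k, ContDiff ℝ 1 (ψ k)) →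
      (∃ R : ℝ, ∀ k t x, R < ‖x‖ → ψ k (t, x) = 0) →
      (∫ z in strip n (a + δ) (b - δ),
          (energy F u Du z * ∑ k, pd k (ψ k) z
            - 2 * ∑ j : Fin n, ∑ k, pd j.succ (ψ k) z * ⟪Du j.succ z, Du k z⟫
            - 2 * ∑ k, ⟪Du 0 z, Du k z⟫ * ψ k z))
        - (∫ x, energy F u Du (b - δ, x) * ψ 0 (b - δ, x))
        + (∫ x, energy F u Du (a + δ, x) * ψ 0 (a + δ, x)) = 0

/-- The weighted energy
`r^{-2β} ∫_S (|∇u|² - 2F(u)) G - (β/2) r^{-2β} ∫_S u² G / (T - t)`;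
it is `Ψ^∓(r)` for the layer `S = T_r^∓(T)`. -/
def weightedEnergy (F : EuclideanSpace ℝ (Fin m) → ℝ) (β T : ℝ) (x₀ : EuclideanSpace ℝ (Fin n))
    (u : SpaceTime n → EuclideanSpace ℝ (Fin m))
    (Du : Fin (n + 1) → SpaceTime n → EuclideanSpace ℝ (Fin m))
    (S : Set (SpaceTime n)) (r : ℝ) : ℝ :=
  r ^ (-2 * β) * (∫ z in S, energy F u Du z * heatKernel T x₀ z)
    - β / 2 * r ^ (-2 * β) * ∫ z in S, 1 / (T - z.1) * ‖u z‖ ^ 2 * heatKernel T x₀ z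

/-- The sup-in-time and space-time weighted bounds away from the time `T`. -/
def WeightedBounds (F : EuclideanSpace ℝ (Fin m) → ℝ) (t₁ t₂ T : ℝ)
    (x₀ : EuclideanSpace ℝ (Fin n)) (u : SpaceTime n → EuclideanSpace ℝ (Fin m))
    (Du : Fin (n + 1) → SpaceTime n → EuclideanSpace ℝ (Fin m)) : Prop :=
  ∀ δ > 0,
    (∃ C : ℝ, ∀ᵐ t ∂(volume.restrict (Ioo t₁ (T - δ) ∪ Ioo (T + δ) t₂)),
      Integrable (fun x => Real.exp (-‖x - x₀‖ ^ 2 / (4 * (T - t))) * energy F u Du (t, x)) ∧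
      ∫ x, Real.exp (-‖x - x₀‖ ^ 2 / (4 * (T - t))) * energy F u Du (t, x) ≤ C) ∧
    IntegrableOn
      (fun z => Real.exp (-‖z.2 - x₀‖ ^ 2 / (4 * (T - z.1))) * (‖Du 0 z‖ ^ 2 + ‖u z‖ ^ 2))
      (strip n t₁ (T - δ) ∪ strip n (T + δ) t₂)

/-- `∫_S G [2(β-1)F(u) - β u·f(u)] ≥ 0`, the integral being absolutely convergent. -/
def NonnegCondition (F : EuclideanSpace ℝ (Fin m) → ℝ) (β T : ℝ)
    (x₀ : EuclideanSpace ℝ (Fin n)) (u : SpaceTime n → EuclideanSpace ℝ (Fin m))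
    (S : Set (SpaceTime n)) : Prop :=
  IntegrableOn (fun z => heatKernel T x₀ z *
    (2 * (β - 1) * F (u z) - β * ⟪u z, gradient F (u z)⟫)) S ∧
  0 ≤ ∫ z in S, heatKernel T x₀ z *
    (2 * (β - 1) * F (u z) - β * ⟪u z, gradient F (u z)⟫)

/-- The growth estimate on the layers `S r`, `0 < r < r₀`: the three integrals converge absolutely
and, multiplied by `r^{-2β}`, are bounded uniformly in `r`. -/
def GrowthEstimate (F : EuclideanSpace ℝ (Fin m) → ℝ) (β T : ℝ) (x₀ : EuclideanSpace ℝ (Fin n))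
    (u : SpaceTime n → EuclideanSpace ℝ (Fin m))
    (Du : Fin (n + 1) → SpaceTime n → EuclideanSpace ℝ (Fin m))
    (S : ℝ → Set (SpaceTime n)) (r₀ : ℝ) : Prop :=
  ∃ C : ℝ, ∀ r ∈ Ioo 0 r₀,
    IntegrableOn (fun z => 1 / (T - z.1) * ‖u z‖ ^ 2 * heatKernel T x₀ z) (S r) ∧
    IntegrableOn (fun z => gradSq Du z * heatKernel T x₀ z) (S r) ∧
    IntegrableOn (fun z => 2 * F (u z) * heatKernel T x₀ z) (S r) ∧
    r ^ (-2 * β) * |∫ z in S r, 1 / (T - z.1) * ‖u z‖ ^ 2 * heatKernel T x₀ z|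
      + r ^ (-2 * β) * |∫ z in S r, gradSq Du z * heatKernel T x₀ z|
      + r ^ (-2 * β) * |∫ z in S r, 2 * F (u z) * heatKernel T x₀ z| ≤ C

/-- The parabolic rescaling `ρ^{-β} u(T + ρ² t, x₀ + ρ x)`. -/
def rescale (β T : ℝ) (x₀ : EuclideanSpace ℝ (Fin n))
    (u : SpaceTime n → EuclideanSpace ℝ (Fin m)) (ρ : ℝ) (z : SpaceTime n) :
    EuclideanSpace ℝ (Fin m) :=
  ρ ^ (-β) • u (T + ρ ^ 2 * z.1, x₀ + ρ • z.2)

/-- The limit domain: it contains `(-∞, 0) × ℝⁿ` iff `t₁ < T`, and `(0, ∞) × ℝⁿ` iff `T < t₂`. -/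
def limitDomain (n : ℕ) (t₁ t₂ T : ℝ) : Set (SpaceTime n) :=
  {z | (t₁ < T ∧ z.1 < 0) ∨ (T < t₂ ∧ 0 < z.1)}

end ParabolicSystem

end

/-! Let `E = 2(t - T)∂_t u + (x - x₀)·∇u` be the derivative of `u` along the parabolic dilations
about `(T, x₀)`, and `W = G/(T - t)`. This weight is positive on both sides of `T` and homogeneous
of degree `-(n+2)`, which cancels the divergence `n + 2` of the dilation field; moreover `∇W = W (x
- x₀)/(2(t - T))`. For a time cutoff `ζ` there are three identities: the vanishing first variation
along `(t - T)ζW` times the dilation field, in which the gradient products combine to `ζW|E|²`; the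
system tested with `(t - T)ζW u`; and the integration by parts of `ζW` times the dilation derivative
of `|u|²`. The first, minus `2β` times the second, minus `β/2` times the third completes a square
and gives `∫ (2(t - T)ζ' + 2βζ) P + ζ D = 0`, with `P` the density of `Ψ` and `D = W|E - βu|² +
2G[2(β-1)F - βu·f]`. This is `integral_energyDensity_add_dissipationDensity`.

With `τ = |t - T|`, the profile `ζ(τ) = ∫_a^b r^{-2β-1} 1_{(1,4)}(τ/r²) dr` solves, after smoothing
of the indicator, `2τζ' + 2βζ = a^{-2β} 1_{(1,4)}(τ/a²) - b^{-2β} 1_{(1,4)}(τ/b²)`. The identity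
therefore becomes `Ψ(b) - Ψ(a) = ∫ ζ D` (`weightedEnergy_sub`). By Fubini the reaction part of the
right side is a positive average over `r` of the integrals in (ii), so `Ψ` is nondecreasing. It is
bounded by (iii), hence has a limit at `0`, and the drop of `Ψ` between `√2 r` and `r` tends to `0`.
That drop controls `r^{-2β} ∫ W|E - βu|²` on the part `2r² < τ < 4r²` of the layer
(`exists_homogeneityDefect_le`).

The measure `W dx dt` is invariant under dilations. So (iii) gives local `L²` bounds for `u_k` and
`∇u_k`, and the drop of `Ψ` shows that the defect `2t∂_t u_k + x·∇u_k - βu_k` tends to `0` locally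
in `L²`. Away from `t = 0` the defect relation can be solved for `∂_t u_k`, which completes the `H¹`
bound (`exists_rescale_bound`). The `l`-derivative of `∫ l^{β+n+2} χ(l²t, lx) u_k` is, up to sign
and a power of `l`, the pairing of a test function with the defect; hence these integrals become
independent of `l` in the limit, which is homogeneity in the sense of distributions
(`integral_dilation_eq`).

Two points need care. Testing with `u` is not immediate because `f(u)` is only locally integrable;
mollification and a bounded truncation of each component justify it
(`integral_self_mul_weakEquation`). The integrability of `W|E|²` is not assumed; it follows by
Fatou's lemma from the first variation identity with spatial cutoffs
(`integrableOn_weight_mul_dilationDeriv_sq`). Both sides of `T` are treated at once by a sign `σ =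
±1`. -/

open scoped ENNReal Convolution

noncomputable section

namespace ParabolicSystem

/-! ### Mollification in `L²`. -/

section Mollification

variable {G : Type*} [NormedAddCommGroup G] [NormedSpace ℝ G] [FiniteDimensional ℝ G]
  [MeasurableSpace G] [BorelSpace G] {μ : Measure G} [μ.IsAddHaarMeasure]

theorem sq_eLpNorm_two {α : Type*} {mα : MeasurableSpace α} (ν : Measure α) (f : α → ℝ) :
    eLpNorm f 2 ν ^ 2 = ∫⁻ x, ‖f x‖ₑ ^ 2 ∂ν := by
  have := eLpNorm_nnreal_pow_eq_lintegral (f := f) (μ := ν) (p := 2) (by norm_num)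
  simpa using this

/-- Translations depend continuously on `y` in the compact-open topology and preserve the measure,
so composition with them is continuous into `L²`. -/
theorem tendsto_eLpNorm_sub_translate {f : G → ℝ} (hf : MemLp f 2 μ) :
    Tendsto (fun y => eLpNorm (fun x => f (x - y) - f x) 2 μ) (𝓝 0) (𝓝 0) := by
  let g : G → C(G, G) := fun y => ⟨fun x => x - y, by fun_prop⟩
  have hg : Continuous g := by
    have : Continuous (fun p : G × G => p.2 - p.1) := by fun_prop
    exact (ContinuousMap.curry ⟨_, this⟩).continuous
  have hm : ∀ y, MeasurePreserving (g y) μ μ := fun y => measurePreserving_sub_right μ y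
  have := (continuous_const (y := hf.toLp f)).compMeasurePreservingLp hg hm (by norm_num)
  have h2 := (this.tendsto 0).sub_const (hf.toLp f)
  have e0 : Lp.compMeasurePreserving (g 0) (hm 0) (hf.toLp f) - hf.toLp f = 0 := by
    rw [Lp.toLp_compMeasurePreserving hf (hm 0), sub_eq_zero, MemLp.toLp_eq_toLp_iff]
    exact Eventually.of_forall fun x => by simp [g]
  rw [e0] at h2
  have h3 := (continuous_enorm.tendsto _).comp h2
  rw [enorm_zero] at h3
  refine h3.congr fun y => ?_
  simp only [Function.comp]
  rw [Lp.toLp_compMeasurePreserving hf (hm y), ← MemLp.toLp_sub, Lp.enorm_toLp]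
  rfl

/-- The normalised bump is a probability density, so the convolution minus `f` is an average of `f(x
- y) - f(x)`. Jensen's inequality, in the form `L¹ ≤ L²` for a probability measure, and Tonelli
reduce the estimate to single translations with `‖y‖ ≤ rOut`. -/
theorem sq_eLpNorm_convolution_sub_le (φ : ContDiffBump (0 : G)) {f : G → ℝ}
    (hf : MemLp f 2 μ) {C : ℝ≥0∞}
    (hC : ∀ y, ‖y‖ ≤ φ.rOut → eLpNorm (fun x => f (x - y) - f x) 2 μ ≤ C) :
    eLpNorm (fun x => (φ.normed μ ⋆[ContinuousLinearMap.lsmul ℝ ℝ, μ] f) x - f x) 2 μ ^ 2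
      ≤ C ^ 2 := by
  set w : G → ℝ≥0∞ := fun y => ENNReal.ofReal (φ.normed μ y) with hw
  have hwm : Measurable w := (φ.continuous_normed.measurable).ennreal_ofReal
  have hint : ∫⁻ y, w y ∂μ = 1 := by
    rw [hw, ← ofReal_integral_eq_lintegral_ofReal φ.integrable_normed
      (Eventually.of_forall fun y => φ.nonneg_normed y), φ.integral_normed, ENNReal.ofReal_one]
  set ν := μ.withDensity w with hν
  have : IsProbabilityMeasure ν := ⟨by rw [hν, withDensity_apply _ MeasurableSet.univ]; simpa⟩
  have hloc : LocallyIntegrable f μ := hf.locallyIntegrable (by norm_num)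
  have hac : ν ≪ μ := withDensity_absolutelyContinuous _ _
  have hfm : ∀ x, AEStronglyMeasurable (fun y => f (x - y)) μ := fun x =>
    hf.1.comp_quasiMeasurePreserving (quasiMeasurePreserving_sub_left μ x)
  have key : ∀ x, ‖(φ.normed μ ⋆[ContinuousLinearMap.lsmul ℝ ℝ, μ] f) x - f x‖ₑ ^ 2 ≤
      ∫⁻ y, w y * ‖f (x - y) - f x‖ₑ ^ 2 ∂μ := by
    intro x
    have e1 : (φ.normed μ ⋆[ContinuousLinearMap.lsmul ℝ ℝ, μ] f) x - f x =
        ∫ y, φ.normed μ y * (f (x - y) - f x) ∂μ := by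
      have hce : Integrable (fun y => φ.normed μ y * f (x - y)) μ :=
        (φ.hasCompactSupport_normed.convolutionExists_left (ContinuousLinearMap.lsmul ℝ ℝ)
          φ.continuous_normed hloc) x
      simp only [mul_sub]
      rw [integral_sub hce (φ.integrable_normed.mul_const _), integral_mul_const,
        φ.integral_normed, one_mul]
      rfl
    have e2 : ‖∫ y, φ.normed μ y * (f (x - y) - f x) ∂μ‖ₑ ≤
        eLpNorm (fun y => f (x - y) - f x) 1 ν := by
      refine (enorm_integral_le_lintegral_enorm _).trans (le_of_eq ?_)
      rw [eLpNorm_one_eq_lintegral_enorm, hν, lintegral_withDensity_eq_lintegral_mul_non_measurable₀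
        _ hwm.aemeasurable (by simp [hw])]
      refine lintegral_congr fun y => ?_
      simp only [Pi.mul_apply, enorm_mul, hw]
      rw [Real.enorm_of_nonneg (φ.nonneg_normed y)]
    rw [e1]
    calc _ ≤ (eLpNorm (fun y => f (x - y) - f x) 2 ν) ^ 2 := by
          gcongr
          refine e2.trans (eLpNorm_le_eLpNorm_of_exponent_le (by norm_num) ?_)
          exact ((hfm x).sub aestronglyMeasurable_const).mono_ac hac
      _ = _ := by
          rw [sq_eLpNorm_two, hν, lintegral_withDensity_eq_lintegral_mul_non_measurable₀
            _ hwm.aemeasurable (by simp [hw])]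
          rfl
  rw [sq_eLpNorm_two]
  calc _ ≤ ∫⁻ x, ∫⁻ y, w y * ‖f (x - y) - f x‖ₑ ^ 2 ∂μ ∂μ := lintegral_mono key
    _ = ∫⁻ y, ∫⁻ x, w y * ‖f (x - y) - f x‖ₑ ^ 2 ∂μ ∂μ := by
        refine lintegral_lintegral_swap ?_
        have h1 : AEStronglyMeasurable (fun p : G × G => f (p.1 - p.2)) (μ.prod μ) :=
          hf.1.comp_quasiMeasurePreserving (quasiMeasurePreserving_sub_of_right_invariant μ μ)
        have h2 : AEStronglyMeasurable (fun p : G × G => f p.1) (μ.prod μ) := hf.1.comp_fst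
        exact (hwm.comp measurable_snd).aemeasurable.mul ((h1.sub h2).enorm.pow_const 2)
    _ = ∫⁻ y, w y * eLpNorm (fun x => f (x - y) - f x) 2 μ ^ 2 ∂μ := by
        refine lintegral_congr fun y => ?_
        rw [lintegral_const_mul' _ _ (by simp [hw]), sq_eLpNorm_two]
    _ ≤ ∫⁻ y, w y * C ^ 2 ∂μ := by
        refine lintegral_mono fun y => ?_
        by_cases hy : ‖y‖ ≤ φ.rOut
        · simp only; gcongr; exact hC y hy
        · have : y ∉ Function.support (φ.normed μ) := by
            rw [φ.support_normed_eq]; simp; linarith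
          simp [hw, Function.notMem_support.1 this]
    _ = C ^ 2 := by rw [lintegral_mul_const _ hwm, hint, one_mul]

theorem tendsto_eLpNorm_convolution_sub {φ : ℕ → ContDiffBump (0 : G)}
    (hφ : Tendsto (fun j => (φ j).rOut) atTop (𝓝 0)) {f : G → ℝ} (hf : MemLp f 2 μ) :
    Tendsto (fun j => eLpNorm (fun x =>
      ((φ j).normed μ ⋆[ContinuousLinearMap.lsmul ℝ ℝ, μ] f) x - f x) 2 μ) atTop (𝓝 0) := by
  rw [ENNReal.tendsto_nhds_zero]
  intro ε hε
  have h := (ENNReal.tendsto_nhds_zero.1 (tendsto_eLpNorm_sub_translate hf)) ε hε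
  obtain ⟨δ, hδ, hδε⟩ := Metric.eventually_nhds_iff.1 h
  filter_upwards [hφ.eventually_lt_const hδ] with j hj
  have := sq_eLpNorm_convolution_sub_le (φ j) hf (C := ε) fun y hy => hδε (by
    rw [dist_zero_right]; linarith)
  exact (ENNReal.pow_le_pow_left_iff two_ne_zero).1 this

end Mollification

/-! ### Smooth approximation of weakly differentiable functions on compact sets. -/

variable {n m : ℕ}

instance isAddHaarMeasure_volume_spaceTime :
    (volume : Measure (SpaceTime n)).IsAddHaarMeasure :=
  inferInstanceAs ((volume : Measure ℝ).prod
    (volume : Measure (EuclideanSpace ℝ (Fin n)))).IsAddHaarMeasure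

/-- `Dv` are the weak first derivatives in `U` of the scalar function `v`. -/
def HasScalarWeakGrad (U : Set (SpaceTime n)) (v : SpaceTime n → ℝ)
    (Dv : Fin (n + 1) → SpaceTime n → ℝ) : Prop :=
  ∀ (k : Fin (n + 1)) (φ : SpaceTime n → ℝ), IsTest U φ →
    ∫ z in U, pd k φ z * v z = -∫ z in U, φ z * Dv k z

/-- `w_j → v` in `L²(K)`, together with the first derivatives, and almost everywhere in `K`. -/
structure SmoothApprox (K : Set (SpaceTime n)) (v : SpaceTime n → ℝ)
    (Dv : Fin (n + 1) → SpaceTime n → ℝ) (w : ℕ → SpaceTime n → ℝ) : Prop where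
  smooth : ∀ j, ContDiff ℝ ∞ (w j)
  ae_tendsto : ∀ᵐ z ∂volume.restrict K, Tendsto (fun j => w j z) atTop (𝓝 (v z))
  tendsto : Tendsto (fun j => eLpNorm (fun z => w j z - v z) 2 (volume.restrict K)) atTop (𝓝 0)
  tendsto_pd : ∀ k, Tendsto (fun j => eLpNorm (fun z => pd k (w j) z - Dv k z) 2
    (volume.restrict K)) atTop (𝓝 0)

/-- The kernel `y ↦ ρ(z - y)` is a test function in `U` because the closed ball about `z` lies in
`U`; the weak derivative is tested with it. The minus sign of the chain rule in `y` cancels the one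
in the definition of the weak derivative. -/
theorem pd_convolution_eq {U : Set (SpaceTime n)} (hU : MeasurableSet U)
    {v : SpaceTime n → ℝ} {Dv : Fin (n + 1) → SpaceTime n → ℝ}
    (hv : MemLp v 2 (volume.restrict U)) (hw : HasScalarWeakGrad U v Dv)
    (φ : ContDiffBump (0 : SpaceTime n)) (k : Fin (n + 1)) {z : SpaceTime n}
    (hz : Metric.closedBall z φ.rOut ⊆ U) :
    pd k (φ.normed volume ⋆[ContinuousLinearMap.lsmul ℝ ℝ, volume] U.indicator v) z =
      (φ.normed volume ⋆[ContinuousLinearMap.lsmul ℝ ℝ, volume] U.indicator (Dv k)) z := by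
  set ρ := φ.normed (volume : Measure (SpaceTime n)) with hρ
  have hloc : LocallyIntegrable (U.indicator v) (volume : Measure (SpaceTime n)) :=
    ((memLp_indicator_iff_restrict hU).2 hv).locallyIntegrable (by norm_num)
  have hρs : ContDiff ℝ ∞ ρ := φ.contDiff_normed
  have hρ1 : ContDiff ℝ 1 ρ := φ.contDiff_normed
  have hρc : HasCompactSupport ρ := φ.hasCompactSupport_normed
  have hd := hρc.hasFDerivAt_convolution_left (ContinuousLinearMap.lsmul ℝ ℝ) hρ1 hloc z
  have htest : IsTest U (fun y => ρ (z - y)) := by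
    refine ⟨hρs.comp (contDiff_const.sub contDiff_id), ?_, ?_⟩
    · exact hρc.comp_homeomorph (Homeomorph.subLeft z)
    · refine (closure_minimal ?_ Metric.isClosed_closedBall).trans hz
      intro y hy
      have : z - y ∈ Function.support ρ := hy
      rw [hρ, φ.support_normed_eq, Metric.mem_ball, dist_zero_right] at this
      rw [Metric.mem_closedBall, dist_comm, dist_eq_norm]
      exact this.le
  have hpd : ∀ y, pd k (fun y => ρ (z - y)) y = -pd k ρ (z - y) := by
    intro y
    have h1 : HasFDerivAt (fun y => z - y) (-ContinuousLinearMap.id ℝ (SpaceTime n)) y :=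
      (hasFDerivAt_id y).const_sub z
    have h2 := (hρ1.differentiable (by norm_num) (z - y)).hasFDerivAt.comp y h1
    simp only [pd]
    rw [show (fun y => ρ (z - y)) = ρ ∘ (fun y => z - y) from rfl, h2.fderiv]
    simp
  have h1 := hw k _ htest
  simp only [hpd, neg_mul, integral_neg, neg_inj] at h1
  have hpd0 : HasCompactSupport (fderiv ℝ ρ) := hρc.fderiv ℝ
  rw [pd, hd.fderiv]
  rw [convolution_eq_swap, convolution_eq_swap]
  rw [ContinuousLinearMap.integral_apply]
  · simp only [ContinuousLinearMap.precompL_apply, ContinuousLinearMap.lsmul_apply, smul_eq_mul]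
    have e1 : ∀ g : SpaceTime n → ℝ, ∀ h : SpaceTime n → ℝ,
        ∫ t, g (z - t) * U.indicator h t = ∫ t in U, g (z - t) * h t := by
      intro g h
      rw [← integral_indicator hU]
      congr 1
      ext t
      by_cases ht : t ∈ U <;> simp [ht]
    rw [e1 ρ, ← h1, ← e1 (pd k ρ)]
    rfl
  · have := (hpd0.convolutionExists_left (ContinuousLinearMap.precompL (SpaceTime n)
      (ContinuousLinearMap.lsmul ℝ ℝ)) (hρ1.continuous_fderiv (by norm_num)) hloc) z
    exact (convolutionExistsAt_iff_integrable_swap).1 this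

theorem exists_smoothApprox {U K : Set (SpaceTime n)} (hU : IsOpen U) (hK : IsCompact K)
    (hKU : K ⊆ U) {v : SpaceTime n → ℝ} {Dv : Fin (n + 1) → SpaceTime n → ℝ}
    (hv : MemLp v 2 (volume.restrict U)) (hDv : ∀ k, MemLp (Dv k) 2 (volume.restrict U))
    (hw : HasScalarWeakGrad U v Dv) : ∃ w, SmoothApprox K v Dv w := by
  obtain ⟨δ, hδ, hδU⟩ := hK.exists_cthickening_subset_open hU hKU
  -- The outer radii `δ / (j + 1)` never exceed `δ`, so at points of `K` every mollification sees
  -- only values in `U`.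
  let φ : ℕ → ContDiffBump (0 : SpaceTime n) := fun j =>
    ⟨δ / (j + 1) / 2, δ / (j + 1), by positivity, half_lt_self (by positivity)⟩
  have hφ : Tendsto (fun j => (φ j).rOut) atTop (𝓝 0) :=
    tendsto_const_nhds.div_atTop (tendsto_atTop_add_const_right _ _ tendsto_natCast_atTop_atTop)
  let w : ℕ → SpaceTime n → ℝ := fun j =>
    (φ j).normed volume ⋆[ContinuousLinearMap.lsmul ℝ ℝ, volume] U.indicator v
  have hvi : MemLp (U.indicator v) 2 volume := (memLp_indicator_iff_restrict hU.measurableSet).2 hv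
  have hDvi : ∀ k, MemLp (U.indicator (Dv k)) 2 volume := fun k =>
    (memLp_indicator_iff_restrict hU.measurableSet).2 (hDv k)
  have hlim : ∀ g : SpaceTime n → ℝ, MemLp (U.indicator g) 2 volume →
      Tendsto (fun j => eLpNorm (fun z => ((φ j).normed volume
        ⋆[ContinuousLinearMap.lsmul ℝ ℝ, volume] U.indicator g) z - g z) 2 (volume.restrict K))
        atTop (𝓝 0) := by
    intro g hg
    refine tendsto_of_tendsto_of_tendsto_of_le_of_le tendsto_const_nhds
      (tendsto_eLpNorm_convolution_sub hφ hg) (fun _ => zero_le) fun j => ?_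
    refine le_trans (le_of_eq (eLpNorm_congr_ae ?_))
      (eLpNorm_mono_measure _ (Measure.restrict_le_self (s := K)))
    filter_upwards [ae_restrict_mem hK.measurableSet] with z hz
    rw [indicator_of_mem (hKU hz)]
  have hws : ∀ j, ContDiff ℝ ∞ (w j) := fun j =>
    (φ j).hasCompactSupport_normed.contDiff_convolution_left _ (φ j).contDiff_normed
      (hvi.locallyIntegrable (by norm_num))
  have hL2 := hlim v hvi
  -- `L²` convergence gives almost everywhere convergence only along a subsequence; the other two
  -- limits survive the extraction.
  obtain ⟨ns, hns, hae⟩ := (tendstoInMeasure_of_tendsto_eLpNorm (p := 2) (by norm_num)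
    (f := w) (fun j => (hws j).continuous.aestronglyMeasurable)
    (hv.1.mono_measure (Measure.restrict_mono hKU le_rfl)) hL2).exists_seq_tendsto_ae
  refine ⟨fun j => w (ns j), fun j => hws _, hae, hL2.comp hns.tendsto_atTop, fun k => ?_⟩
  refine ((hlim (Dv k) (hDvi k)).comp hns.tendsto_atTop).congr fun j => ?_
  refine eLpNorm_congr_ae ?_
  filter_upwards [ae_restrict_mem hK.measurableSet] with z hz
  rw [pd_convolution_eq hU.measurableSet hv hw]
  intro y hy
  refine hδU (Metric.closedBall_subset_cthickening hz _ (Metric.closedBall_subset_closedBall ?_ hy))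
  change δ / ((ns j : ℝ) + 1) ≤ δ
  exact div_le_self hδ.le (by linarith [(Nat.cast_nonneg (ns j) : (0 : ℝ) ≤ ns j)])

/-! ### Limits of integrals of products. -/

section Limits

variable {α : Type*} {mα : MeasurableSpace α} {ν : Measure α}

theorem tendsto_integral_bdd_mul {a : ℕ → α → ℝ} {a₀ h : α → ℝ} {C : ℝ}
    (ham : ∀ j, AEStronglyMeasurable (a j) ν) (hab : ∀ j, ∀ᵐ z ∂ν, |a j z| ≤ C)
    (hlim : ∀ᵐ z ∂ν, Tendsto (fun j => a j z) atTop (𝓝 (a₀ z))) (hh : Integrable h ν) :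
    Tendsto (fun j => ∫ z, a j z * h z ∂ν) atTop (𝓝 (∫ z, a₀ z * h z ∂ν)) := by
  refine tendsto_integral_of_dominated_convergence (fun z => C * |h z|)
    (fun j => (ham j).mul hh.1) (hh.abs.const_mul C) (fun j => ?_) ?_
  · filter_upwards [hab j] with z hz
    rw [Real.norm_eq_abs, abs_mul]
    gcongr
  · filter_upwards [hlim] with z hz using hz.mul_const _

/-- Splitting `f j = (f j - f₀) + f₀`: the difference contributes at most `|C| ‖f j - f₀‖₂ ‖g‖₂` by
Hölder, and with `f₀ g` integrable only the bounded factor varies, so dominated convergence applies.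
-/
theorem tendsto_integral_bdd_mul_mul {a f : ℕ → α → ℝ} {a₀ f₀ g : α → ℝ} {C : ℝ}
    (ham : ∀ j, AEStronglyMeasurable (a j) ν) (hab : ∀ j, ∀ᵐ z ∂ν, |a j z| ≤ C)
    (hlim : ∀ᵐ z ∂ν, Tendsto (fun j => a j z) atTop (𝓝 (a₀ z)))
    (hf : ∀ j, MemLp (f j) 2 ν) (hf₀ : MemLp f₀ 2 ν) (hg : MemLp g 2 ν)
    (hconv : Tendsto (fun j => eLpNorm (fun z => f j z - f₀ z) 2 ν) atTop (𝓝 0)) :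
    Tendsto (fun j => ∫ z, a j z * f j z * g z ∂ν) atTop (𝓝 (∫ z, a₀ z * f₀ z * g z ∂ν)) := by
  have h1 : Tendsto (fun j => ∫ z, a j z * (f₀ z * g z) ∂ν) atTop
      (𝓝 (∫ z, a₀ z * (f₀ z * g z) ∂ν)) :=
    tendsto_integral_bdd_mul ham hab hlim (hf₀.integrable_mul hg)
  have hi : ∀ j, Integrable (fun z => (f j z - f₀ z) * g z) ν := fun j =>
    ((hf j).sub hf₀).integrable_mul hg
  have hai : ∀ (j) (h : α → ℝ), Integrable h ν → Integrable (fun z => a j z * h z) ν :=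
    fun j h hh => hh.bdd_mul (ham j) (by simpa [Real.norm_eq_abs] using hab j)
  have h2 : Tendsto (fun j => ∫ z, a j z * ((f j z - f₀ z) * g z) ∂ν) atTop (𝓝 0) := by
    have h3 : Tendsto (fun j => ENNReal.ofReal |C| *
        (eLpNorm (fun z => f j z - f₀ z) 2 ν * eLpNorm g 2 ν)) atTop (𝓝 0) := by
      have := ENNReal.Tendsto.const_mul (a := ENNReal.ofReal |C|)
        (ENNReal.Tendsto.mul_const (b := eLpNorm g 2 ν) hconv (Or.inr hg.2.ne))
        (Or.inr ENNReal.ofReal_ne_top)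
      simpa using this
    refine tendsto_zero_iff_enorm_tendsto_zero.2
      (tendsto_of_tendsto_of_tendsto_of_le_of_le tendsto_const_nhds h3 (fun _ => zero_le)
        fun j => ?_)
    calc ‖∫ z, a j z * ((f j z - f₀ z) * g z) ∂ν‖ₑ
        ≤ ∫⁻ z, ‖a j z * ((f j z - f₀ z) * g z)‖ₑ ∂ν := enorm_integral_le_lintegral_enorm _
      _ ≤ ∫⁻ z, ENNReal.ofReal |C| * ‖(f j z - f₀ z) * g z‖ₑ ∂ν := by
          refine lintegral_mono_ae ?_
          filter_upwards [hab j] with z hz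
          rw [enorm_mul]
          gcongr
          rw [Real.enorm_eq_ofReal_abs]
          exact ENNReal.ofReal_le_ofReal (hz.trans (le_abs_self C))
      _ = ENNReal.ofReal |C| * eLpNorm ((fun z => f j z - f₀ z) • g) 1 ν := by
          rw [lintegral_const_mul' _ _ ENNReal.ofReal_ne_top, eLpNorm_one_eq_lintegral_enorm]
          rfl
      _ ≤ _ := by
          gcongr
          exact eLpNorm_smul_le_mul_eLpNorm hg.1 ((hf j).sub hf₀).1
  have h4 := h2.add h1
  rw [zero_add] at h4
  simp only [mul_assoc]
  refine h4.congr fun j => ?_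
  rw [← integral_add (hai j _ (hi j)) (hai j (fun z => f₀ z * g z) (hf₀.integrable_mul hg))]
  congr 1
  ext z
  ring

theorem integral_add_sum_add {ι : Type*} [Fintype ι] {a : α → ℝ} {b c : ι → α → ℝ}
    (ha : Integrable a ν) (hb : ∀ i, Integrable (b i) ν) (hc : ∀ i, Integrable (c i) ν) :
    ∫ z, (a z + ∑ i, (b i z + c i z)) ∂ν =
      (∫ z, a z ∂ν) + ∑ i, ((∫ z, b i z ∂ν) + ∫ z, c i z ∂ν) := by
  have h : ∀ i, Integrable (fun z => b i z + c i z) ν := fun i => (hb i).add (hc i)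
  rw [integral_add ha (integrable_finsetSum _ fun i _ => h i),
    integral_finsetSum _ fun i _ => h i]
  congr 1
  exact Finset.sum_congr rfl fun i _ => integral_add (hb i) (hc i)

end Limits

/-! ### Partial derivatives of test functions and the chain rule for squares. -/

theorem pd_mul {φ ψ : SpaceTime n → ℝ} (hφ : ContDiff ℝ ∞ φ) (hψ : ContDiff ℝ ∞ ψ)
    (k : Fin (n + 1)) (z : SpaceTime n) :
    pd k (fun z => φ z * ψ z) z = pd k φ z * ψ z + φ z * pd k ψ z := by
  have h := ((hφ.differentiable (by simp) z).hasFDerivAt.mul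
    (hψ.differentiable (by simp) z).hasFDerivAt)
  simp only [pd]
  rw [show (fun z => φ z * ψ z) = φ * ψ from rfl, h.fderiv]
  simp
  ring

theorem pd_comp {S : ℝ → ℝ} {φ : SpaceTime n → ℝ} (hS : ContDiff ℝ ∞ S) (hφ : ContDiff ℝ ∞ φ)
    (k : Fin (n + 1)) (z : SpaceTime n) :
    pd k (fun z => S (φ z)) z = deriv S (φ z) * pd k φ z := by
  have h := (hS.differentiable (by simp) (φ z)).hasDerivAt.comp_hasFDerivAt z
    (hφ.differentiable (by simp) z).hasFDerivAt
  simp only [pd]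
  rw [show (fun z => S (φ z)) = S ∘ φ from rfl, h.fderiv]
  simp

theorem contDiff_pd {φ : SpaceTime n → ℝ} (hφ : ContDiff ℝ ∞ φ) (k : Fin (n + 1)) :
    ContDiff ℝ ∞ (pd k φ) :=
  (hφ.fderiv_right (m := ∞) (by simp)).clm_apply contDiff_const

theorem pd_eq_zero_of_notMem_tsupport {φ : SpaceTime n → ℝ} (k : Fin (n + 1)) {z : SpaceTime n}
    (hz : z ∉ tsupport φ) : pd k φ z = 0 := by
  have : fderiv ℝ φ z = 0 := by
    by_contra h
    exact hz (support_fderiv_subset ℝ (Function.mem_support.2 h))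
  simp [pd, this]

theorem IsTest.mul {U : Set (SpaceTime n)} {φ ψ : SpaceTime n → ℝ} (hφ : IsTest U φ)
    (hψ : ContDiff ℝ ∞ ψ) : IsTest U (fun z => φ z * ψ z) :=
  ⟨hφ.smooth.mul hψ, hφ.compact.mul_right, (tsupport_mul_subset_left).trans hφ.subset⟩

theorem IsTest.partialDeriv {U : Set (SpaceTime n)} {φ : SpaceTime n → ℝ} (hφ : IsTest U φ)
    (k : Fin (n + 1)) : IsTest U (pd k φ) :=
  ⟨contDiff_pd hφ.smooth k, hφ.compact.fderiv_apply ℝ (dir k),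
    (closure_minimal (fun z (hz : pd k φ z ≠ 0) => by_contra fun h =>
      hz (pd_eq_zero_of_notMem_tsupport k h)) (isClosed_tsupport φ)).trans hφ.subset⟩

theorem exists_bound_of_hasCompactSupport {φ : SpaceTime n → ℝ} (hφ : Continuous φ)
    (hc : HasCompactSupport φ) : ∃ C, ∀ z, |φ z| ≤ C := by
  obtain ⟨C, hC⟩ := hc.exists_bound_of_continuous hφ
  exact ⟨C, hC⟩

theorem setIntegral_eq_of_tsupport {U K : Set (SpaceTime n)} (hK : K ⊆ U) (hU : MeasurableSet U)
    {h : SpaceTime n → ℝ} (h0 : ∀ z ∉ K, h z = 0) : ∫ z in U, h z = ∫ z in K, h z :=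
  setIntegral_eq_of_subset_of_forall_sdiff_eq_zero hU hK fun z hz => h0 z hz.2

theorem memLp_of_continuous_of_isCompact {K : Set (SpaceTime n)} (hK : IsCompact K)
    {w : SpaceTime n → ℝ} (hw : Continuous w) : MemLp w 2 (volume.restrict K) := by
  obtain ⟨C, hC⟩ := hK.exists_bound_of_continuousOn hw.continuousOn
  have : IsFiniteMeasure (volume.restrict K) := ⟨by simpa using hK.measure_lt_top⟩
  refine MemLp.of_bound hw.aestronglyMeasurable C ?_
  filter_upwards [ae_restrict_mem hK.measurableSet] with z hz using hC z hz

/-- This is `∂(v²) = 2v∂v` in weak form. Only one factor `v` is replaced by smooth approximants `w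
j`: then `φ w_j` is an admissible test function for the weak derivative of the other factor, and all
terms pass to the limit in `L²`. -/
theorem HasScalarWeakGrad.integral_mul_sq {U : Set (SpaceTime n)} (hU : IsOpen U)
    {v : SpaceTime n → ℝ} {Dv : Fin (n + 1) → SpaceTime n → ℝ}
    (hv : MemLp v 2 (volume.restrict U)) (hDv : ∀ k, MemLp (Dv k) 2 (volume.restrict U))
    (hw : HasScalarWeakGrad U v Dv) {φ : SpaceTime n → ℝ} (hφ : IsTest U φ) (k : Fin (n + 1)) :
    ∫ z in U, φ z * (2 * (v z * Dv k z)) = -∫ z in U, pd k φ z * v z ^ 2 := by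
  set K := tsupport φ with hKdef
  have hK : IsCompact K := hφ.compact
  obtain ⟨w, hwa⟩ := exists_smoothApprox hU hK hφ.subset hv hDv hw
  have hmono := Measure.restrict_mono hφ.subset (le_refl (volume : Measure (SpaceTime n)))
  have hvK : MemLp v 2 (volume.restrict K) := hv.mono_measure hmono
  have hDvK : ∀ k, MemLp (Dv k) 2 (volume.restrict K) := fun k => (hDv k).mono_measure hmono
  have hwK : ∀ j, MemLp (w j) 2 (volume.restrict K) := fun j =>
    memLp_of_continuous_of_isCompact hK (hwa.smooth j).continuous
  have hpwK : ∀ j, MemLp (pd k (w j)) 2 (volume.restrict K) := fun j =>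
    memLp_of_continuous_of_isCompact hK (contDiff_pd (hwa.smooth j) k).continuous
  have hp0 : ∀ z ∉ K, pd k φ z = 0 := fun z hz => pd_eq_zero_of_notMem_tsupport k hz
  have h0 : ∀ z ∉ K, φ z = 0 := fun z hz => image_eq_zero_of_notMem_tsupport hz
  obtain ⟨C₀, hC₀⟩ := exists_bound_of_hasCompactSupport hφ.smooth.continuous hφ.compact
  obtain ⟨C₁, hC₁⟩ := exists_bound_of_hasCompactSupport (hφ.partialDeriv k).smooth.continuous
    (hφ.partialDeriv k).compact
  have hs := hφ.smooth.continuous.aestronglyMeasurable (μ := volume.restrict K)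
  have hps := (hφ.partialDeriv k).smooth.continuous.aestronglyMeasurable (μ := volume.restrict K)
  have T1 := tendsto_integral_bdd_mul_mul (fun _ => hps) (fun _ => Eventually.of_forall hC₁)
    (Eventually.of_forall fun z => tendsto_const_nhds) hwK hvK hvK hwa.tendsto
  have T2 := tendsto_integral_bdd_mul_mul (fun _ => hs) (fun _ => Eventually.of_forall hC₀)
    (Eventually.of_forall fun z => tendsto_const_nhds) hpwK (hDvK k) hvK (hwa.tendsto_pd k)
  have T3 := tendsto_integral_bdd_mul_mul (fun _ => hs) (fun _ => Eventually.of_forall hC₀)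
    (Eventually.of_forall fun z => tendsto_const_nhds) hwK hvK (hDvK k) hwa.tendsto
  have hint : ∀ {a f g : SpaceTime n → ℝ} {C : ℝ}, AEStronglyMeasurable a (volume.restrict K) →
      (∀ z, |a z| ≤ C) → MemLp f 2 (volume.restrict K) → MemLp g 2 (volume.restrict K) →
      Integrable (fun z => a z * f z * g z) (volume.restrict K) := by
    intro a f g C ha hC hf hg
    simp only [mul_assoc]
    exact (hf.integrable_mul hg).bdd_mul ha (Eventually.of_forall hC)
  have hj : ∀ j, (∫ z in K, pd k φ z * w j z * v z) + ∫ z in K, φ z * pd k (w j) z * v z =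
      -∫ z in K, φ z * w j z * Dv k z := by
    intro j
    have h := hw k _ (hφ.mul (hwa.smooth j))
    rw [setIntegral_eq_of_tsupport hφ.subset hU.measurableSet
      (fun z hz => by simp [pd_mul hφ.smooth (hwa.smooth j), h0 z hz, hp0 z hz]),
      setIntegral_eq_of_tsupport hφ.subset hU.measurableSet
      (fun z hz => by simp [h0 z hz])] at h
    rw [← h, ← integral_add (hint hps hC₁ (hwK j) hvK) (hint hs hC₀ (hpwK j) hvK)]
    refine integral_congr_ae (Eventually.of_forall fun z => ?_)
    simp only [pd_mul hφ.smooth (hwa.smooth j)]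
    ring
  have hlim := tendsto_nhds_unique ((T1.add T2).congr hj) T3.neg
  rw [setIntegral_eq_of_tsupport hφ.subset hU.measurableSet (fun z hz => by simp [h0 z hz]),
    setIntegral_eq_of_tsupport hφ.subset hU.measurableSet (fun z hz => by simp [hp0 z hz])]
  have e1 : ∫ z in K, φ z * (2 * (v z * Dv k z)) =
      (∫ z in K, φ z * Dv k z * v z) + ∫ z in K, φ z * v z * Dv k z := by
    rw [← integral_add (hint hs hC₀ (hDvK k) hvK) (hint hs hC₀ hvK (hDvK k))]
    congr 1; ext z; ring
  have e2 : ∫ z in K, pd k φ z * v z ^ 2 = ∫ z in K, pd k φ z * v z * v z := by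
    congr 1; ext z; ring
  rw [e1, e2]
  linarith

/-! ### Testing a scalar weak equation with its own solution. -/

/-- The bounded truncation `N sin(s/N)` of the identity. -/
def sinTrunc (N s : ℝ) : ℝ := N * Real.sin (N⁻¹ * s)

theorem contDiff_sinTrunc (N : ℝ) : ContDiff ℝ ∞ (sinTrunc N) :=
  contDiff_const.mul (Real.contDiff_sin.comp (contDiff_const.mul contDiff_id))

theorem deriv_sinTrunc {N : ℝ} (hN : N ≠ 0) (s : ℝ) : deriv (sinTrunc N) s = Real.cos (N⁻¹ * s) := by
  have h : HasDerivAt (sinTrunc N) (N * (Real.cos (N⁻¹ * s) * (N⁻¹ * 1))) s :=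
    (((hasDerivAt_id s).const_mul N⁻¹).sin).const_mul N
  rw [h.deriv]
  field_simp

theorem abs_sinTrunc_le {N : ℝ} (hN : 0 ≤ N) (s : ℝ) : |sinTrunc N s| ≤ N := by
  rw [sinTrunc, abs_mul, abs_of_nonneg hN]
  exact mul_le_of_le_one_right hN (Real.abs_sin_le_one _)

theorem abs_sinTrunc_le_abs {N : ℝ} (hN : 0 < N) (s : ℝ) : |sinTrunc N s| ≤ |s| := by
  rw [sinTrunc, abs_mul, abs_of_pos hN]
  calc N * |Real.sin (N⁻¹ * s)| ≤ N * |N⁻¹ * s| := by exact mul_le_mul_of_nonneg_left Real.abs_sin_le_abs hN.le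
    _ = |s| := by rw [abs_mul, abs_of_pos (inv_pos.2 hN)]; field_simp

theorem tendsto_inv_natCast_succ_mul (s : ℝ) :
    Tendsto (fun N : ℕ => ((N : ℝ) + 1)⁻¹ * s) atTop (𝓝 0) := by
  have : Tendsto (fun N : ℕ => ((N : ℝ) + 1)⁻¹) atTop (𝓝 0) := by
    simpa using tendsto_one_div_add_atTop_nhds_zero_nat (𝕜 := ℝ)
  simpa using this.mul_const s

theorem tendsto_sinTrunc (s : ℝ) :
    Tendsto (fun N : ℕ => sinTrunc ((N : ℝ) + 1) s) atTop (𝓝 s) := by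
  have h : HasDerivAt (fun x : ℝ => Real.sin (x * s)) s 0 := by
    have := ((hasDerivAt_id (0 : ℝ)).mul_const s).sin
    simpa using this
  have h2 := h.tendsto_slope_zero_right
  have h3 : Tendsto (fun N : ℕ => ((N : ℝ) + 1)⁻¹) atTop (𝓝[>] 0) := by
    refine tendsto_nhdsWithin_iff.2 ⟨?_, Eventually.of_forall fun N => by simp; positivity⟩
    simpa using tendsto_one_div_add_atTop_nhds_zero_nat (𝕜 := ℝ)
  refine (h2.comp h3).congr fun N => ?_
  simp [sinTrunc]

section WeakEquation

variable {U : Set (SpaceTime n)} {v g : SpaceTime n → ℝ} {Dv : Fin (n + 1) → SpaceTime n → ℝ}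

/-- Since `g` is only locally integrable, the multiplier must stay bounded while the approximants
converge. The test functions `φ sinTrunc N (w j)` are smooth and bounded uniformly in `j`, and they
converge almost everywhere on the support of `φ`. -/
theorem integral_truncation_mul_weakEquation (hU : IsOpen U)
    (hv : MemLp v 2 (volume.restrict U)) (hDv : ∀ k, MemLp (Dv k) 2 (volume.restrict U))
    (hw : HasScalarWeakGrad U v Dv) (hg : LocallyIntegrableOn g U)
    (heq : ∀ φ, IsTest U φ →
      ∫ z in U, (φ z * Dv 0 z + ∑ j : Fin n, pd j.succ φ z * Dv j.succ z) = ∫ z in U, φ z * g z)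
    {φ : SpaceTime n → ℝ} (hφ : IsTest U φ) {N : ℝ} (hN : 0 < N) :
    (∫ z in tsupport φ, φ z * sinTrunc N (v z) * Dv 0 z) +
      ∑ j : Fin n, ((∫ z in tsupport φ, pd j.succ φ z * sinTrunc N (v z) * Dv j.succ z) +
        ∫ z in tsupport φ, φ z * Real.cos (N⁻¹ * v z) * (Dv j.succ z * Dv j.succ z)) =
      ∫ z in tsupport φ, φ z * sinTrunc N (v z) * g z := by
  set K := tsupport φ with hKdef
  have hK : IsCompact K := hφ.compact
  obtain ⟨w, hwa⟩ := exists_smoothApprox hU hK hφ.subset hv hDv hw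
  have hmono := Measure.restrict_mono hφ.subset (le_refl (volume : Measure (SpaceTime n)))
  have : IsFiniteMeasure (volume.restrict K) := ⟨by simpa using hK.measure_lt_top⟩
  have hDvK : ∀ k, MemLp (Dv k) 2 (volume.restrict K) := fun k => (hDv k).mono_measure hmono
  have hDvI : ∀ k, Integrable (Dv k) (volume.restrict K) := fun k =>
    (hDvK k).integrable (by norm_num)
  have hgK : Integrable g (volume.restrict K) := hg.integrableOn_compact_subset hφ.subset hK
  have hp0 : ∀ z ∉ K, ∀ k, pd k φ z = 0 := fun z hz k => pd_eq_zero_of_notMem_tsupport k hz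
  have h0 : ∀ z ∉ K, φ z = 0 := fun z hz => image_eq_zero_of_notMem_tsupport hz
  obtain ⟨C₀, hC₀⟩ := exists_bound_of_hasCompactSupport hφ.smooth.continuous hφ.compact
  have hC₀n : 0 ≤ C₀ := (abs_nonneg _).trans (hC₀ 0)
  choose C₁ hC₁ using fun k => exists_bound_of_hasCompactSupport
    (hφ.partialDeriv k).smooth.continuous (hφ.partialDeriv k).compact
  have hSw : ∀ j, ContDiff ℝ ∞ fun z => sinTrunc N (w j z) := fun j =>
    (contDiff_sinTrunc N).comp (hwa.smooth j)
  have hlimS : ∀ᵐ z ∂volume.restrict K,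
      Tendsto (fun j => sinTrunc N (w j z)) atTop (𝓝 (sinTrunc N (v z))) := by
    filter_upwards [hwa.ae_tendsto] with z hz
    exact ((contDiff_sinTrunc N).continuous.tendsto _).comp hz
  have hcos : Continuous fun s : ℝ => Real.cos (N⁻¹ * s) := by fun_prop
  have hms : ∀ {a : SpaceTime n → ℝ}, Continuous a → ∀ j,
      AEStronglyMeasurable (fun z => a z * sinTrunc N (w j z)) (volume.restrict K) :=
    fun ha j => (ha.mul (hSw j).continuous).aestronglyMeasurable
  have hmc : ∀ j, AEStronglyMeasurable (fun z => φ z * Real.cos (N⁻¹ * w j z))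
      (volume.restrict K) := fun j =>
    (hφ.smooth.continuous.mul (hcos.comp (hwa.smooth j).continuous)).aestronglyMeasurable
  have hbs : ∀ {a : SpaceTime n → ℝ} {C : ℝ}, (∀ z, |a z| ≤ C) → ∀ j z,
      |a z * sinTrunc N (w j z)| ≤ C * N := by
    intro a C hC j z
    rw [abs_mul]
    exact mul_le_mul (hC z) (abs_sinTrunc_le hN.le _) (abs_nonneg _) ((abs_nonneg _).trans (hC z))
  have hbc : ∀ j z, |φ z * Real.cos (N⁻¹ * w j z)| ≤ C₀ := by
    intro j z
    rw [abs_mul]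
    exact (mul_le_of_le_one_right (abs_nonneg _) (Real.abs_cos_le_one _)).trans (hC₀ z)
  have hpwK : ∀ k j, MemLp (pd k (w j)) 2 (volume.restrict K) := fun k j =>
    memLp_of_continuous_of_isCompact hK (contDiff_pd (hwa.smooth j) k).continuous
  have T0 := tendsto_integral_bdd_mul (hms hφ.smooth.continuous)
    (fun j => Eventually.of_forall (hbs hC₀ j)) (hlimS.mono fun z hz => hz.const_mul (φ z))
    (hDvI 0)
  have T1 := fun i : Fin n => tendsto_integral_bdd_mul
    (hms (hφ.partialDeriv i.succ).smooth.continuous)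
    (fun j => Eventually.of_forall (hbs (hC₁ i.succ) j))
    (hlimS.mono fun z hz => hz.const_mul (pd i.succ φ z)) (hDvI i.succ)
  have hlimc : ∀ᵐ z ∂volume.restrict K,
      Tendsto (fun j => φ z * Real.cos (N⁻¹ * w j z)) atTop (𝓝 (φ z * Real.cos (N⁻¹ * v z))) := by
    filter_upwards [hwa.ae_tendsto] with z hz
    exact ((hcos.tendsto _).comp hz).const_mul _
  -- Differentiating the truncation produces the bounded factor `cos(w j / N)` times `∂_i w_j`, and
  -- the latter converges in `L²`.
  have T2 := fun i : Fin n => tendsto_integral_bdd_mul_mul hmc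
    (fun j => Eventually.of_forall (hbc j)) hlimc (hpwK i.succ) (hDvK i.succ) (hDvK i.succ)
    (hwa.tendsto_pd i.succ)
  have T3 := tendsto_integral_bdd_mul (hms hφ.smooth.continuous)
    (fun j => Eventually.of_forall (hbs hC₀ j)) (hlimS.mono fun z hz => hz.const_mul (φ z)) hgK
  have hj : ∀ j, (∫ z in K, φ z * sinTrunc N (w j z) * Dv 0 z) +
      ∑ i : Fin n, ((∫ z in K, pd i.succ φ z * sinTrunc N (w j z) * Dv i.succ z) +
        ∫ z in K, φ z * Real.cos (N⁻¹ * w j z) * pd i.succ (w j) z * Dv i.succ z) =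
      ∫ z in K, φ z * sinTrunc N (w j z) * g z := by
    intro j
    have hpd : ∀ k z, pd k (fun z => φ z * sinTrunc N (w j z)) z =
        pd k φ z * sinTrunc N (w j z) + φ z * Real.cos (N⁻¹ * w j z) * pd k (w j) z := by
      intro k z
      rw [pd_mul hφ.smooth (hSw j), pd_comp (contDiff_sinTrunc N) (hwa.smooth j),
        deriv_sinTrunc hN.ne', mul_assoc]
    have h := heq _ (hφ.mul (hSw j))
    rw [setIntegral_eq_of_tsupport hφ.subset hU.measurableSet
      (fun z hz => by simp [hpd, h0 z hz, hp0 z hz]),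
      setIntegral_eq_of_tsupport hφ.subset hU.measurableSet
      (fun z hz => by simp [h0 z hz])] at h
    have i0 : Integrable (fun z => φ z * sinTrunc N (w j z) * Dv 0 z) (volume.restrict K) :=
      (hDvI 0).bdd_mul (hms hφ.smooth.continuous j) (Eventually.of_forall (hbs hC₀ j))
    have i1 : ∀ i : Fin n, Integrable (fun z => pd i.succ φ z * sinTrunc N (w j z) * Dv i.succ z)
        (volume.restrict K) := fun i =>
      (hDvI i.succ).bdd_mul (hms (hφ.partialDeriv i.succ).smooth.continuous j)
        (Eventually.of_forall (hbs (hC₁ i.succ) j))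
    have i2 : ∀ i : Fin n, Integrable (fun z => φ z * Real.cos (N⁻¹ * w j z) *
        pd i.succ (w j) z * Dv i.succ z) (volume.restrict K) := fun i => by
      simp only [mul_assoc _ (pd _ _ _) _]
      exact ((hpwK i.succ j).integrable_mul (hDvK i.succ)).bdd_mul (hmc j)
        (Eventually.of_forall (hbc j))
    rw [← h]
    simp only [hpd, add_mul]
    exact (integral_add_sum_add i0 i1 i2).symm
  have hlim := tendsto_nhds_unique
    ((T0.add (tendsto_finsetSum _ fun i _ => (T1 i).add (T2 i))).congr hj) T3
  simpa only [mul_assoc] using hlim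

/-- Testing the equation with the solution itself. -/
theorem integral_self_mul_weakEquation (hU : IsOpen U)
    (hv : MemLp v 2 (volume.restrict U)) (hDv : ∀ k, MemLp (Dv k) 2 (volume.restrict U))
    (hw : HasScalarWeakGrad U v Dv) (hg : LocallyIntegrableOn g U)
    (hvg : IntegrableOn (fun z => v z * g z) U)
    (heq : ∀ φ, IsTest U φ →
      ∫ z in U, (φ z * Dv 0 z + ∑ j : Fin n, pd j.succ φ z * Dv j.succ z) = ∫ z in U, φ z * g z)
    {φ : SpaceTime n → ℝ} (hφ : IsTest U φ) :
    ∫ z in U, (φ z * (v z * Dv 0 z) +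
      ∑ j : Fin n, (pd j.succ φ z * (v z * Dv j.succ z) + φ z * Dv j.succ z ^ 2)) =
      ∫ z in U, φ z * (v z * g z) := by
  set K := tsupport φ with hKdef
  have hK : IsCompact K := hφ.compact
  have hmono := Measure.restrict_mono hφ.subset (le_refl (volume : Measure (SpaceTime n)))
  have hDvK : ∀ k, MemLp (Dv k) 2 (volume.restrict K) := fun k => (hDv k).mono_measure hmono
  have hvK : MemLp v 2 (volume.restrict K) := hv.mono_measure hmono
  have hgK : Integrable g (volume.restrict K) := hg.integrableOn_compact_subset hφ.subset hK
  have hvgK : Integrable (fun z => v z * g z) (volume.restrict K) :=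
    IntegrableOn.mono_set hvg hφ.subset
  have hp0 : ∀ z ∉ K, ∀ k, pd k φ z = 0 := fun z hz k => pd_eq_zero_of_notMem_tsupport k hz
  have h0 : ∀ z ∉ K, φ z = 0 := fun z hz => image_eq_zero_of_notMem_tsupport hz
  obtain ⟨C₀, hC₀⟩ := exists_bound_of_hasCompactSupport hφ.smooth.continuous hφ.compact
  choose C₁ hC₁ using fun k => exists_bound_of_hasCompactSupport
    (hφ.partialDeriv k).smooth.continuous (hφ.partialDeriv k).compact
  have hSm : ∀ N, AEStronglyMeasurable (fun z => sinTrunc N (v z)) (volume.restrict K) := fun N =>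
    (contDiff_sinTrunc N).continuous.comp_aestronglyMeasurable hvK.1
  -- Now the truncation level tends to infinity. Because `|N sin(s/N)| ≤ |s|`, the function `C |v
  -- h|` is a majorant independent of `N`; for `h = g` this is where the integrability of `v g`
  -- enters.
  have hT : ∀ {a h : SpaceTime n → ℝ} {C : ℝ}, Continuous a → (∀ z, |a z| ≤ C) →
      AEStronglyMeasurable h (volume.restrict K) →
      Integrable (fun z => v z * h z) (volume.restrict K) →
      Tendsto (fun N : ℕ => ∫ z in K, a z * sinTrunc ((N : ℝ) + 1) (v z) * h z) atTop
        (𝓝 (∫ z in K, a z * (v z * h z))) := by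
    intro a h C ha hC hhm hh
    refine tendsto_integral_of_dominated_convergence (fun z => C * |v z * h z|)
      (fun N => (ha.aestronglyMeasurable.mul (hSm _)).mul hhm) (hh.abs.const_mul C)
      (fun N => Eventually.of_forall fun z => ?_) (Eventually.of_forall fun z => ?_)
    · rw [Real.norm_eq_abs, mul_assoc, abs_mul, abs_mul, abs_mul]
      have := abs_sinTrunc_le_abs (N := (N : ℝ) + 1) (by positivity) (v z)
      have := hC z
      have := (abs_nonneg _).trans this
      gcongr
    · simp only [mul_assoc]
      exact ((tendsto_sinTrunc (v z)).mul_const _).const_mul _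
  have T0 := hT hφ.smooth.continuous hC₀ (hDvK 0).1 (hvK.integrable_mul (hDvK 0))
  have T1 := fun i : Fin n => hT (hφ.partialDeriv i.succ).smooth.continuous (hC₁ i.succ)
    (hDvK i.succ).1 (hvK.integrable_mul (hDvK i.succ))
  have T3 := hT hφ.smooth.continuous hC₀ hgK.1 hvgK
  have T2 : ∀ i : Fin n, Tendsto (fun N : ℕ => ∫ z in K, φ z * Real.cos (((N : ℝ) + 1)⁻¹ * v z) *
      (Dv i.succ z * Dv i.succ z)) atTop (𝓝 (∫ z in K, φ z * (Dv i.succ z * Dv i.succ z))) := by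
    intro i
    refine tendsto_integral_bdd_mul (C := C₀) (fun N => ?_) (fun N => Eventually.of_forall fun z => ?_)
      (Eventually.of_forall fun z => ?_) ((hDvK i.succ).integrable_mul (hDvK i.succ))
    · exact hφ.smooth.continuous.aestronglyMeasurable.mul
        ((by fun_prop : Continuous fun s : ℝ =>
          Real.cos (((N : ℝ) + 1)⁻¹ * s)).comp_aestronglyMeasurable hvK.1)
    · rw [abs_mul]
      exact (mul_le_of_le_one_right (abs_nonneg _) (Real.abs_cos_le_one _)).trans (hC₀ z)
    · have := (Real.continuous_cos.tendsto _).comp (tendsto_inv_natCast_succ_mul (v z))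
      rw [Real.cos_zero] at this
      simpa using this.const_mul (φ z)
  have hlim := tendsto_nhds_unique
    ((T0.add (tendsto_finsetSum _ fun i _ => (T1 i).add (T2 i))).congr fun N =>
      integral_truncation_mul_weakEquation hU hv hDv hw hg heq hφ (by positivity)) T3
  rw [setIntegral_eq_of_tsupport hφ.subset hU.measurableSet
      (fun z hz => by simp [h0 z hz, hp0 z hz]),
    setIntegral_eq_of_tsupport hφ.subset hU.measurableSet (fun z hz => by simp [h0 z hz]), ← hlim]
  have hint : ∀ {a h : SpaceTime n → ℝ} {C : ℝ}, Continuous a → (∀ z, |a z| ≤ C) →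
      Integrable h (volume.restrict K) → Integrable (fun z => a z * h z) (volume.restrict K) :=
    fun ha hC hh => hh.bdd_mul ha.aestronglyMeasurable (Eventually.of_forall hC)
  have i0 := hint hφ.smooth.continuous hC₀ (hvK.integrable_mul (hDvK 0))
  have i1 := fun i : Fin n => hint (hφ.partialDeriv i.succ).smooth.continuous (hC₁ i.succ)
    (hvK.integrable_mul (hDvK i.succ))
  have i2 := fun i : Fin n => hint hφ.smooth.continuous hC₀
    ((hDvK i.succ).integrable_mul (hDvK i.succ))
  simp only [pow_two]
  simp only [Pi.mul_apply] at i0 i1 i2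
  exact integral_add_sum_add i0 i1 i2

end WeakEquation

/-! ### From components to the system. -/

theorem measurableSet_strip (a b : ℝ) : MeasurableSet (strip n a b) :=
  measurableSet_Ioo.prod MeasurableSet.univ

theorem isOpen_strip (a b : ℝ) : IsOpen (strip n a b) := isOpen_Ioo.prod isOpen_univ

theorem mem_strip {a b : ℝ} {z : SpaceTime n} : z ∈ strip n a b ↔ a < z.1 ∧ z.1 < b := by
  simp [strip]

theorem IsTest.integrable_smul {X : Type*} [NormedAddCommGroup X] [NormedSpace ℝ X]
    {U : Set (SpaceTime n)} {φ : SpaceTime n → ℝ} (hφ : IsTest U φ)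
    {h : SpaceTime n → X} (hh : LocallyIntegrableOn h U) : IntegrableOn (fun z => φ z • h z) U := by
  obtain ⟨C, hC⟩ := exists_bound_of_hasCompactSupport hφ.smooth.continuous hφ.compact
  have h1 : IntegrableOn (fun z => φ z • h z) (tsupport φ) :=
    (hh.integrableOn_compact_subset hφ.subset hφ.compact).bdd_smul C
      hφ.smooth.continuous.aestronglyMeasurable (Eventually.of_forall hC)
  exact ((integrableOn_iff_integrable_of_support_subset (fun z hz => by
    by_contra h
    exact hz (by simp [image_eq_zero_of_notMem_tsupport h]))).1 h1).integrableOn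

theorem IsTest.integrable_mul {U : Set (SpaceTime n)} {φ : SpaceTime n → ℝ} (hφ : IsTest U φ)
    {h : SpaceTime n → ℝ} (hh : LocallyIntegrableOn h U) : IntegrableOn (fun z => φ z * h z) U :=
  hφ.integrable_smul hh

theorem hasScalarWeakGrad_apply {U : Set (SpaceTime n)}
    {u : SpaceTime n → EuclideanSpace ℝ (Fin m)}
    {Du : Fin (n + 1) → SpaceTime n → EuclideanSpace ℝ (Fin m)} (h : MemH1 U u Du) (i : Fin m) :
    HasScalarWeakGrad U (fun z => u z i) (fun k z => Du k z i) := by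
  intro k φ hφ
  have h1 := congrArg (fun v => EuclideanSpace.proj (𝕜 := ℝ) i v) (h.weakGrad k φ hφ)
  simp only [map_neg] at h1
  rw [← ContinuousLinearMap.integral_comp_comm _ (integrable_smul_of_memLp (hφ.memLp_pd k) h.memLp),
    ← ContinuousLinearMap.integral_comp_comm _ (integrable_smul_of_memLp hφ.memLp (h.memLp_grad k))]
    at h1
  simpa using h1

theorem memLp_apply {ν : Measure (SpaceTime n)} {u : SpaceTime n → EuclideanSpace ℝ (Fin m)}
    (h : MemLp u 2 ν) (i : Fin m) : MemLp (fun z => u z i) 2 ν :=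
  (EuclideanSpace.proj (𝕜 := ℝ) i).comp_memLp' h

theorem real_inner_eq_sum (x y : EuclideanSpace ℝ (Fin m)) : ⟪x, y⟫ = ∑ i, x i * y i := by
  simp [PiLp.inner_apply, mul_comm]

theorem norm_sq_eq_sum (x : EuclideanSpace ℝ (Fin m)) : ‖x‖ ^ 2 = ∑ i, x i ^ 2 := by
  rw [← real_inner_self_eq_norm_sq, real_inner_eq_sum]
  simp [pow_two]

theorem integrable_inner {U : Set (SpaceTime n)} {f g : SpaceTime n → EuclideanSpace ℝ (Fin m)}
    (hf : MemLp f 2 (volume.restrict U)) (hg : MemLp g 2 (volume.restrict U)) :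
    IntegrableOn (fun z => ⟪f z, g z⟫) U := by
  simp only [real_inner_eq_sum]
  exact integrable_finsetSum _ fun i _ => (memLp_apply hf i).integrable_mul (memLp_apply hg i)

section Identities

variable {U : Set (SpaceTime n)} {u : SpaceTime n → EuclideanSpace ℝ (Fin m)}
  {Du : Fin (n + 1) → SpaceTime n → EuclideanSpace ℝ (Fin m)}

theorem MemH1.integral_mul_norm_sq (h : MemH1 U u Du) (hU : IsOpen U) {θ : SpaceTime n → ℝ}
    (hθ : IsTest U θ) (k : Fin (n + 1)) :
    ∫ z in U, θ z * (2 * ⟪u z, Du k z⟫) = -∫ z in U, pd k θ z * ‖u z‖ ^ 2 := by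
  have hl : ∀ {a : SpaceTime n → ℝ}, IntegrableOn a U → LocallyIntegrableOn a U :=
    fun ha => ha.locallyIntegrableOn
  simp only [real_inner_eq_sum, norm_sq_eq_sum, Finset.mul_sum]
  rw [integral_finsetSum, integral_finsetSum, ← Finset.sum_neg_distrib]
  · exact Finset.sum_congr rfl fun i _ => (hasScalarWeakGrad_apply h i).integral_mul_sq hU
      (memLp_apply h.memLp i) (fun k => memLp_apply (h.memLp_grad k) i) hθ k
  · intro i _
    exact (hθ.partialDeriv k).integrable_mul (hl (memLp_apply h.memLp i).integrable_sq)
  · intro i _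
    exact hθ.integrable_mul (hl (((memLp_apply h.memLp i).integrable_mul
      (memLp_apply (h.memLp_grad k) i)).const_mul 2))

/-- The scalar result applies to each component because `u_i f_i` is integrable for every single
`i`; the components are summed at the end. -/
theorem integral_self_mul_system (hU : IsOpen U) (h : MemH1 U u Du)
    {f : SpaceTime n → EuclideanSpace ℝ (Fin m)}
    (hf : LocallyIntegrableOn f U) (huf : ∀ i, IntegrableOn (fun z => u z i * f z i) U)
    (heq : ∀ φ : SpaceTime n → ℝ, IsTest U φ →
      ∫ z in U, (pd 0 φ z + ∑ j : Fin n, pd j.succ (pd j.succ φ) z) • u z =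
        -∫ z in U, φ z • f z) {θ : SpaceTime n → ℝ} (hθ : IsTest U θ) :
    ∫ z in U, (θ z * ⟪u z, Du 0 z⟫ +
      ∑ j : Fin n, (pd j.succ θ z * ⟪u z, Du j.succ z⟫ + θ z * ‖Du j.succ z‖ ^ 2)) =
      ∫ z in U, θ z * ⟪u z, f z⟫ := by
  have hl : ∀ {a : SpaceTime n → ℝ}, IntegrableOn a U → LocallyIntegrableOn a U :=
    fun ha => ha.locallyIntegrableOn
  have hfi : ∀ i, LocallyIntegrableOn (fun z => f z i) U := fun i z hz => by
    obtain ⟨s, hs, hs'⟩ := hf z hz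
    exact ⟨s, hs, (EuclideanSpace.proj (𝕜 := ℝ) i).integrable_comp hs'⟩
  -- One derivative of the heat operator is moved from `φ` onto `u` by the weak gradient. In the
  -- Laplacian the weak gradient is tested with `∂_j φ`, which is again a test function.
  have hcomp : ∀ i, ∀ φ, IsTest U φ →
      ∫ z in U, (φ z * Du 0 z i + ∑ j : Fin n, pd j.succ φ z * Du j.succ z i) =
        ∫ z in U, φ z * f z i := by
    intro i φ hφ
    have hw := hasScalarWeakGrad_apply h i
    have hui := memLp_apply h.memLp i
    have hLp : MemLp (fun z => pd 0 φ z + ∑ j : Fin n, pd j.succ (pd j.succ φ) z) 2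
        (volume.restrict U) :=
      (hφ.memLp_pd 0).add (memLp_finsetSum _ fun j _ => (hφ.partialDeriv j.succ).memLp_pd j.succ)
    have hproj : ∀ x : EuclideanSpace ℝ (Fin m), EuclideanSpace.proj (𝕜 := ℝ) i x = x i :=
      fun _ => rfl
    have h1 := congrArg (fun v => EuclideanSpace.proj (𝕜 := ℝ) i v) (heq φ hφ)
    simp only [map_neg] at h1
    rw [← ContinuousLinearMap.integral_comp_comm _ (integrable_smul_of_memLp hLp h.memLp),
      ← ContinuousLinearMap.integral_comp_comm _ (hφ.integrable_smul hf)] at h1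
    simp only [hproj, PiLp.smul_apply, smul_eq_mul, add_mul, Finset.sum_mul] at h1
    have j1 := ((hφ.memLp_pd 0).integrable_mul hui)
    have j2 := fun j : Fin n => (((hφ.partialDeriv j.succ).memLp_pd j.succ).integrable_mul hui)
    have l1 := hφ.memLp.integrable_mul (memLp_apply (h.memLp_grad 0) i)
    have l2 := fun j : Fin n => (hφ.memLp_pd j.succ).integrable_mul
      (memLp_apply (h.memLp_grad j.succ) i)
    simp only [Pi.mul_def] at j1 j2 l1 l2
    rw [integral_add j1 (integrable_finsetSum _ fun j _ => j2 j),
      integral_finsetSum _ fun j _ => j2 j, hw 0 φ hφ,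
      Finset.sum_congr rfl fun j _ => hw j.succ _ (hφ.partialDeriv j.succ)] at h1
    rw [integral_add l1 (integrable_finsetSum _ fun j _ => l2 j),
      integral_finsetSum _ fun j _ => l2 j]
    simp only [Finset.sum_neg_distrib] at h1
    linarith
  have hB := fun i => integral_self_mul_weakEquation hU (memLp_apply h.memLp i)
    (fun k => memLp_apply (h.memLp_grad k) i) (hasScalarWeakGrad_apply h i) (hfi i) (huf i)
    (hcomp i) hθ
  have i0 := fun i => hθ.integrable_mul (hl ((memLp_apply h.memLp i).integrable_mul
      (memLp_apply (h.memLp_grad 0) i)))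
  have i1 := fun (i : Fin m) (j : Fin n) => (hθ.partialDeriv j.succ).integrable_mul
    (hl ((memLp_apply h.memLp i).integrable_mul (memLp_apply (h.memLp_grad j.succ) i)))
  have i2 := fun (i : Fin m) (j : Fin n) => hθ.integrable_mul
    (hl (memLp_apply (h.memLp_grad j.succ) i).integrable_sq)
  have i3 := fun i => hθ.integrable_mul (hl (huf i))
  have e2 : ∫ z in U, θ z * ⟪u z, f z⟫ = ∑ i, ∫ z in U, θ z * (u z i * f z i) := by
    rw [← integral_finsetSum _ fun i _ => i3 i]
    simp only [real_inner_eq_sum, Finset.mul_sum]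
  rw [e2, ← Finset.sum_congr rfl fun i _ => hB i, ← integral_finsetSum]
  · congr 1
    ext z
    simp only [real_inner_eq_sum, norm_sq_eq_sum, Finset.mul_sum, Finset.sum_add_distrib]
    rw [Finset.sum_comm (s := (Finset.univ : Finset (Fin n))),
      Finset.sum_comm (s := (Finset.univ : Finset (Fin n)))]
  · intro i _
    exact (i0 i).add (integrable_finsetSum _ fun j _ => (i1 i j).add (i2 i j))

end Identities

/-! ### The first variation along the dilation field. -/

/-- The generator `(2(t - T), x - x₀)` of the parabolic dilations about `(T, x₀)`. -/
def dilationField (T : ℝ) (x₀ : EuclideanSpace ℝ (Fin n)) (k : Fin (n + 1)) (z : SpaceTime n) : ℝ :=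
  (Fin.cons (2 * (z.1 - T)) (fun j => (z.2 - x₀) j) : Fin (n + 1) → ℝ) k

/-- `2(t - T) ∂_t u + (x - x₀) · ∇u`. -/
def dilationDeriv (T : ℝ) (x₀ : EuclideanSpace ℝ (Fin n))
    (Du : Fin (n + 1) → SpaceTime n → EuclideanSpace ℝ (Fin m)) (z : SpaceTime n) :
    EuclideanSpace ℝ (Fin m) :=
  ∑ k, dilationField T x₀ k z • Du k z

section Field

variable (T : ℝ) (x₀ : EuclideanSpace ℝ (Fin n))

@[simp] theorem dilationField_zero (z : SpaceTime n) : dilationField T x₀ 0 z = 2 * (z.1 - T) := rfl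

@[simp] theorem dilationField_succ (j : Fin n) (z : SpaceTime n) :
    dilationField T x₀ j.succ z = z.2 j - x₀ j := rfl

theorem contDiff_dilationField (k : Fin (n + 1)) : ContDiff ℝ ∞ (dilationField T x₀ k) := by
  refine Fin.cases ?_ (fun j => ?_) k
  · exact contDiff_const.mul (contDiff_fst.sub contDiff_const)
  · exact ((EuclideanSpace.proj (𝕜 := ℝ) j).contDiff.comp contDiff_snd).sub contDiff_const

theorem pd_dilationField_zero (k : Fin (n + 1)) (z : SpaceTime n) :
    pd k (dilationField T x₀ 0) z = if k = 0 then 2 else 0 := by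
  have h : HasFDerivAt (dilationField T x₀ 0) ((2 : ℝ) • ContinuousLinearMap.fst ℝ ℝ
      (EuclideanSpace ℝ (Fin n))) z := (hasFDerivAt_fst.sub_const T).const_mul 2
  rw [pd, h.fderiv]
  refine Fin.cases ?_ (fun j => ?_) k <;> simp [dir]

theorem pd_dilationField_succ (j : Fin n) (k : Fin (n + 1)) (z : SpaceTime n) :
    pd k (dilationField T x₀ j.succ) z = if k = j.succ then 1 else 0 := by
  have h : HasFDerivAt (dilationField T x₀ j.succ) ((EuclideanSpace.proj (𝕜 := ℝ) j).comp
      (ContinuousLinearMap.snd ℝ ℝ (EuclideanSpace ℝ (Fin n)))) z :=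
    ((EuclideanSpace.proj (𝕜 := ℝ) j).comp (ContinuousLinearMap.snd ℝ ℝ
      (EuclideanSpace ℝ (Fin n)))).hasFDerivAt.sub_const (x₀ j)
  rw [pd, h.fderiv]
  refine Fin.cases ?_ (fun i => ?_) k
  · simp [dir, (Fin.succ_ne_zero j).symm]
  · simp [dir, eq_comm]

theorem sum_pd_dilationField (z : SpaceTime n) :
    ∑ k, pd k (dilationField T x₀ k) z = n + 2 := by
  rw [Fin.sum_univ_succ]
  simp [pd_dilationField_zero, pd_dilationField_succ]
  ring

end Field

theorem IsVariationalSolution.firstVariation_dilationField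
    {F : EuclideanSpace ℝ (Fin m) → ℝ} {a b : ℝ} {u : SpaceTime n → EuclideanSpace ℝ (Fin m)}
    {Du : Fin (n + 1) → SpaceTime n → EuclideanSpace ℝ (Fin m)}
    (h : IsVariationalSolution F a b u Du) (T : ℝ) (x₀ : EuclideanSpace ℝ (Fin n))
    {θ : SpaceTime n → ℝ} (hθ : IsTest (strip n a b) θ) :
    ∫ z in strip n a b, (energy F u Du z *
        ((∑ k, dilationField T x₀ k z * pd k θ z) + (n + 2) * θ z)
      - 2 * ∑ j : Fin n, pd j.succ θ z * ⟪Du j.succ z, dilationDeriv T x₀ Du z⟫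
      - 2 * (θ z * gradSq Du z) - 2 * (θ z * ⟪Du 0 z, dilationDeriv T x₀ Du z⟫)) = 0 := by
  obtain ⟨δ₀, hδ₀, hae⟩ := h.firstVariation
  have hK : IsCompact (Prod.fst '' tsupport θ) := hθ.compact.isCompact.image continuous_fst
  obtain ⟨δ₁, hδ₁, hδ₁'⟩ : ∃ δ₁ > 0, ∀ δ, δ < δ₁ → tsupport θ ⊆ strip n (a + δ) (b - δ) := by
    obtain ⟨δ₁, hδ₁, hsub⟩ := hK.exists_cthickening_subset_open isOpen_Ioo
      (show Prod.fst '' tsupport θ ⊆ Ioo a b by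
        rintro _ ⟨z, hz, rfl⟩
        exact mem_strip.1 (hθ.subset hz))
    refine ⟨δ₁, hδ₁, fun δ hδ z hz => mem_strip.2 ?_⟩
    have hz' : z.1 ∈ Prod.fst '' tsupport θ := ⟨z, hz, rfl⟩
    have hb := Metric.closedBall_subset_cthickening hz' δ₁
    have h1 := hsub (hb (show z.1 - δ₁ ∈ Metric.closedBall z.1 δ₁ by
      simp [abs_of_pos hδ₁]))
    have h2 := hsub (hb (show z.1 + δ₁ ∈ Metric.closedBall z.1 δ₁ by
      simp [abs_of_pos hδ₁]))
    constructor <;> linarith [h1.1, h2.2]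
  rw [ae_restrict_iff' measurableSet_Ioo] at hae
  -- The first variation formula holds for almost every small `δ`, and `(0, min δ₀ δ₁)` has positive
  -- measure, so an admissible `δ` exists for which the support of `θ` stays inside the shortened
  -- strip.
  obtain ⟨δ, hδm, hδ⟩ : ∃ δ ∈ Ioo 0 (min δ₀ δ₁), δ ∈ Ioo 0 δ₀ → _ := by
    have hpos : volume (Ioo (0 : ℝ) (min δ₀ δ₁)) ≠ 0 := by
      simp [hδ₀, hδ₁]
    have := frequently_ae_mem_iff.2 hpos
    obtain ⟨δ, h1, h2⟩ := (this.and_eventually hae).exists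
    exact ⟨δ, h1, h2⟩
  have hδ0 := hδ ⟨hδm.1, hδm.2.trans_le (min_le_left _ _)⟩
  have hsub := hδ₁' δ (hδm.2.trans_le (min_le_right _ _))
  have hψ : ∀ k, ContDiff ℝ ∞ fun z => θ z * dilationField T x₀ k z := fun k =>
    hθ.smooth.mul (contDiff_dilationField T x₀ k)
  have hbd : ∃ R : ℝ, ∀ (k : Fin (n + 1)) t x, R < ‖x‖ →
      θ (t, x) * dilationField T x₀ k (t, x) = 0 := by
    obtain ⟨R, hR⟩ := hθ.compact.isCompact.isBounded.exists_norm_le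
    refine ⟨R, fun k t x hx => ?_⟩
    have : (t, x) ∉ tsupport θ := fun hmem => by
      have := hR _ hmem
      have := (norm_snd_le (t, x)).trans this
      exact absurd hx (not_lt.2 this)
    simp [image_eq_zero_of_notMem_tsupport this]
  have key := hδ0 (fun k z => θ z * dilationField T x₀ k z)
    (fun k => (hψ k).of_le (by exact_mod_cast le_top)) hbd
  -- The two boundary slices miss the support of `θ`, so both boundary integrals vanish.
  have z1 : ∀ x, θ (b - δ, x) = 0 := fun x => image_eq_zero_of_notMem_tsupport fun hm => by
    have := (mem_strip.1 (hsub hm)).2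
    simp at this
  have z2 : ∀ x, θ (a + δ, x) = 0 := fun x => image_eq_zero_of_notMem_tsupport fun hm => by
    have := (mem_strip.1 (hsub hm)).1
    simp at this
  simp only [z1, z2, zero_mul, mul_zero, integral_zero, sub_zero, add_zero] at key
  have hss : strip n (a + δ) (b - δ) ⊆ strip n a b := fun z hz => by
    rw [mem_strip] at hz ⊢
    constructor <;> linarith [hz.1, hz.2, hδm.1]
  rw [setIntegral_eq_of_subset_of_forall_sdiff_eq_zero (measurableSet_strip _ _) hss]
  · rw [← key]
    refine integral_congr_ae (Eventually.of_forall fun z => ?_)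
    simp only [pd_mul hθ.smooth (contDiff_dilationField T x₀ _)]
    have e1 : ∑ k, (pd k θ z * dilationField T x₀ k z + θ z * pd k (dilationField T x₀ k) z) =
        (∑ k, dilationField T x₀ k z * pd k θ z) + (n + 2) * θ z := by
      rw [Finset.sum_add_distrib, ← Finset.mul_sum, sum_pd_dilationField]
      congr 1
      · exact Finset.sum_congr rfl fun k _ => mul_comm _ _
      · ring
    have e2 : ∀ k', ⟪Du k' z, dilationDeriv T x₀ Du z⟫ =
        ∑ k, dilationField T x₀ k z * ⟪Du k' z, Du k z⟫ := fun k' => by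
      simp [dilationDeriv, inner_sum, real_inner_smul_right]
    -- The Jacobian of the dilation field is diagonal with spatial entries `1`; differentiating the
    -- field therefore leaves just `θ |∂_j u|²`.
    have e3 : ∀ j : Fin n, ∑ k, (pd j.succ θ z * dilationField T x₀ k z +
        θ z * pd j.succ (dilationField T x₀ k) z) * ⟪Du j.succ z, Du k z⟫ =
        pd j.succ θ z * ⟪Du j.succ z, dilationDeriv T x₀ Du z⟫ + θ z * ‖Du j.succ z‖ ^ 2 := by
      intro j
      rw [e2, Finset.mul_sum]
      simp only [add_mul, Finset.sum_add_distrib]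
      congr 1
      · exact Finset.sum_congr rfl fun k _ => by ring
      · rw [Fin.sum_univ_succ]
        simp [pd_dilationField_zero, pd_dilationField_succ, Fin.succ_ne_zero]
    rw [e1, Finset.sum_congr rfl fun j _ => e3 j, Finset.sum_add_distrib, e2 0, gradSq]
    simp only [← Finset.mul_sum]
    have e4 : ∑ k, ⟪Du 0 z, Du k z⟫ * (θ z * dilationField T x₀ k z) =
        ∑ k, θ z * (dilationField T x₀ k z * ⟪Du 0 z, Du k z⟫) :=
      Finset.sum_congr rfl fun k _ => by ring
    rw [e4, ← Finset.mul_sum]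
    ring
  · intro z hz
    have hz' : z ∉ tsupport θ := fun hm => hz.2 (hsub hm)
    simp [pd_eq_zero_of_notMem_tsupport _ hz', image_eq_zero_of_notMem_tsupport hz']

/-! ### Derivatives of the weight. -/

/-- The positive weight `G_{(T,x₀)}(t,x) / (T - t)`. -/
def weight (T : ℝ) (x₀ : EuclideanSpace ℝ (Fin n)) (z : SpaceTime n) : ℝ :=
  4 * Real.pi * |4 * Real.pi * (T - z.1)| ^ (-(n : ℝ) / 2 - 1) *
    Real.exp (-‖z.2 - x₀‖ ^ 2 / (4 * (T - z.1)))

section Weight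

variable (T : ℝ) (x₀ : EuclideanSpace ℝ (Fin n))

theorem heatKernel_eq (z : SpaceTime n) : heatKernel T x₀ z = (T - z.1) * weight T x₀ z := by
  rw [heatKernel, weight]; ring

theorem weight_nonneg (z : SpaceTime n) : 0 ≤ weight T x₀ z := by
  have := Real.pi_pos
  rw [weight]; positivity

theorem measurable_weight : Measurable (weight (n := n) T x₀) := by
  unfold weight
  refine Measurable.mul (measurable_const.mul (Measurable.pow_const ?_ _)) ?_
  · exact ((measurable_const.mul (measurable_const.sub measurable_fst))).norm
  · exact Real.measurable_exp.comp ((((measurable_snd.sub_const x₀).norm.pow_const 2).neg).div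
      (measurable_const.mul (measurable_const.sub measurable_fst)))

variable {T}

theorem contDiffAt_weight {z : SpaceTime n} (hz : z.1 ≠ T) :
    ContDiffAt ℝ ∞ (weight T x₀) z := by
  have h0 : T - z.1 ≠ 0 := sub_ne_zero.2 hz.symm
  have hp := Real.pi_pos
  have h1 : 4 * Real.pi * (T - z.1) ≠ 0 := by positivity
  have c1 : ContDiffAt ℝ ∞ (fun z : SpaceTime n => 4 * Real.pi * (T - z.1)) z := by fun_prop
  unfold weight
  have c2 : ContDiffAt ℝ ∞ (fun z : SpaceTime n => |4 * Real.pi * (T - z.1)|) z :=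
    ContDiffAt.comp (g := fun x : ℝ => |x|) z (contDiffAt_abs h1) c1
  refine (contDiffAt_const.mul (c2.rpow_const_of_ne (abs_ne_zero.2 h1))).mul (ContDiffAt.exp ?_)
  refine ContDiffAt.div ?_ (by fun_prop) (by positivity)
  exact ((contDiff_snd.sub contDiff_const).norm_sq ℝ).neg.contDiffAt

theorem hasFDerivAt_weight {z : SpaceTime n} (hz : z.1 ≠ T) :
    HasFDerivAt (weight T x₀) (weight T x₀ z •
      (((-(n : ℝ) / 2 - 1) / (z.1 - T) - ‖z.2 - x₀‖ ^ 2 / (4 * (z.1 - T) ^ 2)) •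
          ContinuousLinearMap.fst ℝ ℝ (EuclideanSpace ℝ (Fin n)) +
        (1 / (2 * (z.1 - T))) • (innerSL ℝ (z.2 - x₀)).comp
          (ContinuousLinearMap.snd ℝ ℝ (EuclideanSpace ℝ (Fin n))))) z := by
  have h0 : T - z.1 ≠ 0 := sub_ne_zero.2 hz.symm
  have h0' : z.1 - T ≠ 0 := sub_ne_zero.2 hz
  have hp := Real.pi_pos
  have h1 : 4 * Real.pi * (T - z.1) ≠ 0 := by positivity
  set p : ℝ := -(n : ℝ) / 2 - 1 with hpdef
  have d1 : HasDerivAt (fun t : ℝ => 4 * Real.pi * (T - t)) (4 * Real.pi * (-1)) z.1 :=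
    ((hasDerivAt_id z.1).const_sub T).const_mul _
  -- The logarithmic derivative of `|T - t|^p` is `p/(t - T)` on either side of `T`, so one formula
  -- serves both.
  have d2 : HasDerivAt (fun t : ℝ => 4 * Real.pi * |4 * Real.pi * (T - t)| ^ p)
      (4 * Real.pi * |4 * Real.pi * (T - z.1)| ^ p * (p / (z.1 - T))) z.1 := by
    have ha : HasDerivAt (fun t : ℝ => |4 * Real.pi * (T - t)|)
        (SignType.sign (4 * Real.pi * (T - z.1)) * (4 * Real.pi * (-1))) z.1 :=
      HasDerivAt.comp (h₂ := fun x : ℝ => |x|) z.1 (hasDerivAt_abs h1) d1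
    have habs := ha.rpow_const (p := p) (Or.inl (abs_ne_zero.2 h1))
    refine (habs.const_mul (4 * Real.pi)).congr_deriv ?_
    rw [Real.rpow_sub_one (abs_ne_zero.2 h1)]
    rcases lt_or_gt_of_ne h1 with h | h
    · rw [abs_of_neg h, sign_neg h]
      simp
      field_simp
      ring
    · rw [abs_of_pos h, sign_pos h]
      simp
      field_simp
      ring
  have d3 : HasFDerivAt (fun z : SpaceTime n => 4 * Real.pi * |4 * Real.pi * (T - z.1)| ^ p)
      ((4 * Real.pi * |4 * Real.pi * (T - z.1)| ^ p * (p / (z.1 - T))) •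
        ContinuousLinearMap.fst ℝ ℝ (EuclideanSpace ℝ (Fin n))) z :=
    d2.comp_hasFDerivAt z hasFDerivAt_fst
  have d4 : HasFDerivAt (fun z : SpaceTime n => ‖z.2 - x₀‖ ^ 2)
      (2 • (innerSL ℝ (z.2 - x₀)).comp
        (ContinuousLinearMap.snd ℝ ℝ (EuclideanSpace ℝ (Fin n)))) z :=
    (hasFDerivAt_snd.sub_const x₀).norm_sq
  have d5 : HasDerivAt (fun t : ℝ => (4 * (t - T))⁻¹) (-4 / (4 * (z.1 - T)) ^ 2) z.1 := by
    have := (((hasDerivAt_id z.1).sub_const T).const_mul 4).inv (by simpa using h0')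
    refine this.congr_deriv ?_
    simp
  have d6 : HasFDerivAt (fun z : SpaceTime n => (4 * (z.1 - T))⁻¹)
      ((-4 / (4 * (z.1 - T)) ^ 2) • ContinuousLinearMap.fst ℝ ℝ (EuclideanSpace ℝ (Fin n))) z :=
    d5.comp_hasFDerivAt z hasFDerivAt_fst
  have d7 := (d3.mul (d4.mul d6).exp)
  have e : weight T x₀ = fun z : SpaceTime n => 4 * Real.pi * |4 * Real.pi * (T - z.1)| ^ p *
      Real.exp (‖z.2 - x₀‖ ^ 2 * (4 * (z.1 - T))⁻¹) := by
    ext w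
    rw [weight, ← hpdef, show -‖w.2 - x₀‖ ^ 2 / (4 * (T - w.1)) =
      ‖w.2 - x₀‖ ^ 2 * (4 * (w.1 - T))⁻¹ by
        rw [← div_eq_mul_inv, show 4 * (T - w.1) = -(4 * (w.1 - T)) by ring, neg_div_neg_eq]]
  have hez := congrFun e z
  rw [hez]
  rw [e]
  refine d7.congr_fderiv ?_
  ext w
  · simp
    field_simp
    ring
  · simp
    field_simp
    ring

/-- The denominator `2(t - T)` is the time component of the dilation field. Multiplication by it
turns `∂_t u + ∇ log W · ∇u` into the dilation derivative of `u`. -/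
theorem pd_succ_weight {z : SpaceTime n} (hz : z.1 ≠ T) (j : Fin n) :
    pd j.succ (weight T x₀) z = weight T x₀ z * ((z.2 j - x₀ j) / (2 * (z.1 - T))) := by
  rw [pd, (hasFDerivAt_weight x₀ hz).fderiv]
  have h0' : z.1 - T ≠ 0 := sub_ne_zero.2 hz
  simp [dir, PiLp.inner_apply]
  left
  field_simp

/-- Euler's relation for a function homogeneous of degree `-(n+2)`: the `|x - x₀|²` terms from the
time and space derivatives of the exponential cancel. -/
theorem sum_dilationField_mul_pd_weight {z : SpaceTime n} (hz : z.1 ≠ T) :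
    ∑ k, dilationField T x₀ k z * pd k (weight T x₀) z = -(n + 2) * weight T x₀ z := by
  have h0' : z.1 - T ≠ 0 := sub_ne_zero.2 hz
  rw [Fin.sum_univ_succ]
  simp only [pd_succ_weight x₀ hz, dilationField_zero, dilationField_succ]
  have e : ∑ j : Fin n, (z.2 j - x₀ j) * (weight T x₀ z * ((z.2 j - x₀ j) / (2 * (z.1 - T)))) =
      weight T x₀ z * ‖z.2 - x₀‖ ^ 2 / (2 * (z.1 - T)) := by
    rw [norm_sq_eq_sum, Finset.mul_sum, Finset.sum_div]
    refine Finset.sum_congr rfl fun j _ => ?_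
    simp
    ring
  rw [e, pd, (hasFDerivAt_weight x₀ hz).fderiv]
  simp [dir]
  field_simp
  ring

end Weight

/-! ### Products of the weight with a time cutoff. -/

section TimeCutoff

variable {T : ℝ} (x₀ : EuclideanSpace ℝ (Fin n)) {η : ℝ → ℝ}

theorem eventually_eq_zero_of_fst_eq (hT : T ∉ tsupport η) {z : SpaceTime n} (hz : z.1 = T) :
    ∀ᶠ w : SpaceTime n in 𝓝 z, η w.1 = 0 := by
  have : ∀ᶠ t in 𝓝 z.1, η t = 0 := by
    rw [hz]
    exact notMem_tsupport_iff_eventuallyEq.1 hT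
  exact continuous_fst.continuousAt.eventually this

/-- The weight is singular only on `t = T`, and there the cutoff vanishes identically nearby. -/
theorem contDiff_time_mul_weight (hη : ContDiff ℝ ∞ η) (hT : T ∉ tsupport η) :
    ContDiff ℝ ∞ fun z : SpaceTime n => η z.1 * weight T x₀ z := by
  rw [contDiff_iff_contDiffAt]
  intro z
  by_cases hz : z.1 = T
  · have : (fun z : SpaceTime n => η z.1 * weight T x₀ z) =ᶠ[𝓝 z] fun _ => 0 := by
      filter_upwards [eventually_eq_zero_of_fst_eq hT hz] with w hw
      rw [hw, zero_mul]
    exact contDiffAt_const.congr_of_eventuallyEq this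
  · exact (hη.comp contDiff_fst).contDiffAt.mul (contDiffAt_weight x₀ hz)

theorem pd_time_mul_weight (hη : ContDiff ℝ ∞ η) (hT : T ∉ tsupport η) (k : Fin (n + 1))
    (z : SpaceTime n) : pd k (fun z : SpaceTime n => η z.1 * weight T x₀ z) z =
      (if k = 0 then deriv η z.1 else 0) * weight T x₀ z + η z.1 * pd k (weight T x₀) z := by
  by_cases hz : z.1 = T
  · have h : (fun z : SpaceTime n => η z.1 * weight T x₀ z) =ᶠ[𝓝 z] fun _ => 0 := by
      filter_upwards [eventually_eq_zero_of_fst_eq hT hz] with w hw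
      rw [hw, zero_mul]
    have h1 : η z.1 = 0 := (eventually_eq_zero_of_fst_eq hT hz).self_of_nhds
    have h2 : deriv η z.1 = 0 := by
      rw [hz]
      exact (notMem_tsupport_iff_eventuallyEq.1 hT).deriv_eq.trans (by simp)
    rw [pd, h.fderiv_eq, h1, h2]
    simp
  · have d1 : HasFDerivAt (fun z : SpaceTime n => η z.1)
        (deriv η z.1 • ContinuousLinearMap.fst ℝ ℝ (EuclideanSpace ℝ (Fin n))) z :=
      (hη.differentiable (by simp) z.1).hasDerivAt.comp_hasFDerivAt z hasFDerivAt_fst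
    have d2 := d1.mul (hasFDerivAt_weight x₀ hz).differentiableAt.hasFDerivAt
    rw [pd, show (fun z : SpaceTime n => η z.1 * weight T x₀ z) =
      (fun z => η z.1) * weight T x₀ from rfl, d2.fderiv]
    have e : (dir k : SpaceTime n).1 = if k = 0 then 1 else 0 := by
      refine Fin.cases ?_ (fun j => ?_) k <;> simp [dir]
    simp [e, pd]
    ring_nf

theorem pd_succ_time_mul_weight (hη : ContDiff ℝ ∞ η) (hT : T ∉ tsupport η) (j : Fin n)
    (z : SpaceTime n) : pd j.succ (fun z : SpaceTime n => η z.1 * weight T x₀ z) z =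
      η z.1 * weight T x₀ z * ((z.2 j - x₀ j) / (2 * (z.1 - T))) := by
  rw [pd_time_mul_weight x₀ hη hT]
  by_cases hz : z.1 = T
  · have h1 : η z.1 = 0 := by rw [hz]; exact image_eq_zero_of_notMem_tsupport hT
    simp [h1]
  · rw [pd_succ_weight x₀ hz]
    simp
    ring

theorem sum_dilationField_mul_pd_time_mul_weight (hη : ContDiff ℝ ∞ η) (hT : T ∉ tsupport η)
    (z : SpaceTime n) :
    ∑ k, dilationField T x₀ k z * pd k (fun z : SpaceTime n => η z.1 * weight T x₀ z) z =
      (2 * (z.1 - T) * deriv η z.1 - (n + 2) * η z.1) * weight T x₀ z := by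
  simp only [pd_time_mul_weight x₀ hη hT, mul_add, Finset.sum_add_distrib]
  have e : ∑ k, dilationField T x₀ k z * (η z.1 * pd k (weight T x₀) z) =
      η z.1 * ∑ k, dilationField T x₀ k z * pd k (weight T x₀) z := by
    rw [Finset.mul_sum]
    exact Finset.sum_congr rfl fun k _ => by ring
  rw [e]
  by_cases hz : z.1 = T
  · have h1 : η z.1 = 0 := by rw [hz]; exact image_eq_zero_of_notMem_tsupport hT
    simp [h1]
    ring
  · rw [sum_dilationField_mul_pd_weight x₀ hz]
    simp
    ring

end TimeCutoff

/-! ### Spatial cutoffs. -/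

/-- Smooth spatial cutoff functions exhausting space, with scale invariant gradient bounds. -/
structure IsCutoffSeq (x₀ : EuclideanSpace ℝ (Fin n)) (X : ℕ → SpaceTime n → ℝ) (C : ℝ) :
    Prop where
  smooth : ∀ k, ContDiff ℝ ∞ (X k)
  nonneg : ∀ k z, 0 ≤ X k z
  le_one : ∀ k z, X k z ≤ 1
  eq_one : ∀ (k : ℕ) z, ‖z.2 - x₀‖ < k + 1 → X k z = 1
  eq_zero : ∀ (k : ℕ) z, 2 * ((k : ℝ) + 1) ≤ ‖z.2 - x₀‖ → X k z = 0
  pd_zero : ∀ k z, pd 0 (X k) z = 0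
  pd_le : ∀ k (j : Fin n) z, |pd j.succ (X k) z| ≤ C
  mul_pd_le : ∀ k (j : Fin n) z, ‖z.2 - x₀‖ * |pd j.succ (X k) z| ≤ C

/-- A single bump is dilated by `k + 1`. Its gradient gains the factor `1/(k+1)` and vanishes beyond
`‖x - x₀‖ = 2(k+1)`, which bounds the product with `‖x - x₀‖` uniformly in `k`. -/
theorem exists_isCutoffSeq (x₀ : EuclideanSpace ℝ (Fin n)) : ∃ X C, IsCutoffSeq x₀ X C := by
  let χ : ContDiffBump (0 : EuclideanSpace ℝ (Fin n)) := ⟨1, 2, one_pos, one_lt_two⟩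
  have hχ : ContDiff ℝ ∞ χ := χ.contDiff
  obtain ⟨C₀, hC₀⟩ := (χ.hasCompactSupport.fderiv ℝ).exists_bound_of_continuous
    (hχ.continuous_fderiv (by simp))
  have hC₀n : 0 ≤ C₀ := (norm_nonneg _).trans (hC₀ 0)
  let X : ℕ → SpaceTime n → ℝ := fun k z => χ (((k : ℝ) + 1)⁻¹ • (z.2 - x₀))
  have hk : ∀ k : ℕ, (0 : ℝ) < k + 1 := fun k => by positivity
  have hnorm : ∀ (k : ℕ) (z : SpaceTime n), ‖((k : ℝ) + 1)⁻¹ • (z.2 - x₀)‖ =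
      ((k : ℝ) + 1)⁻¹ * ‖z.2 - x₀‖ := fun k z => by
    rw [norm_smul, Real.norm_of_nonneg (inv_pos.2 (hk k)).le]
  have hpd : ∀ k l z, pd l (X k) z = ((k : ℝ) + 1)⁻¹ *
      fderiv ℝ χ (((k : ℝ) + 1)⁻¹ • (z.2 - x₀)) (dir l : SpaceTime n).2 := by
    intro k l z
    have d1 : HasFDerivAt (fun z : SpaceTime n => ((k : ℝ) + 1)⁻¹ • (z.2 - x₀))
        (((k : ℝ) + 1)⁻¹ • ContinuousLinearMap.snd ℝ ℝ (EuclideanSpace ℝ (Fin n))) z :=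
      HasFDerivAt.const_smul (f := fun z : SpaceTime n => z.2 - x₀)
        (hasFDerivAt_snd.sub_const x₀) (((k : ℝ) + 1)⁻¹)
    have d2 := (hχ.differentiable (by simp) (((k : ℝ) + 1)⁻¹ • (z.2 - x₀))).hasFDerivAt.comp z d1
    rw [pd, show X k = χ ∘ fun z : SpaceTime n => ((k : ℝ) + 1)⁻¹ • (z.2 - x₀) from rfl, d2.fderiv]
    simp
  have hb : ∀ (k : ℕ) (j : Fin n) z, |pd j.succ (X k) z| ≤ ((k : ℝ) + 1)⁻¹ * C₀ := by
    intro k j z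
    rw [hpd, abs_mul, abs_of_pos (inv_pos.2 (hk k))]
    gcongr
    rw [← Real.norm_eq_abs]
    refine (ContinuousLinearMap.le_opNorm _ _).trans ?_
    have : ‖(dir j.succ : SpaceTime n).2‖ = 1 := by simp [dir]
    rw [this, mul_one]
    exact hC₀ _
  refine ⟨X, 2 * C₀, ⟨fun k => ?_, fun k z => χ.nonneg, fun k z => χ.le_one, fun k z hz => ?_,
    fun k z hz => ?_, fun k z => ?_, fun k j z => ?_, fun k j z => ?_⟩⟩
  · exact hχ.comp (by fun_prop)
  · refine χ.one_of_mem_closedBall ?_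
    rw [mem_closedBall_zero_iff, hnorm, inv_mul_le_iff₀ (hk k)]
    change ‖z.2 - x₀‖ ≤ (k + 1) * 1
    linarith
  · refine χ.zero_of_le_dist ?_
    rw [dist_zero_right, hnorm, le_inv_mul_iff₀ (hk k)]
    change (k + 1 : ℝ) * 2 ≤ _
    linarith
  · rw [hpd]
    simp [dir]
  · refine (hb k j z).trans ?_
    have : ((k : ℝ) + 1)⁻¹ ≤ 1 := inv_le_one_of_one_le₀ (by simp)
    nlinarith
  · by_cases hz : 2 * ((k : ℝ) + 1) < ‖z.2 - x₀‖
    · have : fderiv ℝ χ (((k : ℝ) + 1)⁻¹ • (z.2 - x₀)) = 0 := by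
        by_contra h
        have h2 := support_fderiv_subset ℝ (Function.mem_support.2 h)
        rw [χ.tsupport_eq, mem_closedBall_zero_iff, hnorm, inv_mul_le_iff₀ (hk k)] at h2
        change _ ≤ (k + 1 : ℝ) * 2 at h2
        linarith
      rw [hpd, this]
      simp
      exact hC₀n
    · calc ‖z.2 - x₀‖ * |pd j.succ (X k) z| ≤ (2 * ((k : ℝ) + 1)) * (((k : ℝ) + 1)⁻¹ * C₀) := by
            have := hb k j z
            have := not_lt.1 hz
            gcongr
        _ = 2 * C₀ := by have := hk k; field_simp

namespace IsCutoffSeq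

variable {x₀ : EuclideanSpace ℝ (Fin n)} {X : ℕ → SpaceTime n → ℝ} {C : ℝ}

theorem tendsto_one (h : IsCutoffSeq x₀ X C) (z : SpaceTime n) :
    Tendsto (fun k => X k z) atTop (𝓝 1) := by
  refine tendsto_const_nhds.congr' ?_
  filter_upwards [eventually_ge_atTop ⌈‖z.2 - x₀‖⌉₊] with k hk
  refine (h.eq_one k z ?_).symm
  have := (Nat.le_ceil ‖z.2 - x₀‖).trans (Nat.cast_le.2 hk)
  linarith

theorem tendsto_pd (h : IsCutoffSeq x₀ X C) (j : Fin n) (z : SpaceTime n) :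
    Tendsto (fun k => pd j.succ (X k) z) atTop (𝓝 0) := by
  refine tendsto_const_nhds.congr' ?_
  filter_upwards [eventually_ge_atTop ⌈‖z.2 - x₀‖⌉₊] with k hk
  have hk' := (Nat.le_ceil ‖z.2 - x₀‖).trans (Nat.cast_le.2 hk)
  have hev : X k =ᶠ[𝓝 z] fun _ => 1 := by
    have : ∀ᶠ w : SpaceTime n in 𝓝 z, ‖w.2 - x₀‖ < k + 1 :=
      (by fun_prop : Continuous fun w : SpaceTime n => ‖w.2 - x₀‖).continuousAt.eventually_lt_const
        (by linarith)
    filter_upwards [this] with w hw using h.eq_one k w hw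
  rw [pd, hev.fderiv_eq]
  simp

theorem const_nonneg (h : IsCutoffSeq x₀ X C) (j : Fin n) : 0 ≤ C :=
  (abs_nonneg _).trans (h.pd_le 0 j 0)

/-- A time cutoff times the weight, localised in space. -/
theorem isTest (h : IsCutoffSeq x₀ X C) {T a b : ℝ} {η : ℝ → ℝ} (hη : ContDiff ℝ ∞ η)
    (hc : HasCompactSupport η) (hs : tsupport η ⊆ Ioo a b) (hT : T ∉ tsupport η) (k : ℕ) :
    IsTest (strip n a b) fun z => η z.1 * weight T x₀ z * X k z := by
  have hsub : (tsupport fun z : SpaceTime n => η z.1 * weight T x₀ z * X k z) ⊆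
      tsupport η ×ˢ Metric.closedBall x₀ (2 * ((k : ℝ) + 1)) := by
    refine closure_minimal (fun z hz => ?_)
      ((isClosed_tsupport η).prod Metric.isClosed_closedBall)
    have hz' : η z.1 * weight T x₀ z * X k z ≠ 0 := hz
    refine ⟨subset_tsupport _ fun h0 => hz' (by simp [h0]), ?_⟩
    rw [Metric.mem_closedBall, dist_eq_norm]
    by_contra hcon
    exact hz' (by rw [h.eq_zero k z (not_le.1 hcon).le, mul_zero])
  refine ⟨(contDiff_time_mul_weight x₀ hη hT).mul (h.smooth k), ?_, ?_⟩
  · exact (hc.isCompact.prod (isCompact_closedBall _ _)).of_isClosed_subset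
      (isClosed_tsupport _) hsub
  · intro z hz
    exact mem_strip.2 (hs (hsub hz).1)

end IsCutoffSeq

section Truncated

variable {T : ℝ} {x₀ : EuclideanSpace ℝ (Fin n)} {X : ℕ → SpaceTime n → ℝ} {C : ℝ} {η : ℝ → ℝ}

theorem pd_succ_truncated (h : IsCutoffSeq x₀ X C) (hη : ContDiff ℝ ∞ η) (hT : T ∉ tsupport η)
    (k : ℕ) (j : Fin n) (z : SpaceTime n) :
    pd j.succ (fun z => η z.1 * weight T x₀ z * X k z) z =
      η z.1 * weight T x₀ z * ((z.2 j - x₀ j) / (2 * (z.1 - T)) * X k z + pd j.succ (X k) z) := by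
  rw [pd_mul (contDiff_time_mul_weight x₀ hη hT) (h.smooth k), pd_succ_time_mul_weight x₀ hη hT]
  ring

/-- By homogeneity the weight contributes `-(n+2)`, which cancels the divergence term; only
derivatives falling on the two cutoffs remain. -/
theorem sum_dilationField_mul_pd_truncated (h : IsCutoffSeq x₀ X C) (hη : ContDiff ℝ ∞ η)
    (hT : T ∉ tsupport η) (k : ℕ) (z : SpaceTime n) :
    (∑ l, dilationField T x₀ l z * pd l (fun z => η z.1 * weight T x₀ z * X k z) z) +
      (n + 2) * (η z.1 * weight T x₀ z * X k z) =
      2 * (z.1 - T) * deriv η z.1 * weight T x₀ z * X k z +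
        η z.1 * weight T x₀ z * ∑ j : Fin n, (z.2 j - x₀ j) * pd j.succ (X k) z := by
  simp only [pd_mul (contDiff_time_mul_weight x₀ hη hT) (h.smooth k)]
  have e : ∑ l, dilationField T x₀ l z *
      (pd l (fun z : SpaceTime n => η z.1 * weight T x₀ z) z * X k z +
        η z.1 * weight T x₀ z * pd l (X k) z) =
      (∑ l, dilationField T x₀ l z * pd l (fun z : SpaceTime n => η z.1 * weight T x₀ z) z) * X k z
        + η z.1 * weight T x₀ z * ∑ l, dilationField T x₀ l z * pd l (X k) z := by
    rw [Finset.sum_mul, Finset.mul_sum, ← Finset.sum_add_distrib]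
    exact Finset.sum_congr rfl fun l _ => by ring
  rw [e, sum_dilationField_mul_pd_time_mul_weight x₀ hη hT, Fin.sum_univ_succ, h.pd_zero]
  simp only [dilationField_succ]
  ring

/-- `2(t-T) ∂_t u + (x-x₀)·∇u` in coordinates. -/
theorem inner_dilationDeriv (v : EuclideanSpace ℝ (Fin m))
    (Du : Fin (n + 1) → SpaceTime n → EuclideanSpace ℝ (Fin m)) (z : SpaceTime n) :
    ⟪v, dilationDeriv T x₀ Du z⟫ = 2 * (z.1 - T) * ⟪v, Du 0 z⟫ +
      ∑ j : Fin n, (z.2 j - x₀ j) * ⟪v, Du j.succ z⟫ := by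
  rw [dilationDeriv, inner_sum, Fin.sum_univ_succ]
  simp [real_inner_smul_right]

end Truncated

/-! ### The three integral identities with spatial cutoffs. -/

/-- `η ∈ C_c^∞((a, b))`. -/
structure IsTimeTest (a b : ℝ) (η : ℝ → ℝ) : Prop where
  smooth : ContDiff ℝ ∞ η
  compact : HasCompactSupport η
  subset : tsupport η ⊆ Ioo a b

/-- Absolute convergence, in `S`, of the weighted integrals in the monotonicity formula. -/
structure LayerIntegrable (F : EuclideanSpace ℝ (Fin m) → ℝ) (β T : ℝ)
    (x₀ : EuclideanSpace ℝ (Fin n)) (u : SpaceTime n → EuclideanSpace ℝ (Fin m))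
    (Du : Fin (n + 1) → SpaceTime n → EuclideanSpace ℝ (Fin m)) (S : Set (SpaceTime n)) :
    Prop where
  grad : IntegrableOn (fun z => weight T x₀ z * gradSq Du z) S
  potential : IntegrableOn (fun z => weight T x₀ z * F (u z)) S
  time : IntegrableOn (fun z => weight T x₀ z * ‖Du 0 z‖ ^ 2) S
  sq : IntegrableOn (fun z => weight T x₀ z * ‖u z‖ ^ 2) S
  reaction : IntegrableOn (fun z => weight T x₀ z * (β * ⟪u z, gradient F (u z)⟫)) S

section

variable {F : EuclideanSpace ℝ (Fin m) → ℝ} {a b a' b' β T : ℝ} {x₀ : EuclideanSpace ℝ (Fin n)}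
  {u : SpaceTime n → EuclideanSpace ℝ (Fin m)}
  {Du : Fin (n + 1) → SpaceTime n → EuclideanSpace ℝ (Fin m)}
  {X : ℕ → SpaceTime n → ℝ} {C : ℝ} {ζ : ℝ → ℝ}

theorem LayerIntegrable.energy {S : Set (SpaceTime n)} (h : LayerIntegrable F β T x₀ u Du S) :
    IntegrableOn (fun z => weight T x₀ z * energy F u Du z) S := by
  refine (h.grad.sub (h.potential.const_mul 2)).congr (Eventually.of_forall fun z => ?_)
  simp only [Pi.sub_apply, ParabolicSystem.energy]
  ring

theorem integrable_time_mul {c : ℝ → ℝ} (hc : Continuous c) {h : SpaceTime n → ℝ}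
    (hh : IntegrableOn h (strip n a b)) : IntegrableOn (fun z => c z.1 * h z) (strip n a b) := by
  obtain ⟨M, hM⟩ := (isCompact_Icc (a := a) (b := b)).exists_bound_of_continuousOn hc.continuousOn
  refine hh.bdd_mul (c := M) (hc.comp continuous_fst).aestronglyMeasurable ?_
  filter_upwards [ae_restrict_mem (measurableSet_Ioo.prod MeasurableSet.univ)] with z hz
  exact hM _ (Ioo_subset_Icc_self hz.1)

theorem strip_subset_strip (ha : a ≤ a') (hb : b' ≤ b) : strip n a' b' ⊆ strip n a b :=
  fun z hz => by
    rw [mem_strip] at hz ⊢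
    exact ⟨ha.trans_lt hz.1, hz.2.trans_le hb⟩

theorem IsTimeTest.mul_left (h : IsTimeTest a b ζ) {c : ℝ → ℝ} (hc : ContDiff ℝ ∞ c) :
    IsTimeTest a b fun t => c t * ζ t :=
  ⟨hc.mul h.smooth, h.compact.mul_left, (tsupport_mul_subset_right).trans h.subset⟩

theorem IsTimeTest.continuous_deriv (h : IsTimeTest a b ζ) : Continuous (deriv ζ) :=
  h.smooth.continuous_deriv (by simp)

theorem deriv_sub_mul (h : IsTimeTest a b ζ) (t : ℝ) :
    deriv (fun t => (t - T) * ζ t) t = ζ t + (t - T) * deriv ζ t := by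
  have := ((hasDerivAt_id t).sub_const T).mul (h.smooth.differentiable (by simp) t).hasDerivAt
  refine (this.deriv).trans ?_
  simp

theorem strip_integral_eq {θ h : SpaceTime n → ℝ} (ha : a ≤ a') (hb : b' ≤ b)
    (hθ : IsTest (strip n a' b') θ) (h0 : ∀ z ∉ tsupport θ, h z = 0) :
    ∫ z in strip n a b, h z = ∫ z in strip n a' b', h z :=
  setIntegral_eq_of_tsupport (strip_subset_strip ha hb) (measurableSet_strip a b)
    fun z hz => h0 z fun hm => hz (hθ.subset hm)

theorem mem_strip_ne (hT : T ∉ Ioo a' b') {z : SpaceTime n} (hz : z ∈ strip n a' b') :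
    z.1 - T ≠ 0 := by
  intro h
  rw [mem_strip] at hz
  exact hT ⟨by linarith, by linarith⟩

theorem sum_mul_inner_dilationDeriv (z : SpaceTime n) :
    2 * (z.1 - T) * ⟪Du 0 z, dilationDeriv T x₀ Du z⟫ +
      ∑ j : Fin n, (z.2 j - x₀ j) * ⟪Du j.succ z, dilationDeriv T x₀ Du z⟫ =
      ‖dilationDeriv T x₀ Du z‖ ^ 2 := by
  have hc : ∀ k, ⟪Du k z, dilationDeriv T x₀ Du z⟫ = ⟪dilationDeriv T x₀ Du z, Du k z⟫ :=
    fun k => real_inner_comm _ _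
  simp only [hc]
  rw [← real_inner_self_eq_norm_sq, inner_dilationDeriv (dilationDeriv T x₀ Du z)]

/-- The test function is `(t - T) ζ W X_k`. The extra factor `t - T` cancels the denominator in
`∇W`, so the terms with `∂_t u` and `∇u` paired with the dilation derivative assemble to the square
of the latter. -/
theorem integral_firstVariation_truncated (h : IsVariationalSolution F a b u Du) (ha : a ≤ a')
    (hb : b' ≤ b) (hT : T ∉ Ioo a' b') (hX : IsCutoffSeq x₀ X C) (hζ : IsTimeTest a' b' ζ) (k : ℕ) :
    ∫ z in strip n a' b', (X k z * ((2 * (z.1 - T) ^ 2 * deriv ζ z.1 + 2 * (z.1 - T) * ζ z.1) *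
          (weight T x₀ z * energy F u Du z)
        - 2 * (z.1 - T) * ζ z.1 * (weight T x₀ z * gradSq Du z)
        - ζ z.1 * (weight T x₀ z * ‖dilationDeriv T x₀ Du z‖ ^ 2))
      + (z.1 - T) * ζ z.1 * ((∑ j : Fin n, (z.2 j - x₀ j) * pd j.succ (X k) z) *
          (weight T x₀ z * energy F u Du z)
        - 2 * ∑ j : Fin n, pd j.succ (X k) z *
          (weight T x₀ z * ⟪Du j.succ z, dilationDeriv T x₀ Du z⟫))) = 0 := by
  have hη : IsTimeTest a' b' fun t => (t - T) * ζ t :=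
    hζ.mul_left (contDiff_id.sub contDiff_const)
  have hTη : T ∉ tsupport fun t => (t - T) * ζ t := fun hm => hT (hη.subset hm)
  have hθ' := hX.isTest hη.smooth hη.compact hη.subset hTη k
  have hθ : IsTest (strip n a b) _ := ⟨hθ'.smooth, hθ'.compact,
    hθ'.subset.trans (strip_subset_strip ha hb)⟩
  have key := h.firstVariation_dilationField T x₀ hθ
  rw [strip_integral_eq ha hb hθ' fun z hz => by
    simp [pd_eq_zero_of_notMem_tsupport _ hz, image_eq_zero_of_notMem_tsupport hz]] at key
  rw [← key]
  refine setIntegral_congr_fun (measurableSet_strip _ _) fun z hz => ?_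
  have hs := mem_strip_ne hT hz
  simp only
  rw [sum_dilationField_mul_pd_truncated hX hη.smooth hTη, deriv_sub_mul hζ,
    ← sum_mul_inner_dilationDeriv z]
  simp only [pd_succ_truncated hX hη.smooth hTη]
  have e : ∑ j : Fin n, (z.1 - T) * ζ z.1 * weight T x₀ z *
      ((z.2 j - x₀ j) / (2 * (z.1 - T)) * X k z + pd j.succ (X k) z) *
        ⟪Du j.succ z, dilationDeriv T x₀ Du z⟫ =
      ζ z.1 * weight T x₀ z * X k z / 2 *
        (∑ j : Fin n, (z.2 j - x₀ j) * ⟪Du j.succ z, dilationDeriv T x₀ Du z⟫) +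
      (z.1 - T) * ζ z.1 * ∑ j : Fin n, pd j.succ (X k) z *
          (weight T x₀ z * ⟪Du j.succ z, dilationDeriv T x₀ Du z⟫) := by
    rw [Finset.mul_sum, Finset.mul_sum, ← Finset.sum_add_distrib]
    refine Finset.sum_congr rfl fun j _ => ?_
    field_simp
  rw [e]
  ring

/-- With the same test function and multiplier `u`, the term `u·∂_t u` and the term where the
gradient hits `W` together form half of `ζ W u·E`. -/
theorem integral_test_self_truncated (h : IsVariationalSolution F a b u Du) (ha : a ≤ a')
    (hb : b' ≤ b) (hT : T ∉ Ioo a' b') (hX : IsCutoffSeq x₀ X C) (hζ : IsTimeTest a' b' ζ) (k : ℕ) :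
    ∫ z in strip n a' b', (X k z * (ζ z.1 / 2 * (weight T x₀ z * ⟪u z, dilationDeriv T x₀ Du z⟫)
        + (z.1 - T) * ζ z.1 * (weight T x₀ z * gradSq Du z)
        - (z.1 - T) * ζ z.1 * (weight T x₀ z * ⟪u z, gradient F (u z)⟫))
      + (z.1 - T) * ζ z.1 * ∑ j : Fin n, pd j.succ (X k) z *
          (weight T x₀ z * ⟪u z, Du j.succ z⟫)) = 0 := by
  have hη : IsTimeTest a' b' fun t => (t - T) * ζ t :=
    hζ.mul_left (contDiff_id.sub contDiff_const)
  have hTη : T ∉ tsupport fun t => (t - T) * ζ t := fun hm => hT (hη.subset hm)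
  have hθ' := hX.isTest hη.smooth hη.compact hη.subset hTη k
  have hθ : IsTest (strip n a b) _ := ⟨hθ'.smooth, hθ'.compact,
    hθ'.subset.trans (strip_subset_strip ha hb)⟩
  have hl : ∀ {g : SpaceTime n → ℝ}, IntegrableOn g (strip n a b) →
    LocallyIntegrableOn g (strip n a b) := fun hg => hg.locallyIntegrableOn
  have key := integral_self_mul_system (isOpen_strip a b) h.memH1 h.locallyIntegrable_f
    h.integrable_uf h.distributional hθ
  have i1 := hθ.integrable_mul (hl (integrable_inner h.memH1.memLp (h.memH1.memLp_grad 0)))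
  have i2 := fun j : Fin n => (hθ.partialDeriv j.succ).integrable_mul
    (hl (integrable_inner h.memH1.memLp (h.memH1.memLp_grad j.succ)))
  have i3 := fun j : Fin n => hθ.integrable_mul
    (hl (integrable_inner (h.memH1.memLp_grad j.succ) (h.memH1.memLp_grad j.succ)))
  have i4 : IntegrableOn (fun z => ⟪u z, gradient F (u z)⟫) (strip n a b) := by
    simp only [real_inner_eq_sum]
    exact integrable_finsetSum _ fun i _ => h.integrable_uf i
  have i5 := hθ.integrable_mul (hl i4)
  simp only [real_inner_self_eq_norm_sq] at i3
  have i23 : ∀ j : Fin n, IntegrableOn _ (strip n a b) := fun j => (i2 j).add (i3 j)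
  have i123 : IntegrableOn _ (strip n a b) := 
    i1.add (integrable_finsetSum Finset.univ fun j _ => i23 j)
  rw [← sub_eq_zero] at key
  have key := (integral_sub i123 i5).trans key
  rw [strip_integral_eq ha hb hθ' fun z hz => by
      simp [pd_eq_zero_of_notMem_tsupport _ hz, image_eq_zero_of_notMem_tsupport hz]] at key
  rw [← key]
  refine setIntegral_congr_fun (measurableSet_strip _ _) fun z hz => ?_
  have hs := mem_strip_ne hT hz
  simp only [pd_succ_truncated hX hη.smooth hTη, Pi.add_apply]
  rw [inner_dilationDeriv, gradSq]
  have e : ∑ j : Fin n, ((z.1 - T) * ζ z.1 * weight T x₀ z *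
      ((z.2 j - x₀ j) / (2 * (z.1 - T)) * X k z + pd j.succ (X k) z) *
        ⟪u z, Du j.succ z⟫ + (z.1 - T) * ζ z.1 * weight T x₀ z * X k z * ‖Du j.succ z‖ ^ 2) =
      ζ z.1 * weight T x₀ z * X k z / 2 *
        (∑ j : Fin n, (z.2 j - x₀ j) * ⟪u z, Du j.succ z⟫) +
      (z.1 - T) * ζ z.1 * weight T x₀ z * X k z * (∑ j : Fin n, ‖Du j.succ z‖ ^ 2) +
      (z.1 - T) * ζ z.1 * ∑ j : Fin n, pd j.succ (X k) z *
          (weight T x₀ z * ⟪u z, Du j.succ z⟫) := by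
    rw [Finset.mul_sum, Finset.mul_sum, Finset.mul_sum, ← Finset.sum_add_distrib,
      ← Finset.sum_add_distrib]
    refine Finset.sum_congr rfl fun j _ => ?_
    field_simp
    ring
  rw [e]
  ring

/-- Integration by parts of the dilation derivative of `|u|²` against `ζ W X_k`, carried out one
coordinate direction at a time; the divergence of the field again cancels the degree of `W`. -/
theorem integral_dilation_norm_sq_truncated (h : IsVariationalSolution F a b u Du) (ha : a ≤ a')
    (hb : b' ≤ b) (hT : T ∉ Ioo a' b') (hX : IsCutoffSeq x₀ X C) (hζ : IsTimeTest a' b' ζ) (k : ℕ) :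
    ∫ z in strip n a' b', (X k z *
        (2 * ζ z.1 * (weight T x₀ z * ⟪u z, dilationDeriv T x₀ Du z⟫)
        + 2 * (z.1 - T) * deriv ζ z.1 * (weight T x₀ z * ‖u z‖ ^ 2))
      + ζ z.1 * (∑ j : Fin n, (z.2 j - x₀ j) * pd j.succ (X k) z) *
          (weight T x₀ z * ‖u z‖ ^ 2)) = 0 := by
  have hTζ : T ∉ tsupport ζ := fun hm => hT (hζ.subset hm)
  have hθ' := hX.isTest hζ.smooth hζ.compact hζ.subset hTζ k
  set θ := fun z : SpaceTime n => ζ z.1 * weight T x₀ z * X k z with hθdef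
  have hθ : IsTest (strip n a b) θ := ⟨hθ'.smooth, hθ'.compact,
    hθ'.subset.trans (strip_subset_strip ha hb)⟩
  have hl : ∀ {g : SpaceTime n → ℝ}, IntegrableOn g (strip n a b) →
    LocallyIntegrableOn g (strip n a b) := fun hg => hg.locallyIntegrableOn
  have hθk := fun l => hθ.mul (contDiff_dilationField T x₀ l)
  have key := Finset.sum_congr (s₁ := Finset.univ) rfl fun l _ =>
    h.memH1.integral_mul_norm_sq (isOpen_strip a b) (hθk l) l
  have hsq : IntegrableOn (fun z => ‖u z‖ ^ 2) (strip n a b) := by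
    simpa only [real_inner_self_eq_norm_sq] using integrable_inner h.memH1.memLp h.memH1.memLp
  have i1 := fun l => (hθk l).integrable_mul
    (hl ((integrable_inner h.memH1.memLp (h.memH1.memLp_grad l)).const_mul 2))
  have i2 := fun l => ((hθk l).partialDeriv l).integrable_mul (hl hsq)
  rw [Finset.sum_neg_distrib, ← integral_finsetSum _ fun l _ => i1 l,
    ← integral_finsetSum _ fun l _ => i2 l, ← add_eq_zero_iff_eq_neg,
    ← integral_add (integrable_finsetSum _ fun l _ => i1 l)
      (integrable_finsetSum _ fun l _ => i2 l)] at key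
  have e0 : ∀ z, (∑ l, θ z * dilationField T x₀ l z * (2 * ⟪u z, Du l z⟫)) +
      ∑ l, pd l (fun z => θ z * dilationField T x₀ l z) z * ‖u z‖ ^ 2 =
      2 * θ z * ⟪u z, dilationDeriv T x₀ Du z⟫ +
        ((∑ l, dilationField T x₀ l z * pd l θ z) + (n + 2) * θ z) * ‖u z‖ ^ 2 := by
    intro z
    congr 1
    · rw [dilationDeriv, inner_sum, Finset.mul_sum]
      refine Finset.sum_congr rfl fun l _ => ?_
      rw [real_inner_smul_right]
      ring
    · rw [← Finset.sum_mul]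
      congr 1
      rw [← sum_pd_dilationField T x₀ z, Finset.sum_mul, ← Finset.sum_add_distrib]
      refine Finset.sum_congr rfl fun l _ => ?_
      rw [pd_mul hθ.smooth (contDiff_dilationField T x₀ l)]
      ring
  simp only [e0] at key
  rw [strip_integral_eq ha hb hθ' fun z hz => by
      simp [pd_eq_zero_of_notMem_tsupport _ hz, image_eq_zero_of_notMem_tsupport hz]] at key
  rw [← key]
  refine setIntegral_congr_fun (measurableSet_strip _ _) fun z _ => ?_
  simp only [hθdef]
  rw [sum_dilationField_mul_pd_truncated hX hζ.smooth hTζ]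
  ring

end

/-! ### Removal of the spatial cutoffs and the fundamental identity. -/

/-- The density of the weighted energy. -/
def energyDensity (F : EuclideanSpace ℝ (Fin m) → ℝ) (β T : ℝ) (x₀ : EuclideanSpace ℝ (Fin n))
    (u : SpaceTime n → EuclideanSpace ℝ (Fin m))
    (Du : Fin (n + 1) → SpaceTime n → EuclideanSpace ℝ (Fin m)) (z : SpaceTime n) : ℝ :=
  energy F u Du z * heatKernel T x₀ z - β / 2 * (1 / (T - z.1) * ‖u z‖ ^ 2 * heatKernel T x₀ z)

/-- The deviation of `u` from being homogeneous of degree `β`. -/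
def homogeneityDefect (β T : ℝ) (x₀ : EuclideanSpace ℝ (Fin n))
    (u : SpaceTime n → EuclideanSpace ℝ (Fin m))
    (Du : Fin (n + 1) → SpaceTime n → EuclideanSpace ℝ (Fin m)) (z : SpaceTime n) :
    EuclideanSpace ℝ (Fin m) :=
  dilationDeriv T x₀ Du z - β • u z

/-- The density of the derivative of the weighted energy. -/
def dissipationDensity (F : EuclideanSpace ℝ (Fin m) → ℝ) (β T : ℝ)
    (x₀ : EuclideanSpace ℝ (Fin n)) (u : SpaceTime n → EuclideanSpace ℝ (Fin m))
    (Du : Fin (n + 1) → SpaceTime n → EuclideanSpace ℝ (Fin m)) (z : SpaceTime n) : ℝ :=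
  weight T x₀ z * ‖homogeneityDefect β T x₀ u Du z‖ ^ 2 + 2 * (heatKernel T x₀ z *
    (2 * (β - 1) * F (u z) - β * ⟪u z, gradient F (u z)⟫))

/-- Fatou's lemma: the upper bound on the integrals passes to the almost everywhere limit. -/
theorem integrable_of_tendsto_of_integral_le {α : Type*} {mα : MeasurableSpace α} {ν : Measure α}
    {f : ℕ → α → ℝ} {f₀ : α → ℝ} {C : ℝ} (hf : ∀ k, Integrable (f k) ν)
    (hf0 : ∀ k, 0 ≤ᵐ[ν] f k) (hlim : ∀ᵐ z ∂ν, Tendsto (fun k => f k z) atTop (𝓝 (f₀ z)))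
    (hC : ∀ k, ∫ z, f k z ∂ν ≤ C) : Integrable f₀ ν := by
  refine ⟨aestronglyMeasurable_of_tendsto_ae _ (fun k => (hf k).1) hlim, ?_⟩
  have h1 : ∫⁻ z, ‖f₀ z‖ₑ ∂ν ≤ liminf (fun k => ∫⁻ z, ‖f k z‖ₑ ∂ν) atTop := by
    refine le_trans (le_of_eq (lintegral_congr_ae ?_))
      (lintegral_liminf_le' fun k => (hf k).1.enorm)
    filter_upwards [hlim] with z hz
    exact (hz.enorm).liminf_eq.symm
  have h2 : ∀ k, ∫⁻ z, ‖f k z‖ₑ ∂ν ≤ ENNReal.ofReal C := by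
    intro k
    rw [← ofReal_integral_norm_eq_lintegral_enorm (hf k)]
    refine ENNReal.ofReal_le_ofReal (le_trans (le_of_eq (integral_congr_ae ?_)) (hC k))
    filter_upwards [hf0 k] with z hz
    exact Real.norm_of_nonneg hz
  have h3 : liminf (fun k => ∫⁻ z, ‖f k z‖ₑ ∂ν) atTop ≤ ENNReal.ofReal C := by
    refine liminf_le_of_le (by isBoundedDefault) fun b hb => ?_
    obtain ⟨k, hk⟩ := hb.exists
    exact hk.trans (h2 k)
  exact (h1.trans h3).trans_lt ENNReal.ofReal_lt_top

theorem tendsto_setIntegral_zero {α : Type*} {mα : MeasurableSpace α} {ν : Measure α} {S : Set α}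
    (hS : MeasurableSet S) {R : ℕ → α → ℝ} {B : α → ℝ} (hB : IntegrableOn B S ν)
    (hm : ∀ k, AEStronglyMeasurable (R k) (ν.restrict S)) (hb : ∀ k, ∀ z ∈ S, |R k z| ≤ B z)
    (hl : ∀ z ∈ S, Tendsto (fun k => R k z) atTop (𝓝 0)) :
    (∀ k, IntegrableOn (R k) S ν) ∧ Tendsto (fun k => ∫ z in S, R k z ∂ν) atTop (𝓝 0) := by
  have hb' : ∀ k, ∀ᵐ z ∂ν.restrict S, ‖R k z‖ ≤ B z := fun k => by
    filter_upwards [ae_restrict_mem hS] with z hz using hb k z hz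
  refine ⟨fun k => Integrable.mono' hB (hm k) (hb' k), ?_⟩
  have := tendsto_integral_of_dominated_convergence B hm hB hb'
    (by filter_upwards [ae_restrict_mem hS] with z hz using hl z hz)
  simpa using this

theorem abs_real_inner_le_of_sq_le {x y : EuclideanSpace ℝ (Fin m)} {g : ℝ} (hx : ‖x‖ ^ 2 ≤ g)
    (hy : ‖y‖ ^ 2 ≤ g) : |⟪x, y⟫| ≤ g := by
  refine (abs_real_inner_le_norm x y).trans ?_
  nlinarith [sq_nonneg (‖x‖ - ‖y‖)]

theorem gradSq_nonneg (Du : Fin (n + 1) → SpaceTime n → EuclideanSpace ℝ (Fin m))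
    (z : SpaceTime n) : 0 ≤ gradSq Du z := Finset.sum_nonneg fun _ _ => by positivity

theorem norm_sq_le_gradSq (Du : Fin (n + 1) → SpaceTime n → EuclideanSpace ℝ (Fin m))
    (j : Fin n) (z : SpaceTime n) : ‖Du j.succ z‖ ^ 2 ≤ gradSq Du z :=
  Finset.single_le_sum (f := fun j : Fin n => ‖Du j.succ z‖ ^ 2) (fun _ _ => by positivity)
    (Finset.mem_univ j)

section

variable {F : EuclideanSpace ℝ (Fin m) → ℝ} {a b a' b' β T : ℝ} {x₀ : EuclideanSpace ℝ (Fin n)}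
  {u : SpaceTime n → EuclideanSpace ℝ (Fin m)}
  {Du : Fin (n + 1) → SpaceTime n → EuclideanSpace ℝ (Fin m)}
  {X : ℕ → SpaceTime n → ℝ} {C : ℝ} {ζ : ℝ → ℝ}

theorem IsCutoffSeq.abs_sum_le (hX : IsCutoffSeq x₀ X C) (k : ℕ) (z : SpaceTime n) :
    |∑ j : Fin n, (z.2 j - x₀ j) * pd j.succ (X k) z| ≤ n * C := by
  refine (Finset.abs_sum_le_sum_abs _ _).trans ?_
  have : ∀ j ∈ (Finset.univ : Finset (Fin n)), |(z.2 j - x₀ j) * pd j.succ (X k) z| ≤ C := by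
    intro j _
    rw [abs_mul]
    refine le_trans ?_ (hX.mul_pd_le k j z)
    gcongr
    exact PiLp.norm_apply_le (z.2 - x₀) j
  refine (Finset.sum_le_sum this).trans ?_
  simp

theorem IsCutoffSeq.tendsto_sum (hX : IsCutoffSeq x₀ X C) (c : Fin n → ℝ) (z : SpaceTime n) :
    Tendsto (fun k => ∑ j : Fin n, pd j.succ (X k) z * c j) atTop (𝓝 0) := by
  have := tendsto_finsetSum (Finset.univ : Finset (Fin n)) fun j _ =>
    (hX.tendsto_pd j z).mul_const (c j)
  simpa using this

/-- The dilation derivative grows like `‖x - x₀‖`, and this growth is absorbed by the scale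
invariant bound on the cutoff gradient. Thus only integrals without a spatial moment are needed to
dominate the error terms. -/
theorem IsCutoffSeq.abs_pd_mul_inner_le (hX : IsCutoffSeq x₀ X C) (k : ℕ) (j : Fin n)
    (z : SpaceTime n) : |pd j.succ (X k) z * ⟪Du j.succ z, dilationDeriv T x₀ Du z⟫| ≤
      (2 * |z.1 - T| + n) * C * (‖Du 0 z‖ ^ 2 + gradSq Du z) := by
  set g := ‖Du 0 z‖ ^ 2 + gradSq Du z with hg
  have hC := hX.const_nonneg j
  have hgr := gradSq_nonneg Du z
  have h0 : ‖Du 0 z‖ ^ 2 ≤ g := by linarith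
  have hj : ∀ i : Fin n, ‖Du i.succ z‖ ^ 2 ≤ g := fun i => by
    have := norm_sq_le_gradSq Du i z
    nlinarith [sq_nonneg ‖Du 0 z‖]
  have hg0 : 0 ≤ g := (sq_nonneg _).trans h0
  have hp := hX.pd_le k j z
  rw [inner_dilationDeriv, mul_add, Finset.mul_sum]
  refine (abs_add_le _ _).trans ?_
  have e1 : |pd j.succ (X k) z * (2 * (z.1 - T) * ⟪Du j.succ z, Du 0 z⟫)| ≤
      2 * |z.1 - T| * C * g := by
    rw [abs_mul, abs_mul, abs_mul, abs_two]
    have := abs_real_inner_le_of_sq_le (hj j) h0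
    calc _ ≤ C * (2 * |z.1 - T| * g) := by gcongr
      _ = _ := by ring
  have e2 : |∑ i : Fin n, pd j.succ (X k) z * ((z.2 i - x₀ i) * ⟪Du j.succ z, Du i.succ z⟫)| ≤
      n * (C * g) := by
    refine (Finset.abs_sum_le_sum_abs _ _).trans ?_
    have : ∀ i ∈ (Finset.univ : Finset (Fin n)),
        |pd j.succ (X k) z * ((z.2 i - x₀ i) * ⟪Du j.succ z, Du i.succ z⟫)| ≤ C * g := by
      intro i _
      rw [← mul_assoc, abs_mul, abs_mul]
      have h1 := abs_real_inner_le_of_sq_le (hj j) (hj i)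
      have h2 : |pd j.succ (X k) z| * |z.2 i - x₀ i| ≤ C := by
        refine le_trans ?_ (hX.mul_pd_le k j z)
        rw [mul_comm]
        gcongr
        exact PiLp.norm_apply_le (z.2 - x₀) i
      gcongr
    refine (Finset.sum_le_sum this).trans ?_
    simp
  calc _ ≤ 2 * |z.1 - T| * C * g + n * (C * g) := add_le_add e1 e2
    _ = _ := by ring

theorem aestronglyMeasurable_dilationDeriv {S : Set (SpaceTime n)}
    (hDu : ∀ k, AEStronglyMeasurable (Du k) (volume.restrict S)) :
    AEStronglyMeasurable (dilationDeriv T x₀ Du) (volume.restrict S) := by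
  have : dilationDeriv T x₀ Du = ∑ k, fun z => dilationField T x₀ k z • Du k z := by
    ext1 z
    simp [dilationDeriv]
  rw [this]
  exact Finset.aestronglyMeasurable_sum _ fun k _ =>
    (contDiff_dilationField T x₀ k).continuous.aestronglyMeasurable.smul (hDu k)

theorem locallyIntegrableOn_dilationDeriv_sq (h : IsVariationalSolution F a b u Du) :
    LocallyIntegrableOn (fun z => ‖dilationDeriv T x₀ Du z‖ ^ 2) (strip n a b) := by
  rw [locallyIntegrableOn_iff (isOpen_strip a b).isLocallyClosed]
  intro K hK hKc
  have hmono := Measure.restrict_mono hK (le_refl (volume : Measure (SpaceTime n)))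
  have : MemLp (dilationDeriv T x₀ Du) 2 (volume.restrict K) := by
    have e : dilationDeriv T x₀ Du = fun z => ∑ k, dilationField T x₀ k z • Du k z := rfl
    rw [e]
    refine memLp_finsetSum _ fun k _ => ?_
    obtain ⟨M, hM⟩ := hKc.exists_bound_of_continuousOn
      (contDiff_dilationField T x₀ k).continuous.continuousOn
    have hD := (h.memH1.memLp_grad k).mono_measure hmono
    refine MemLp.of_le_mul (c := M) hD
      ((contDiff_dilationField T x₀ k).continuous.aestronglyMeasurable.smul hD.1) ?_
    filter_upwards [ae_restrict_mem hKc.measurableSet] with z hz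
    rw [norm_smul]
    have := hM z hz
    gcongr
  simpa only [real_inner_self_eq_norm_sq] using integrable_inner this this

/-- The first variation identity in the limit of spatial cutoffs. -/
theorem tendsto_integral_cutoff_mul_dilationDeriv_sq (h : IsVariationalSolution F a b u Du)
    (ha : a ≤ a') (hb : b' ≤ b) (hT : T ∉ Ioo a' b') (hX : IsCutoffSeq x₀ X C)
    (hζ : IsTimeTest a' b' ζ) (hL : LayerIntegrable F β T x₀ u Du (strip n a' b')) :
    (∀ k, IntegrableOn (fun z => X k z * (ζ z.1 * (weight T x₀ z *
      ‖dilationDeriv T x₀ Du z‖ ^ 2))) (strip n a' b')) ∧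
    Tendsto (fun k => ∫ z in strip n a' b', X k z * (ζ z.1 * (weight T x₀ z *
      ‖dilationDeriv T x₀ Du z‖ ^ 2))) atTop
      (𝓝 (∫ z in strip n a' b', ((2 * (z.1 - T) ^ 2 * deriv ζ z.1 + 2 * (z.1 - T) * ζ z.1) *
          (weight T x₀ z * energy F u Du z)
        - 2 * (z.1 - T) * ζ z.1 * (weight T x₀ z * gradSq Du z)))) := by
  set S := strip n a' b' with hSdef
  have hS : MeasurableSet S := measurableSet_strip _ _
  have hSU := strip_subset_strip (n := n) ha hb
  have hmono := Measure.restrict_mono hSU (le_refl (volume : Measure (SpaceTime n)))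
  have hDm : ∀ k, AEStronglyMeasurable (Du k) (volume.restrict S) := fun k =>
    (h.memH1.memLp_grad k).1.mono_measure hmono
  have hEm := aestronglyMeasurable_dilationDeriv (T := T) (x₀ := x₀) hDm
  have hζc := hζ.smooth.continuous
  have hζd := hζ.continuous_deriv
  have hTζ : T ∉ tsupport ζ := fun hm => hT (hζ.subset hm)
  have hWm := (measurable_weight T x₀).aestronglyMeasurable (μ := volume.restrict S)
  set A : SpaceTime n → ℝ := fun z =>
    (2 * (z.1 - T) ^ 2 * deriv ζ z.1 + 2 * (z.1 - T) * ζ z.1) * (weight T x₀ z * energy F u Du z)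
      - 2 * (z.1 - T) * ζ z.1 * (weight T x₀ z * gradSq Du z) with hA
  set Q : SpaceTime n → ℝ := fun z => ζ z.1 * (weight T x₀ z * ‖dilationDeriv T x₀ Du z‖ ^ 2)
    with hQ
  set R : ℕ → SpaceTime n → ℝ := fun k z =>
    (z.1 - T) * ζ z.1 * ((∑ j : Fin n, (z.2 j - x₀ j) * pd j.succ (X k) z) *
          (weight T x₀ z * energy F u Du z)
        - 2 * ∑ j : Fin n, pd j.succ (X k) z *
          (weight T x₀ z * ⟪Du j.succ z, dilationDeriv T x₀ Du z⟫)) with hR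
  have iA : IntegrableOn A S :=
    (integrable_time_mul (c := fun t => 2 * (t - T) ^ 2 * deriv ζ t + 2 * (t - T) * ζ t)
      (by fun_prop) hL.energy).sub
      (integrable_time_mul (c := fun t => 2 * (t - T) * ζ t) (by fun_prop) hL.grad)
  have hXb : ∀ k z, |X k z| ≤ 1 := fun k z => by
    rw [abs_of_nonneg (hX.nonneg k z)]; exact hX.le_one k z
  have hXm : ∀ k, AEStronglyMeasurable (X k) (volume.restrict S) := fun k =>
    (hX.smooth k).continuous.aestronglyMeasurable
  -- Nothing is known yet about `W|E|²` on the whole strip; for fixed `k` the compact support of the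
  -- cutoff and the local square integrability of `E` suffice.
  have iXQ : ∀ k, IntegrableOn (fun z => X k z * Q z) S := by
    intro k
    have hθ := hX.isTest hζ.smooth hζ.compact (hζ.subset.trans (Ioo_subset_Ioo ha hb)) hTζ k
    have := (hθ.integrable_mul (locallyIntegrableOn_dilationDeriv_sq (T := T) (x₀ := x₀) h)).mono_set
      hSU
    refine this.congr (Eventually.of_forall fun z => ?_)
    simp only [hQ]
    ring
  obtain ⟨iR, limR⟩ : (∀ k, IntegrableOn (R k) S) ∧
      Tendsto (fun k => ∫ z in S, R k z) atTop (𝓝 0) := by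
    refine tendsto_setIntegral_zero hS (B := fun z => |(z.1 - T) * ζ z.1| * (n * C) *
        |weight T x₀ z * energy F u Du z| +
        |(z.1 - T) * ζ z.1| * (2 * (n * ((2 * |z.1 - T| + n) * C))) *
          (weight T x₀ z * ‖Du 0 z‖ ^ 2 + weight T x₀ z * gradSq Du z)) ?_ ?_ ?_ ?_
    · exact (integrable_time_mul (c := fun t => |(t - T) * ζ t| * (n * C)) (by fun_prop)
        hL.energy.abs).add (integrable_time_mul
          (c := fun t => |(t - T) * ζ t| * (2 * (n * ((2 * |t - T| + n) * C)))) (by fun_prop)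
        (hL.time.add hL.grad))
    · intro k
      have m1 : AEStronglyMeasurable (fun z : SpaceTime n => (z.1 - T) * ζ z.1)
        (volume.restrict S) := by
        refine Continuous.aestronglyMeasurable ?_
        fun_prop
      refine m1.mul (AEStronglyMeasurable.sub ?_ ?_)
      · refine AEStronglyMeasurable.mul ?_ hL.energy.1
        refine Continuous.aestronglyMeasurable ?_
        exact continuous_finsetSum _ fun j _ => ((contDiff_dilationField T x₀ j.succ).continuous.mul
          (contDiff_pd (hX.smooth k) j.succ).continuous)
      · refine AEStronglyMeasurable.const_mul ?_ 2
        refine Finset.aestronglyMeasurable_fun_sum _ fun j _ => ?_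
        exact (contDiff_pd (hX.smooth k) j.succ).continuous.aestronglyMeasurable.mul
          (hWm.mul ((hDm j.succ).inner hEm))
    · intro k z _
      simp only [hR]
      rw [abs_mul, mul_assoc, mul_assoc |(z.1 - T) * ζ z.1|, ← mul_add]
      refine mul_le_mul_of_nonneg_left ?_ (abs_nonneg _)
      refine (abs_sub _ _).trans (add_le_add ?_ ?_)
      · rw [abs_mul]
        exact mul_le_mul_of_nonneg_right (hX.abs_sum_le k z) (abs_nonneg _)
      · rw [abs_mul, abs_two, mul_assoc 2]
        refine mul_le_mul_of_nonneg_left ?_ zero_le_two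
        refine (Finset.abs_sum_le_sum_abs _ _).trans ?_
        have : ∀ j ∈ (Finset.univ : Finset (Fin n)), |pd j.succ (X k) z * (weight T x₀ z *
            ⟪Du j.succ z, dilationDeriv T x₀ Du z⟫)| ≤ weight T x₀ z *
            ((2 * |z.1 - T| + n) * C * (‖Du 0 z‖ ^ 2 + gradSq Du z)) := by
          intro j _
          rw [mul_left_comm, abs_mul, abs_of_nonneg (weight_nonneg T x₀ z)]
          exact mul_le_mul_of_nonneg_left (hX.abs_pd_mul_inner_le k j z) (weight_nonneg T x₀ z)
        refine (Finset.sum_le_sum this).trans (le_of_eq ?_)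
        simp
        ring
    · intro z _
      have t1 := (hX.tendsto_sum (fun j => z.2 j - x₀ j) z).mul_const
        (weight T x₀ z * energy F u Du z)
      have t2 := (hX.tendsto_sum (fun j => weight T x₀ z *
        ⟪Du j.succ z, dilationDeriv T x₀ Du z⟫) z).const_mul 2
      have t3 := (t1.sub t2).const_mul ((z.1 - T) * ζ z.1)
      simpa [hR, mul_comm] using t3
  refine ⟨iXQ, ?_⟩
  have limA : Tendsto (fun k => ∫ z in S, X k z * A z) atTop (𝓝 (∫ z in S, A z)) := by
    have := tendsto_integral_bdd_mul hXm (fun k => Eventually.of_forall (hXb k))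
      (Eventually.of_forall hX.tendsto_one) iA
    simpa using this
  have iXA : ∀ k, IntegrableOn (fun z => X k z * A z) S := fun k =>
    iA.bdd_mul (hXm k) (Eventually.of_forall (hXb k))
  have hlim := limA.add limR
  rw [add_zero] at hlim
  refine hlim.congr fun k => ?_
  have key := integral_firstVariation_truncated h ha hb hT hX hζ k
  have e : ∫ z in S, (X k z * A z - X k z * Q z + R k z) = 0 := by
    rw [← key]
    refine integral_congr_ae (Eventually.of_forall fun z => ?_)
    simp only [hA, hQ, hR]
    ring
  have iXAQ : IntegrableOn (fun z => X k z * A z - X k z * Q z) S := (iXA k).sub (iXQ k)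
  rw [integral_add iXAQ (iR k), integral_sub (iXA k) (iXQ k)] at e
  linarith

end

theorem exists_isTimeTest_eq_one {a b a' b' : ℝ} (h1 : a < a') (h2 : a' < b') (h3 : b' < b) :
    ∃ ζ, IsTimeTest a b ζ ∧ (∀ t, 0 ≤ ζ t) ∧ (∀ t ∈ Icc a' b', ζ t = 1) ∧ ∀ t, ζ t ≤ 1 := by
  have hd : 0 < min (a' - a) (b - b') := lt_min (by linarith) (by linarith)
  let χ : ContDiffBump ((a' + b') / 2) :=
    ⟨(b' - a') / 2, (b' - a') / 2 + min (a' - a) (b - b') / 2, by linarith, by linarith⟩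
  have l1 := min_le_left (a' - a) (b - b')
  have l2 := min_le_right (a' - a) (b - b')
  refine ⟨χ, ⟨χ.contDiff, χ.hasCompactSupport, ?_⟩, fun t => χ.nonneg, fun t ht => ?_,
    fun t => χ.le_one⟩
  · rw [χ.tsupport_eq, Real.closedBall_eq_Icc]
    intro t ht
    change t ∈ Icc ((a' + b') / 2 - ((b' - a') / 2 + min (a' - a) (b - b') / 2))
      ((a' + b') / 2 + ((b' - a') / 2 + min (a' - a) (b - b') / 2)) at ht
    exact ⟨by linarith [ht.1], by linarith [ht.2]⟩
  · refine χ.one_of_mem_closedBall ?_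
    rw [Real.closedBall_eq_Icc]
    change t ∈ Icc ((a' + b') / 2 - (b' - a') / 2) ((a' + b') / 2 + (b' - a') / 2)
    exact ⟨by linarith [ht.1], by linarith [ht.2]⟩

theorem integral_linear_comb_eq_zero {α : Type*} {mα : MeasurableSpace α} {ν : Measure α}
    {f g h : α → ℝ} (If : ∫ z, f z ∂ν = 0) (Ig : ∫ z, g z ∂ν = 0) (Ih : ∫ z, h z ∂ν = 0)
    (hf : Integrable f ν) (hg : Integrable g ν) (hh : Integrable h ν) (c d : ℝ) :
    ∫ z, (f z - c * g z - d * h z) ∂ν = 0 := by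
  have h1 : Integrable (fun z => f z - c * g z) ν := hf.sub (hg.const_mul c)
  rw [integral_sub h1 (hh.const_mul d), integral_sub hf (hg.const_mul c),
    integral_const_mul, integral_const_mul, If, Ig, Ih]
  simp

section

variable {F : EuclideanSpace ℝ (Fin m) → ℝ} {a b a' b' β T : ℝ} {x₀ : EuclideanSpace ℝ (Fin n)}
  {u : SpaceTime n → EuclideanSpace ℝ (Fin m)}
  {Du : Fin (n + 1) → SpaceTime n → EuclideanSpace ℝ (Fin m)} {ζ : ℝ → ℝ}

/-- The integrals with spatial cutoffs converge, hence are bounded, and the integrands are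
nonnegative, so Fatou applies. The larger strip leaves room for a time cutoff equal to `1` on the
smaller one. -/
theorem integrableOn_weight_mul_dilationDeriv_sq (h : IsVariationalSolution F a b u Du)
    {a'' b'' : ℝ} (ha : a ≤ a'') (ha' : a'' < a') (hab : a' < b') (hb' : b' < b'') (hb : b'' ≤ b)
    (hT : T ∉ Ioo a'' b'') (hL : LayerIntegrable F β T x₀ u Du (strip n a'' b'')) :
    IntegrableOn (fun z => weight T x₀ z * ‖dilationDeriv T x₀ Du z‖ ^ 2) (strip n a' b') := by
  obtain ⟨X, C, hX⟩ := exists_isCutoffSeq x₀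
  obtain ⟨ζ, hζ, hζ0, hζ1, -⟩ := exists_isTimeTest_eq_one ha' hab hb'
  obtain ⟨hi, hlim⟩ := tendsto_integral_cutoff_mul_dilationDeriv_sq h ha hb hT hX hζ hL
  obtain ⟨M, hM⟩ := hlim.bddAbove_range
  have hint : IntegrableOn (fun z => ζ z.1 * (weight T x₀ z * ‖dilationDeriv T x₀ Du z‖ ^ 2))
      (strip n a'' b'') := by
    refine integrable_of_tendsto_of_integral_le hi (fun k => Eventually.of_forall fun z => ?_)
      (Eventually.of_forall fun z => ?_) (fun k => hM ⟨k, rfl⟩)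
    · exact mul_nonneg (hX.nonneg k z) (mul_nonneg (hζ0 _)
        (mul_nonneg (weight_nonneg T x₀ z) (sq_nonneg _)))
    · simpa using (hX.tendsto_one z).mul_const (ζ z.1 *
        (weight T x₀ z * ‖dilationDeriv T x₀ Du z‖ ^ 2))
  refine (hint.mono_set (strip_subset_strip ha'.le hb'.le)).congr_fun (fun z hz => ?_)
    (measurableSet_strip _ _)
  rw [mem_strip] at hz
  simp only
  rw [hζ1 z.1 ⟨hz.1.le, hz.2.le⟩, one_mul]

theorem integrable_weight_inner {S : Set (SpaceTime n)}
    {f g : SpaceTime n → EuclideanSpace ℝ (Fin m)}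
    (hfm : AEStronglyMeasurable f (volume.restrict S))
    (hgm : AEStronglyMeasurable g (volume.restrict S))
    (hf : IntegrableOn (fun z => weight T x₀ z * ‖f z‖ ^ 2) S)
    (hg : IntegrableOn (fun z => weight T x₀ z * ‖g z‖ ^ 2) S) :
    IntegrableOn (fun z => weight T x₀ z * ⟪f z, g z⟫) S := by
  refine Integrable.mono' (hf.add hg)
    ((measurable_weight T x₀).aestronglyMeasurable.mul (hfm.inner hgm))
    (Eventually.of_forall fun z => ?_)
  rw [Real.norm_eq_abs, abs_mul, abs_of_nonneg (weight_nonneg T x₀ z), Pi.add_apply, ← mul_add]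
  refine mul_le_mul_of_nonneg_left ?_ (weight_nonneg T x₀ z)
  exact abs_real_inner_le_of_sq_le (by linarith [sq_nonneg ‖g z‖]) (by linarith [sq_nonneg ‖f z‖])

/-- Once `W|E|²` is integrable, dominated convergence identifies the limit of the cutoff integrals
with the full integral. -/
theorem integral_firstVariation_eq_zero
    (h : IsVariationalSolution F a b u Du) (ha : a ≤ a') (hb : b' ≤ b) (hT : T ∉ Ioo a' b')
    (hζ : IsTimeTest a' b' ζ) (hL : LayerIntegrable F β T x₀ u Du (strip n a' b'))
    (hE : IntegrableOn (fun z => weight T x₀ z * ‖dilationDeriv T x₀ Du z‖ ^ 2) (strip n a' b')) :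
    ∫ z in strip n a' b', (ζ z.1 * (weight T x₀ z * ‖dilationDeriv T x₀ Du z‖ ^ 2) -
      ((2 * (z.1 - T) ^ 2 * deriv ζ z.1 + 2 * (z.1 - T) * ζ z.1) *
          (weight T x₀ z * energy F u Du z)
        - 2 * (z.1 - T) * ζ z.1 * (weight T x₀ z * gradSq Du z))) = 0 := by
  obtain ⟨X, C, hX⟩ := exists_isCutoffSeq x₀
  have hζc := hζ.smooth.continuous
  have hζd := hζ.continuous_deriv
  obtain ⟨-, hlim⟩ := tendsto_integral_cutoff_mul_dilationDeriv_sq h ha hb hT hX hζ hL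
  have iQ := integrable_time_mul hζc hE
  have limQ := tendsto_integral_bdd_mul (ν := volume.restrict (strip n a' b')) (C := 1)
    (fun k => (hX.smooth k).continuous.aestronglyMeasurable)
    (fun k => Eventually.of_forall fun z => by
      rw [abs_of_nonneg (hX.nonneg k z)]; exact hX.le_one k z)
    (Eventually.of_forall hX.tendsto_one) iQ
  have := tendsto_nhds_unique limQ hlim
  simp only [one_mul] at this
  rw [integral_sub iQ, this, sub_self]
  exact (integrable_time_mul (c := fun t => 2 * (t - T) ^ 2 * deriv ζ t + 2 * (t - T) * ζ t)
      (by fun_prop) hL.energy).sub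
      (integrable_time_mul (c := fun t => 2 * (t - T) * ζ t) (by fun_prop) hL.grad)

theorem integral_test_self_eq_zero
    (h : IsVariationalSolution F a b u Du) (ha : a ≤ a') (hb : b' ≤ b) (hT : T ∉ Ioo a' b')
    (hζ : IsTimeTest a' b' ζ) (hL : LayerIntegrable F β T x₀ u Du (strip n a' b'))
    (hE : IntegrableOn (fun z => weight T x₀ z * ‖dilationDeriv T x₀ Du z‖ ^ 2) (strip n a' b')) :
    ∫ z in strip n a' b', (ζ z.1 / 2 * β * (weight T x₀ z * ⟪u z, dilationDeriv T x₀ Du z⟫)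
        + (z.1 - T) * ζ z.1 * β * (weight T x₀ z * gradSq Du z)
        - (z.1 - T) * ζ z.1 * (weight T x₀ z * (β * ⟪u z, gradient F (u z)⟫))) = 0 := by
  obtain ⟨X, C, hX⟩ := exists_isCutoffSeq x₀
  have hζc := hζ.smooth.continuous
  set S := strip n a' b' with hSdef
  have hS : MeasurableSet S := measurableSet_strip _ _
  have hmono := Measure.restrict_mono (strip_subset_strip (n := n) ha hb)
    (le_refl (volume : Measure (SpaceTime n)))
  have hDm : ∀ k, AEStronglyMeasurable (Du k) (volume.restrict S) := fun k =>
    (h.memH1.memLp_grad k).1.mono_measure hmono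
  have hum : AEStronglyMeasurable u (volume.restrict S) := h.memH1.memLp.1.mono_measure hmono
  have hEm := aestronglyMeasurable_dilationDeriv (T := T) (x₀ := x₀) hDm
  have hWm := (measurable_weight T x₀).aestronglyMeasurable (μ := volume.restrict S)
  have iuE := integrable_weight_inner hum hEm hL.sq hE
  set A : SpaceTime n → ℝ := fun z =>
    ζ z.1 / 2 * β * (weight T x₀ z * ⟪u z, dilationDeriv T x₀ Du z⟫)
        + (z.1 - T) * ζ z.1 * β * (weight T x₀ z * gradSq Du z)
        - (z.1 - T) * ζ z.1 * (weight T x₀ z * (β * ⟪u z, gradient F (u z)⟫)) with hA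
  set R : ℕ → SpaceTime n → ℝ := fun k z => (z.1 - T) * ζ z.1 * β *
    ∑ j : Fin n, pd j.succ (X k) z * (weight T x₀ z * ⟪u z, Du j.succ z⟫) with hR
  have iA : IntegrableOn A S :=
    ((integrable_time_mul (c := fun t => ζ t / 2 * β) (by fun_prop) iuE).add
      (integrable_time_mul (c := fun t => (t - T) * ζ t * β) (by fun_prop) hL.grad)).sub
      (integrable_time_mul (c := fun t => (t - T) * ζ t) (by fun_prop) hL.reaction)
  have iuD : ∀ j : Fin n, IntegrableOn (fun z => weight T x₀ z * ⟪u z, Du j.succ z⟫) S := by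
    intro j
    refine integrable_weight_inner hum (hDm _) hL.sq (Integrable.mono' hL.grad
      (hWm.mul ((hDm _).norm.pow 2)) (Eventually.of_forall fun z => ?_))
    rw [Real.norm_of_nonneg (mul_nonneg (weight_nonneg T x₀ z) (sq_nonneg _))]
    exact mul_le_mul_of_nonneg_left (norm_sq_le_gradSq Du j z) (weight_nonneg T x₀ z)
  have hXb : ∀ k z, |X k z| ≤ 1 := fun k z => by
    rw [abs_of_nonneg (hX.nonneg k z)]; exact hX.le_one k z
  have hXm : ∀ k, AEStronglyMeasurable (X k) (volume.restrict S) := fun k =>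
    (hX.smooth k).continuous.aestronglyMeasurable
  obtain ⟨iR, limR⟩ : (∀ k, IntegrableOn (R k) S) ∧
      Tendsto (fun k => ∫ z in S, R k z) atTop (𝓝 0) := by
    refine tendsto_setIntegral_zero hS (B := fun z => |(z.1 - T) * ζ z.1 * β| * C *
      ∑ j : Fin n, |weight T x₀ z * ⟪u z, Du j.succ z⟫|) ?_ ?_ ?_ ?_
    · exact integrable_time_mul (c := fun t => |(t - T) * ζ t * β| * C) (by fun_prop)
        (integrable_finsetSum _ fun j _ => (iuD j).abs)
    · intro k
      refine AEStronglyMeasurable.mul ?_ (Finset.aestronglyMeasurable_fun_sum _ fun j _ =>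
        (contDiff_pd (hX.smooth k) j.succ).continuous.aestronglyMeasurable.mul (iuD j).1)
      refine Continuous.aestronglyMeasurable ?_
      fun_prop
    · intro k z _
      simp only [hR]
      rw [abs_mul, mul_assoc |(z.1 - T) * ζ z.1 * β|]
      refine mul_le_mul_of_nonneg_left ?_ (abs_nonneg _)
      rw [Finset.mul_sum]
      refine (Finset.abs_sum_le_sum_abs _ _).trans (Finset.sum_le_sum fun j _ => ?_)
      rw [abs_mul]
      exact mul_le_mul_of_nonneg_right (hX.pd_le k j z) (abs_nonneg _)
    · intro z _
      simpa [hR] using (hX.tendsto_sum (fun j => weight T x₀ z * ⟪u z, Du j.succ z⟫) z).const_mul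
        ((z.1 - T) * ζ z.1 * β)
  have limA : Tendsto (fun k => ∫ z in S, X k z * A z) atTop (𝓝 (∫ z in S, A z)) := by
    have := tendsto_integral_bdd_mul hXm (fun k => Eventually.of_forall (hXb k))
      (Eventually.of_forall hX.tendsto_one) iA
    simpa using this
  have iXA : ∀ k, IntegrableOn (fun z => X k z * A z) S := fun k =>
    iA.bdd_mul (hXm k) (Eventually.of_forall (hXb k))
  have hlim := limA.add limR
  rw [add_zero] at hlim
  refine tendsto_nhds_unique hlim (tendsto_const_nhds.congr fun k => ?_)
  -- The identity is multiplied by `β` before the cutoff is removed, since integrability is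
  -- available only for `β u·f(u)`; for `β = 0` nothing is claimed about `u·f(u)` itself.
  have key := congrArg (fun r => β * r) (integral_test_self_truncated h ha hb hT hX hζ k)
  simp only [mul_zero] at key
  rw [← integral_const_mul] at key
  rw [← integral_add (iXA k) (iR k), ← key]
  refine integral_congr_ae (Eventually.of_forall fun z => ?_)
  simp only [hA, hR]
  ring

theorem integral_dilation_norm_sq_eq_zero
    (h : IsVariationalSolution F a b u Du) (ha : a ≤ a') (hb : b' ≤ b) (hT : T ∉ Ioo a' b')
    (hζ : IsTimeTest a' b' ζ) (hL : LayerIntegrable F β T x₀ u Du (strip n a' b'))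
    (hE : IntegrableOn (fun z => weight T x₀ z * ‖dilationDeriv T x₀ Du z‖ ^ 2) (strip n a' b')) :
    ∫ z in strip n a' b', (2 * ζ z.1 * (weight T x₀ z * ⟪u z, dilationDeriv T x₀ Du z⟫)
        + 2 * (z.1 - T) * deriv ζ z.1 * (weight T x₀ z * ‖u z‖ ^ 2)) = 0 := by
  obtain ⟨X, C, hX⟩ := exists_isCutoffSeq x₀
  have hζc := hζ.smooth.continuous
  have hζd := hζ.continuous_deriv
  set S := strip n a' b' with hSdef
  have hS : MeasurableSet S := measurableSet_strip _ _
  have hmono := Measure.restrict_mono (strip_subset_strip (n := n) ha hb)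
    (le_refl (volume : Measure (SpaceTime n)))
  have hum : AEStronglyMeasurable u (volume.restrict S) := h.memH1.memLp.1.mono_measure hmono
  have hEm := aestronglyMeasurable_dilationDeriv (T := T) (x₀ := x₀) (S := S)
    fun k => (h.memH1.memLp_grad k).1.mono_measure hmono
  have iuE := integrable_weight_inner hum hEm hL.sq hE
  set A : SpaceTime n → ℝ := fun z =>
    2 * ζ z.1 * (weight T x₀ z * ⟪u z, dilationDeriv T x₀ Du z⟫)
        + 2 * (z.1 - T) * deriv ζ z.1 * (weight T x₀ z * ‖u z‖ ^ 2) with hA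
  set Y : ℕ → SpaceTime n → ℝ := fun k z => ∑ j : Fin n, (z.2 j - x₀ j) * pd j.succ (X k) z with hY
  have iA : IntegrableOn A S :=
    (integrable_time_mul (c := fun t => 2 * ζ t) (by fun_prop) iuE).add
      (integrable_time_mul (c := fun t => 2 * (t - T) * deriv ζ t) (by fun_prop) hL.sq)
  have iB : IntegrableOn (fun z => ζ z.1 * (weight T x₀ z * ‖u z‖ ^ 2)) S :=
    integrable_time_mul hζc hL.sq
  have hXb : ∀ k z, |X k z| ≤ 1 := fun k z => by
    rw [abs_of_nonneg (hX.nonneg k z)]; exact hX.le_one k z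
  have hXm : ∀ k, AEStronglyMeasurable (X k) (volume.restrict S) := fun k =>
    (hX.smooth k).continuous.aestronglyMeasurable
  have hYm : ∀ k, AEStronglyMeasurable (Y k) (volume.restrict S) := fun k =>
    (continuous_finsetSum _ fun j _ => ((contDiff_dilationField T x₀ j.succ).continuous.mul
      (contDiff_pd (hX.smooth k) j.succ).continuous)).aestronglyMeasurable
  have limA := tendsto_integral_bdd_mul hXm (fun k => Eventually.of_forall (hXb k))
      (Eventually.of_forall hX.tendsto_one) iA
  have limY := tendsto_integral_bdd_mul (a₀ := fun _ => 0) hYm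
    (fun k => Eventually.of_forall (hX.abs_sum_le k))
    (Eventually.of_forall fun z => by
      simpa [hY, mul_comm] using hX.tendsto_sum (fun j => z.2 j - x₀ j) z) iB
  have hlim := limA.add limY
  simp only [one_mul, zero_mul, integral_zero, add_zero] at hlim
  refine tendsto_nhds_unique hlim (tendsto_const_nhds.congr fun k => ?_)
  rw [← integral_dilation_norm_sq_truncated h ha hb hT hX hζ k, ← integral_add
    (iA.bdd_mul (hXm k) (Eventually.of_forall (hXb k)))
    (iB.bdd_mul (hYm k) (Eventually.of_forall (hX.abs_sum_le k)))]
  refine integral_congr_ae (Eventually.of_forall fun z => ?_)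
  simp only [hA, hY]
  ring

/-- The fundamental identity behind the monotonicity formula. -/
theorem integral_energyDensity_add_dissipationDensity
    (h : IsVariationalSolution F a b u Du) (ha : a ≤ a') (hb : b' ≤ b) (hT : T ∉ Ioo a' b')
    (hζ : IsTimeTest a' b' ζ) (hL : LayerIntegrable F β T x₀ u Du (strip n a' b'))
    (hE : IntegrableOn (fun z => weight T x₀ z * ‖dilationDeriv T x₀ Du z‖ ^ 2) (strip n a' b')) :
    ∫ z in strip n a' b', ((2 * (z.1 - T) * deriv ζ z.1 + 2 * β * ζ z.1) *
      energyDensity F β T x₀ u Du z + ζ z.1 * dissipationDensity F β T x₀ u Du z) = 0 := by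
  have I1 := integral_firstVariation_eq_zero h ha hb hT hζ hL hE
  have I2 := integral_test_self_eq_zero h ha hb hT hζ hL hE
  have I3 := integral_dilation_norm_sq_eq_zero h ha hb hT hζ hL hE
  have hζc := hζ.smooth.continuous
  have hζd := hζ.continuous_deriv
  have hmono := Measure.restrict_mono (strip_subset_strip (n := n) ha hb)
    (le_refl (volume : Measure (SpaceTime n)))
  have hum : AEStronglyMeasurable u (volume.restrict (strip n a' b')) :=
    h.memH1.memLp.1.mono_measure hmono
  have hEm := aestronglyMeasurable_dilationDeriv (T := T) (x₀ := x₀) (S := strip n a' b')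
    fun k => (h.memH1.memLp_grad k).1.mono_measure hmono
  have iuE := integrable_weight_inner hum hEm hL.sq hE
  -- The second identity already carries a factor `β`. With the coefficients `2` and `β/2` the mixed
  -- terms add up to `-2β u·E`; the missing `β²|u|²` of the square is balanced by the `|u|²` part of
  -- `2βζ` times the energy density.
  refine Eq.trans ?_ (integral_linear_comb_eq_zero I1 I2 I3
    ((integrable_time_mul hζc hE).sub
      ((integrable_time_mul (c := fun t => 2 * (t - T) ^ 2 * deriv ζ t + 2 * (t - T) * ζ t)
        (by fun_prop) hL.energy).sub
        (integrable_time_mul (c := fun t => 2 * (t - T) * ζ t) (by fun_prop) hL.grad)))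
    (((integrable_time_mul (c := fun t => ζ t / 2 * β) (by fun_prop) iuE).add
      (integrable_time_mul (c := fun t => (t - T) * ζ t * β) (by fun_prop) hL.grad)).sub
      (integrable_time_mul (c := fun t => (t - T) * ζ t) (by fun_prop) hL.reaction))
    ((integrable_time_mul (c := fun t => 2 * ζ t) (by fun_prop) iuE).add
      (integrable_time_mul (c := fun t => 2 * (t - T) * deriv ζ t) (by fun_prop) hL.sq))
    2 (β / 2))
  refine setIntegral_congr_fun (measurableSet_strip _ _) fun z hz => ?_
  have hs := mem_strip_ne hT hz
  have hs' : T - z.1 ≠ 0 := fun h0 => hs (by linarith)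
  have e1 : 1 / (T - z.1) * ‖u z‖ ^ 2 * heatKernel T x₀ z = weight T x₀ z * ‖u z‖ ^ 2 := by
    rw [heatKernel_eq]
    field_simp
  have e2 : ‖homogeneityDefect β T x₀ u Du z‖ ^ 2 = ‖dilationDeriv T x₀ Du z‖ ^ 2 -
      2 * β * ⟪u z, dilationDeriv T x₀ Du z⟫ + β ^ 2 * ‖u z‖ ^ 2 := by
    rw [homogeneityDefect, norm_sub_sq_real, real_inner_smul_right, norm_smul, mul_pow,
      real_inner_comm, Real.norm_eq_abs, sq_abs]
    ring
  rw [energyDensity, dissipationDensity, e1, e2, heatKernel_eq, energy]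
  ring

end

/-! ### One-sided slabs and integrability on them. -/

/-- The points whose signed distance in time from `T` lies in `(α, γ)`. -/
def slab (n : ℕ) (σ T α γ : ℝ) : Set (SpaceTime n) := {z | σ * (z.1 - T) ∈ Ioo α γ}

section Slab

variable {σ T α γ α' γ' : ℝ}

theorem mem_slab {z : SpaceTime n} :
    z ∈ slab n σ T α γ ↔ α < σ * (z.1 - T) ∧ σ * (z.1 - T) < γ := Iff.rfl

theorem slab_one : slab n 1 T α γ = strip n (T + α) (T + γ) := by
  ext z
  rw [mem_slab, mem_strip, one_mul]
  constructor <;> rintro ⟨h1, h2⟩ <;> constructor <;> linarith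

theorem slab_neg_one : slab n (-1) T α γ = strip n (T - γ) (T - α) := by
  ext z
  rw [mem_slab, mem_strip]
  constructor <;> rintro ⟨h1, h2⟩ <;> constructor <;> linarith

theorem isOpen_slab : IsOpen (slab n σ T α γ) :=
  isOpen_Ioo.preimage (by fun_prop : Continuous fun z : SpaceTime n => σ * (z.1 - T))

theorem measurableSet_slab : MeasurableSet (slab n σ T α γ) := isOpen_slab.measurableSet

theorem slab_subset_slab (h1 : α' ≤ α) (h2 : γ ≤ γ') : slab n σ T α γ ⊆ slab n σ T α' γ' :=
  fun _ hz => ⟨h1.trans_lt hz.1, hz.2.trans_le h2⟩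

theorem slab_eq_empty (h : γ ≤ α) : slab n σ T α γ = ∅ :=
  eq_empty_of_forall_notMem fun _ hz => (hz.1.trans hz.2).not_ge h

theorem layerMinus_eq_slab (r : ℝ) : layerMinus n T r = slab n (-1) T (r ^ 2) (4 * r ^ 2) := by
  rw [slab_neg_one, layerMinus]

theorem layerPlus_eq_slab (r : ℝ) : layerPlus n T r = slab n 1 T (r ^ 2) (4 * r ^ 2) := by
  rw [slab_one, layerPlus]

theorem abs_time_eq (hσ : σ = 1 ∨ σ = -1) (z : SpaceTime n) (h : 0 < σ * (z.1 - T)) :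
    |T - z.1| = σ * (z.1 - T) := by
  rw [← abs_of_pos h, abs_mul, abs_sub_comm]
  rcases hσ with rfl | rfl <;> simp

theorem time_ne_of_mem_slab (hα : 0 ≤ α) {z : SpaceTime n} (hz : z ∈ slab n σ T α γ) :
    T - z.1 ≠ 0 := by
  intro h0
  have := hz.1
  rw [show z.1 - T = 0 by linarith, mul_zero] at this
  linarith

/-- Integrability on the dyadic layers gives integrability on all compact ranges of times. -/
theorem integrableOn_slab_of_layers {f : SpaceTime n → ℝ} {r₀ : ℝ} (hr₀ : 0 < r₀)
    (h : ∀ r ∈ Ioo 0 r₀, IntegrableOn f (slab n σ T (r ^ 2) (4 * r ^ 2)))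
    (hα : 0 < α) (hγ : γ < 4 * r₀ ^ 2) : IntegrableOn f (slab n σ T α γ) := by
  have key : IntegrableOn f {z : SpaceTime n | σ * (z.1 - T) ∈ Icc α γ} := by
    refine IsCompact.induction_on (isCompact_Icc (a := α) (b := γ))
      (p := fun s => IntegrableOn f {z : SpaceTime n | σ * (z.1 - T) ∈ s}) ?_ ?_ ?_ ?_
    · simp
    · exact fun s t hst ht => ht.mono_set fun z hz => hst hz
    · exact fun s t hs ht => (hs.union ht).mono_set fun z hz => hz
    · intro τ hτ
      have hτ0 : 0 < τ := hα.trans_le hτ.1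
      -- A squared radius `q` strictly between these two numbers satisfies `q < τ < 4q` and `√q <
      -- r₀`, so the layer of radius `√q` covers a neighbourhood of the time `τ`.
      have hmin : τ / 4 < min τ (r₀ ^ 2) := lt_min (by linarith) (by linarith [hτ.2])
      obtain ⟨q, hq1, hq2⟩ := exists_between hmin
      have hq0 : 0 < q := by linarith
      have hqs : √q ^ 2 = q := Real.sq_sqrt hq0.le
      refine ⟨Ioo q (4 * q), mem_nhdsWithin_of_mem_nhds (Ioo_mem_nhds
        (hq2.trans_le (min_le_left _ _)) (by linarith)), ?_⟩
      have := h (√q) ⟨Real.sqrt_pos.2 hq0,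
        (Real.sqrt_lt' hr₀).2 (hq2.trans_le (min_le_right _ _))⟩
      rwa [hqs] at this
  exact key.mono_set fun z hz => Ioo_subset_Icc_self hz

theorem integrableOn_inv_time_mul (hσ : σ = 1 ∨ σ = -1) (hα : 0 < α) {f : SpaceTime n → ℝ}
    (hf : IntegrableOn f (slab n σ T α γ)) :
    IntegrableOn (fun z => 1 / (T - z.1) * f z) (slab n σ T α γ) := by
  refine hf.bdd_mul (c := 1 / α) ?_ ?_
  · exact (measurable_const.div (measurable_const.sub measurable_fst)).aestronglyMeasurable
  · filter_upwards [ae_restrict_mem measurableSet_slab] with z hz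
    rw [norm_div, norm_one, Real.norm_eq_abs, abs_time_eq hσ z (hα.trans hz.1)]
    exact one_div_le_one_div_of_le hα hz.1.le

theorem weight_eq {x₀ : EuclideanSpace ℝ (Fin n)} {z : SpaceTime n} (hz : T - z.1 ≠ 0) (c : ℝ) :
    weight T x₀ z * c = 1 / (T - z.1) * (c * heatKernel T x₀ z) := by
  rw [heatKernel_eq]
  field_simp

end Slab

/-- The hypotheses of the monotonicity formula on the side `σ = ±1` of the time `T`. -/
structure OneSidedSolution (F : EuclideanSpace ℝ (Fin m) → ℝ) (β T : ℝ)
    (x₀ : EuclideanSpace ℝ (Fin n)) (u : SpaceTime n → EuclideanSpace ℝ (Fin m))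
    (Du : Fin (n + 1) → SpaceTime n → EuclideanSpace ℝ (Fin m)) (σ L : ℝ) : Prop where
  sign : σ = 1 ∨ σ = -1
  pos : 0 < L
  sol : IsVariationalSolution F (min T (T + σ * L)) (max T (T + σ * L)) u Du
  time : ∀ δ > 0, IntegrableOn
    (fun z => Real.exp (-‖z.2 - x₀‖ ^ 2 / (4 * (T - z.1))) * (‖Du 0 z‖ ^ 2 + ‖u z‖ ^ 2))
    (slab n σ T δ L)
  nonneg : ∀ r ∈ Ioo 0 (√L / 4), NonnegCondition F β T x₀ u (slab n σ T (r ^ 2) (4 * r ^ 2))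
  growth : GrowthEstimate F β T x₀ u Du (fun r => slab n σ T (r ^ 2) (4 * r ^ 2)) (√L / 4)

namespace OneSidedSolution

variable {F : EuclideanSpace ℝ (Fin m) → ℝ} {β T σ L α γ : ℝ} {x₀ : EuclideanSpace ℝ (Fin n)}
  {u : SpaceTime n → EuclideanSpace ℝ (Fin m)}
  {Du : Fin (n + 1) → SpaceTime n → EuclideanSpace ℝ (Fin m)}

theorem memH1 (h : OneSidedSolution F β T x₀ u Du σ L) : MemH1 (slab n σ T 0 L) u Du := by
  have hL := h.pos
  have := h.sol.memH1
  rcases h.sign with rfl | rfl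
  · rwa [slab_one, add_zero, show T = min T (T + 1 * L) by rw [min_eq_left]; linarith,
      show min T (T + 1 * L) + L = max T (T + 1 * L) by
        rw [min_eq_left (by linarith), max_eq_right (by linarith), one_mul]]
  · rwa [slab_neg_one, sub_zero, show T = max T (T + -1 * L) by rw [max_eq_left]; linarith,
      show max T (T + -1 * L) - L = min T (T + -1 * L) by
        rw [min_eq_right (by linarith), max_eq_left (by linarith)]; ring]

/-- On a slab bounded away from `T` the factor `1/(T - t)` is bounded, so `W` may replace `G`. The
growth estimate supplies the gradient, the potential and `|u|²`; the reaction term is the difference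
of the potential and the integrand of the sign condition; `∂_t u` comes from the exponentially
weighted bound. The threshold `L/4` is `4r²` at `r = √L/4`. -/
theorem layerIntegrable (h : OneSidedSolution F β T x₀ u Du σ L) (hα : 0 < α) (hγ : γ < L / 4) :
    LayerIntegrable F β T x₀ u Du (slab n σ T α γ) := by
  have hL := h.pos
  have hr₀ : 0 < √L / 4 := by positivity
  have hsq : 4 * (√L / 4) ^ 2 = L / 4 := by
    rw [div_pow, Real.sq_sqrt hL.le]; ring
  rw [← hsq] at hγ
  obtain ⟨C, hC⟩ := h.growth
  have hpot : ∀ r ∈ Ioo 0 (√L / 4), IntegrableOn (fun z => weight T x₀ z * F (u z))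
      (slab n σ T (r ^ 2) (4 * r ^ 2)) := fun r hr => by
    have hr2 : 0 < r ^ 2 := by have := hr.1; positivity
    refine IntegrableOn.congr_fun ((integrableOn_inv_time_mul h.sign hr2
      (hC r hr).2.2.1).const_mul (1 / 2)) (fun z hz => ?_) measurableSet_slab
    rw [weight_eq (time_ne_of_mem_slab hr2.le hz)]
    ring
  refine ⟨integrableOn_slab_of_layers hr₀ (fun r hr => ?_) hα hγ,
    integrableOn_slab_of_layers hr₀ hpot hα hγ, ?_,
    integrableOn_slab_of_layers hr₀ (fun r hr => ?_) hα hγ,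
    integrableOn_slab_of_layers hr₀ (fun r hr => ?_) hα hγ⟩
  · have hr2 : 0 < r ^ 2 := by have := hr.1; positivity
    refine (integrableOn_inv_time_mul h.sign hr2 (hC r hr).2.1).congr_fun (fun z hz => ?_)
      measurableSet_slab
    exact (weight_eq (time_ne_of_mem_slab hr2.le hz) _).symm
  · have hsub : slab n σ T α γ ⊆ slab n σ T α L := slab_subset_slab le_rfl (by
      rw [hsq] at hγ; linarith)
    have hDm : AEStronglyMeasurable (Du 0) (volume.restrict (slab n σ T α γ)) :=
      (h.memH1.memLp_grad 0).1.mono_measure (Measure.restrict_mono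
        (hsub.trans (slab_subset_slab hα.le le_rfl)) le_rfl)
    have hp := Real.pi_pos
    refine Integrable.mono' (((h.time α hα).mono_set hsub).const_mul
      (4 * Real.pi * (4 * Real.pi * α) ^ (-(n : ℝ) / 2 - 1)))
      ((measurable_weight T x₀).aestronglyMeasurable.mul (hDm.norm.pow 2)) ?_
    filter_upwards [ae_restrict_mem measurableSet_slab] with z hz
    rw [Real.norm_of_nonneg (mul_nonneg (weight_nonneg T x₀ z) (sq_nonneg _)), weight, mul_assoc]
    -- The power of `|T - t|` in `W` has a negative exponent, so it is largest at the edge of the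
    -- slab nearest to `T`.
    have hle : 4 * Real.pi * α ≤ |4 * Real.pi * (T - z.1)| := by
      rw [abs_mul, abs_of_pos (by positivity), abs_time_eq h.sign z (hα.trans hz.1)]
      exact mul_le_mul_of_nonneg_left hz.1.le (by positivity)
    refine mul_le_mul (mul_le_mul_of_nonneg_left ?_ (by positivity)) ?_ (by positivity)
      (by positivity)
    · refine Real.rpow_le_rpow_of_nonpos (by positivity) hle ?_
      have : (0 : ℝ) ≤ n := Nat.cast_nonneg n
      linarith
    · exact mul_le_mul_of_nonneg_left (by linarith [sq_nonneg ‖u z‖]) (Real.exp_pos _).le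
  · have hr2 : 0 < r ^ 2 := by have := hr.1; positivity
    refine (hC r hr).1.congr_fun (fun z hz => ?_) measurableSet_slab
    simp only
    rw [weight_eq (time_ne_of_mem_slab hr2.le hz)]
    ring
  · have hr2 : 0 < r ^ 2 := by have := hr.1; positivity
    refine IntegrableOn.congr_fun (((hpot r hr).const_mul (2 * (β - 1))).sub
      (integrableOn_inv_time_mul h.sign hr2 (h.nonneg r hr).1)) (fun z hz => ?_)
      measurableSet_slab
    have := time_ne_of_mem_slab hr2.le hz
    simp only [Pi.sub_apply]
    rw [heatKernel_eq]
    field_simp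
    ring

/-- There is room on both sides of the slab: `α/2` below and some `γ' < L/4` above, as the Fatou
argument requires. -/
theorem integrableOn_dilationDeriv_sq (h : OneSidedSolution F β T x₀ u Du σ L) (hα : 0 < α)
    (hγ : γ < L / 4) :
    IntegrableOn (fun z => weight T x₀ z * ‖dilationDeriv T x₀ Du z‖ ^ 2) (slab n σ T α γ) := by
  rcases le_or_gt γ α with hle | hlt
  · simp [slab_eq_empty hle]
  obtain ⟨γ', hγ1, hγ2⟩ := exists_between hγ
  have hLI := h.layerIntegrable (α := α / 2) (by linarith) hγ2
  have hL := h.pos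
  have hsol := h.sol
  rcases h.sign with rfl | rfl
  · rw [slab_one] at hLI ⊢
    exact integrableOn_weight_mul_dilationDeriv_sq hsol
      (by rw [min_eq_left] <;> linarith) (by linarith) (by linarith) (by linarith)
      (by rw [max_eq_right] <;> linarith) (fun hm => by linarith [hm.1]) hLI
  · rw [slab_neg_one] at hLI ⊢
    exact integrableOn_weight_mul_dilationDeriv_sq hsol
      (by rw [min_eq_right] <;> linarith) (by linarith) (by linarith) (by linarith)
      (by rw [max_eq_left] <;> linarith) (fun hm => by linarith [hm.2]) hLI

theorem aestronglyMeasurable_u (h : OneSidedSolution F β T x₀ u Du σ L) (hα : 0 ≤ α)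
    (hγ : γ ≤ L) : AEStronglyMeasurable u (volume.restrict (slab n σ T α γ)) :=
  h.memH1.memLp.1.mono_measure (Measure.restrict_mono (slab_subset_slab hα hγ) le_rfl)

theorem aestronglyMeasurable_grad (h : OneSidedSolution F β T x₀ u Du σ L) (hα : 0 ≤ α)
    (hγ : γ ≤ L) (k : Fin (n + 1)) :
    AEStronglyMeasurable (Du k) (volume.restrict (slab n σ T α γ)) :=
  (h.memH1.memLp_grad k).1.mono_measure (Measure.restrict_mono (slab_subset_slab hα hγ) le_rfl)

theorem integrableOn_homogeneityDefect_sq (h : OneSidedSolution F β T x₀ u Du σ L) (hα : 0 < α)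
    (hγ : γ < L / 4) :
    IntegrableOn (fun z => weight T x₀ z * ‖homogeneityDefect β T x₀ u Du z‖ ^ 2)
      (slab n σ T α γ) := by
  have hL := h.pos
  have hum := h.aestronglyMeasurable_u hα.le (by linarith : γ ≤ L)
  have hEm := aestronglyMeasurable_dilationDeriv (T := T) (x₀ := x₀)
    (h.aestronglyMeasurable_grad hα.le (by linarith : γ ≤ L))
  refine Integrable.mono' (((h.integrableOn_dilationDeriv_sq hα hγ).const_mul 2).add
    ((h.layerIntegrable hα hγ).sq.const_mul (2 * β ^ 2)))
    ((measurable_weight T x₀).aestronglyMeasurable.mul ((hEm.sub (hum.const_smul β)).norm.pow 2))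
    (Eventually.of_forall fun z => ?_)
  have hW := weight_nonneg T x₀ z
  rw [Real.norm_of_nonneg (mul_nonneg hW (sq_nonneg _)), Pi.add_apply]
  have h1 : ‖homogeneityDefect β T x₀ u Du z‖ ≤ ‖dilationDeriv T x₀ Du z‖ + |β| * ‖u z‖ := by
    refine (norm_sub_le _ _).trans (le_of_eq ?_)
    rw [norm_smul, Real.norm_eq_abs]
  have h2 : ‖homogeneityDefect β T x₀ u Du z‖ ^ 2 ≤
      2 * ‖dilationDeriv T x₀ Du z‖ ^ 2 + 2 * β ^ 2 * ‖u z‖ ^ 2 := by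
    refine (pow_le_pow_left₀ (norm_nonneg _) h1 2).trans ?_
    nlinarith [sq_nonneg (‖dilationDeriv T x₀ Du z‖ - |β| * ‖u z‖), sq_abs β]
  nlinarith [mul_le_mul_of_nonneg_left h2 hW]

theorem integrableOn_reaction (h : OneSidedSolution F β T x₀ u Du σ L) (hα : 0 < α)
    (hγ : γ < L / 4) :
    IntegrableOn (fun z => heatKernel T x₀ z *
      (2 * (β - 1) * F (u z) - β * ⟪u z, gradient F (u z)⟫)) (slab n σ T α γ) := by
  have hL := h.pos
  refine integrableOn_slab_of_layers (r₀ := √L / 4) (by positivity)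
    (fun r hr => (h.nonneg r hr).1) hα ?_
  rwa [div_pow, Real.sq_sqrt hL.le, show 4 * (L / 4 ^ 2) = L / 4 by ring]

theorem integrableOn_dissipationDensity (h : OneSidedSolution F β T x₀ u Du σ L) (hα : 0 < α)
    (hγ : γ < L / 4) : IntegrableOn (dissipationDensity F β T x₀ u Du) (slab n σ T α γ) :=
  (h.integrableOn_homogeneityDefect_sq hα hγ).add ((h.integrableOn_reaction hα hγ).const_mul 2)

theorem integrableOn_layer {f : SpaceTime n → ℝ} (h : OneSidedSolution F β T x₀ u Du σ L)
    (hf : ∀ r ∈ Ioo 0 (√L / 4), IntegrableOn f (slab n σ T (r ^ 2) (4 * r ^ 2)))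
    (hα : 0 < α) (hγ : γ < L / 4) : IntegrableOn f (slab n σ T α γ) := by
  have hL := h.pos
  refine integrableOn_slab_of_layers (r₀ := √L / 4) (by positivity) hf hα ?_
  rwa [div_pow, Real.sq_sqrt hL.le, show 4 * (L / 4 ^ 2) = L / 4 by ring]

theorem integrableOn_energy (h : OneSidedSolution F β T x₀ u Du σ L) (hα : 0 < α)
    (hγ : γ < L / 4) :
    IntegrableOn (fun z => energy F u Du z * heatKernel T x₀ z) (slab n σ T α γ) := by
  obtain ⟨C, hC⟩ := h.growth
  refine h.integrableOn_layer (fun r hr => ?_) hα hγ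
  refine ((hC r hr).2.1.sub (hC r hr).2.2.1).congr (Eventually.of_forall fun z => ?_)
  simp only [Pi.sub_apply, ParabolicSystem.energy]
  ring

theorem integrableOn_sq (h : OneSidedSolution F β T x₀ u Du σ L) (hα : 0 < α)
    (hγ : γ < L / 4) :
    IntegrableOn (fun z => 1 / (T - z.1) * ‖u z‖ ^ 2 * heatKernel T x₀ z) (slab n σ T α γ) := by
  obtain ⟨C, hC⟩ := h.growth
  exact h.integrableOn_layer (fun r hr => (hC r hr).1) hα hγ

theorem integrableOn_energyDensity (h : OneSidedSolution F β T x₀ u Du σ L) (hα : 0 < α)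
    (hγ : γ < L / 4) : IntegrableOn (energyDensity F β T x₀ u Du) (slab n σ T α γ) :=
  (h.integrableOn_energy hα hγ).sub ((h.integrableOn_sq hα hγ).const_mul (β / 2))

theorem weightedEnergy_eq (h : OneSidedSolution F β T x₀ u Du σ L) {S : Set (SpaceTime n)}
    (hα : 0 < α) (hγ : γ < L / 4) (hS : S ⊆ slab n σ T α γ) (r : ℝ) :
    weightedEnergy F β T x₀ u Du S r =
      r ^ (-2 * β) * ∫ z in S, energyDensity F β T x₀ u Du z := by
  unfold energyDensity
  rw [integral_sub ((h.integrableOn_energy hα hγ).mono_set hS)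
    (((h.integrableOn_sq hα hγ).mono_set hS).const_mul (β / 2)), integral_const_mul,
    weightedEnergy]
  ring

/-- The fundamental identity, in terms of the distance in time from `T`. -/
theorem integral_slab_eq_zero (h : OneSidedSolution F β T x₀ u Du σ L) (hα : 0 < α)
    (hγ : γ < L / 4) {ζ : ℝ → ℝ} (hζ : IsTimeTest α γ ζ) :
    ∫ z in slab n σ T α γ, ((2 * (σ * (z.1 - T)) * deriv ζ (σ * (z.1 - T)) +
        2 * β * ζ (σ * (z.1 - T))) * energyDensity F β T x₀ u Du z +
      ζ (σ * (z.1 - T)) * dissipationDensity F β T x₀ u Du z) = 0 := by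
  have hLI := h.layerIntegrable hα hγ
  have hE := h.integrableOn_dilationDeriv_sq hα hγ
  have hL := h.pos
  have hsol := h.sol
  have hσ0 : σ ≠ 0 := by rcases h.sign with rfl | rfl <;> norm_num
  have hσ2 : σ * σ = 1 := by rcases h.sign with rfl | rfl <;> norm_num
  have hsm : ContDiff ℝ ∞ fun t => ζ (σ * (t - T)) :=
    hζ.smooth.comp (contDiff_const.mul (contDiff_id.sub contDiff_const))
  let e : ℝ ≃ₜ ℝ := (Homeomorph.subRight T).trans (Homeomorph.mulLeft₀ σ hσ0)
  have hcs : HasCompactSupport fun t => ζ (σ * (t - T)) :=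
    hζ.compact.comp_homeomorph e
  have hts : ∀ t ∈ tsupport (fun t => ζ (σ * (t - T))), σ * (t - T) ∈ Ioo α γ := fun t ht =>
    hζ.subset (tsupport_comp_subset_preimage ζ (f := fun t => σ * (t - T)) (by fun_prop) ht)
  have hd : ∀ t, deriv (fun t => ζ (σ * (t - T))) t = σ * deriv ζ (σ * (t - T)) := fun t => by
    have h1 : HasDerivAt (fun t => σ * (t - T)) (σ * 1) t :=
      ((hasDerivAt_id t).sub_const T).const_mul σ
    have h2 := ((hζ.smooth.differentiable (by simp) _).hasDerivAt).comp t h1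
    rw [mul_one, mul_comm] at h2
    exact h2.deriv
  -- The operator `2τ d/dτ` is unchanged by the substitution `τ = σ(t - T)`, so the identity takes
  -- the same form on both sides of `T`.
  have hpt : ∀ z : SpaceTime n, (2 * (σ * (z.1 - T)) * deriv ζ (σ * (z.1 - T)) +
        2 * β * ζ (σ * (z.1 - T))) = (2 * (z.1 - T) * deriv (fun t => ζ (σ * (t - T))) z.1 +
        2 * β * (fun t => ζ (σ * (t - T))) z.1) := fun z => by
    rw [hd]; ring
  simp only [hpt]
  rcases h.sign with rfl | rfl
  · rw [slab_one] at hLI hE ⊢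
    refine integral_energyDensity_add_dissipationDensity
      (ζ := fun t => ζ (1 * (t - T))) hsol
      (by rw [min_eq_left] <;> linarith) (by rw [max_eq_right] <;> linarith)
      (fun hm => by linarith [hm.1]) ⟨hsm, hcs, fun t ht => ?_⟩ hLI hE
    obtain ⟨h1, h2⟩ := hts t ht
    exact ⟨by linarith, by linarith⟩
  · rw [slab_neg_one] at hLI hE ⊢
    refine integral_energyDensity_add_dissipationDensity
      (ζ := fun t => ζ (-1 * (t - T))) hsol
      (by rw [min_eq_right] <;> linarith) (by rw [max_eq_left] <;> linarith)
      (fun hm => by linarith [hm.2]) ⟨hsm, hcs, fun t ht => ?_⟩ hLI hE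
    obtain ⟨h1, h2⟩ := hts t ht
    exact ⟨by linarith, by linarith⟩

end OneSidedSolution

/-! ### Averages of time profiles over scales. -/

/-- The weighted average over the scales `r ∈ (a, b)` of the rescaled time profiles `κ(·/r²)`. -/
def timeAverage (p : ℝ) (κ : ℝ → ℝ) (a b τ : ℝ) : ℝ := ∫ r in a..b, r ^ p * κ (τ / r ^ 2)

section TimeAverage

variable {p a b : ℝ} {κ : ℝ → ℝ}

theorem intervalIntegrable_rpow_of_pos (ha : 0 < a) (hab : a ≤ b) (p : ℝ) :
    IntervalIntegrable (fun r => r ^ p) volume a b := by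
  refine intervalIntegral.intervalIntegrable_rpow (Or.inr fun h0 => ?_)
  rw [uIcc_of_le hab] at h0
  linarith [h0.1]

theorem continuousOn_timeAverage_integrand (ha : 0 < a) (hκ : Continuous κ) (p τ : ℝ) :
    ContinuousOn (fun r => r ^ p * κ (τ / r ^ 2)) (Icc a b) := by
  have hr : ∀ r ∈ Icc a b, r ≠ 0 := fun r hr => (ha.trans_le hr.1).ne'
  refine ContinuousOn.mul (ContinuousOn.rpow_const continuousOn_id fun r h => Or.inl (hr r h)) ?_
  exact hκ.comp_continuousOn (continuousOn_const.div (continuousOn_id.pow 2)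
    fun r h => pow_ne_zero 2 (hr r h))

theorem aestronglyMeasurable_timeAverage_integrand (hκ : Measurable κ) (p τ : ℝ) :
    AEStronglyMeasurable (fun r => r ^ p * κ (τ / r ^ 2)) (volume.restrict (uIoc a b)) :=
  ((measurable_id.pow_const p).mul
    (hκ.comp (measurable_const.div (measurable_id.pow_const 2)))).aestronglyMeasurable

theorem abs_timeAverage_le (ha : 0 < a) (hab : a ≤ b) (h0 : ∀ t, 0 ≤ κ t) (h1 : ∀ t, κ t ≤ 1)
    (τ : ℝ) : |timeAverage p κ a b τ| ≤ ∫ r in a..b, r ^ p := by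
  rw [timeAverage, ← Real.norm_eq_abs]
  refine intervalIntegral.norm_integral_le_of_norm_le hab (Eventually.of_forall fun r hr => ?_)
    (intervalIntegrable_rpow_of_pos ha hab p)
  have hr0 : 0 < r := ha.trans hr.1
  rw [norm_mul, Real.norm_of_nonneg (Real.rpow_nonneg hr0.le p), Real.norm_of_nonneg (h0 _)]
  exact mul_le_of_le_one_right (Real.rpow_nonneg hr0.le p) (h1 _)

theorem timeAverage_nonneg (ha : 0 < a) (hab : a ≤ b) (h0 : ∀ t, 0 ≤ κ t) (τ : ℝ) :
    0 ≤ timeAverage p κ a b τ :=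
  intervalIntegral.integral_nonneg hab fun _ hr =>
    mul_nonneg (Real.rpow_nonneg (ha.le.trans hr.1) p) (h0 _)

theorem tendsto_timeAverage (ha : 0 < a) (hab : a ≤ b) {κ : ℕ → ℝ → ℝ} {κ₀ : ℝ → ℝ}
    (hm : ∀ j, Measurable (κ j)) (h0 : ∀ j t, 0 ≤ κ j t) (h1 : ∀ j t, κ j t ≤ 1)
    (hl : ∀ t, Tendsto (fun j => κ j t) atTop (𝓝 (κ₀ t))) (τ : ℝ) :
    Tendsto (fun j => timeAverage p (κ j) a b τ) atTop (𝓝 (timeAverage p κ₀ a b τ)) := by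
  refine intervalIntegral.tendsto_integral_filter_of_dominated_convergence (fun r => r ^ p)
    (Eventually.of_forall fun j => aestronglyMeasurable_timeAverage_integrand (hm j) p τ)
    (Eventually.of_forall fun j => Eventually.of_forall fun r hr => ?_)
    (intervalIntegrable_rpow_of_pos ha hab p)
    (Eventually.of_forall fun r _ => (hl _).const_mul _)
  rw [uIoc_of_le hab] at hr
  have hr0 : 0 < r := ha.trans hr.1
  rw [norm_mul, Real.norm_of_nonneg (Real.rpow_nonneg hr0.le p), Real.norm_of_nonneg (h0 j _)]
  exact mul_le_of_le_one_right (Real.rpow_nonneg hr0.le p) (h1 j _)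

theorem hasDerivAt_timeAverage (ha : 0 < a) (hab : a ≤ b) (hκ : ContDiff ℝ ∞ κ)
    (hc : HasCompactSupport κ) (τ : ℝ) :
    HasDerivAt (timeAverage p κ a b) (timeAverage (p - 2) (deriv κ) a b τ) τ := by
  have hκ' : Continuous (deriv κ) := hκ.continuous_deriv (by simp)
  obtain ⟨M, hM⟩ := hc.deriv.exists_bound_of_continuous hκ'
  have hint : ∀ (q : ℝ) {g : ℝ → ℝ}, Continuous g → ∀ τ,
      IntervalIntegrable (fun r => r ^ q * g (τ / r ^ 2)) volume a b := fun q g hg τ => by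
    refine ContinuousOn.intervalIntegrable ?_
    rw [uIcc_of_le hab]
    exact continuousOn_timeAverage_integrand ha hg q τ
  refine (intervalIntegral.hasDerivAt_integral_of_dominated_loc_of_deriv_le
    (F := fun τ r => r ^ p * κ (τ / r ^ 2)) (F' := fun τ r => r ^ (p - 2) * deriv κ (τ / r ^ 2))
    (bound := fun r => r ^ (p - 2) * M)
    univ_mem (Eventually.of_forall fun τ =>
      aestronglyMeasurable_timeAverage_integrand hκ.continuous.measurable p τ)
    (hint p hκ.continuous τ) (aestronglyMeasurable_timeAverage_integrand hκ'.measurable (p - 2) τ)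
    (Eventually.of_forall fun r hr x _ => ?_)
    ((intervalIntegrable_rpow_of_pos ha hab _).mul_const M)
    (Eventually.of_forall fun r hr x _ => ?_)).2
  · rw [uIoc_of_le hab] at hr
    have hr0 : 0 < r := ha.trans hr.1
    rw [norm_mul, Real.norm_of_nonneg (Real.rpow_nonneg hr0.le _)]
    exact mul_le_mul_of_nonneg_left (hM _) (Real.rpow_nonneg hr0.le _)
  · rw [uIoc_of_le hab] at hr
    have hr0 : 0 < r := ha.trans hr.1
    have h1 : HasDerivAt (fun x : ℝ => x / r ^ 2) (1 / r ^ 2) x := (hasDerivAt_id x).div_const _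
    have h2 := (((hκ.differentiable (by simp) _).hasDerivAt).comp x h1).const_mul (r ^ p)
    refine h2.congr_deriv ?_
    rw [Real.rpow_sub hr0, Real.rpow_two]
    ring

/-- The derivative is an average of the same kind, of `deriv κ` with exponent `p - 2`; hence an
induction that generalises over both the profile and the exponent. -/
theorem contDiff_timeAverage (ha : 0 < a) (hab : a ≤ b) (hκ : ContDiff ℝ ∞ κ)
    (hc : HasCompactSupport κ) : ContDiff ℝ ∞ (timeAverage p κ a b) := by
  rw [contDiff_infty]
  intro k
  induction k generalizing p κ with
  | zero =>
    rw [Nat.cast_zero, contDiff_zero]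
    exact continuous_iff_continuousAt.2 fun τ =>
      (hasDerivAt_timeAverage ha hab hκ hc τ).continuousAt
  | succ k ih =>
    have hd := hasDerivAt_timeAverage (p := p) ha hab hκ hc
    push_cast
    rw [contDiff_succ_iff_deriv]
    refine ⟨fun τ => (hd τ).differentiableAt, by simp, ?_⟩
    rw [funext fun τ => (hd τ).deriv]
    exact ih (contDiff_infty_iff_deriv.1 hκ).2 hc.deriv

theorem isTimeTest_timeAverage {c d α γ : ℝ} (ha : 0 < a) (hab : a ≤ b) (hκ : IsTimeTest c d κ)
    (hc : 0 ≤ c) (hd : 0 ≤ d) (hα : α < c * a ^ 2) (hγ : d * b ^ 2 < γ) :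
    IsTimeTest α γ (timeAverage p κ a b) := by
  have h0 : ∀ τ ∉ Icc (c * a ^ 2) (d * b ^ 2), timeAverage p κ a b τ = 0 := fun τ hτ => by
    refine intervalIntegral.integral_zero_ae (Eventually.of_forall fun r hr => ?_)
    rw [uIoc_of_le hab] at hr
    have hr0 : 0 < r := ha.trans hr.1
    rw [image_eq_zero_of_notMem_tsupport (f := κ) fun hm => hτ ?_, mul_zero]
    obtain ⟨h1, h2⟩ := hκ.subset hm
    rw [lt_div_iff₀ (by positivity)] at h1
    rw [div_lt_iff₀ (by positivity)] at h2
    exact ⟨(mul_le_mul_of_nonneg_left (pow_le_pow_left₀ ha.le hr.1.le 2) hc).trans h1.le,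
      h2.le.trans (mul_le_mul_of_nonneg_left (pow_le_pow_left₀ hr0.le hr.2 2) hd)⟩
  have hts : tsupport (timeAverage p κ a b) ⊆ Icc (c * a ^ 2) (d * b ^ 2) :=
    closure_minimal (fun τ hτ => by_contra fun hn => hτ (h0 τ hn)) isClosed_Icc
  exact ⟨contDiff_timeAverage ha hab hκ.smooth hκ.compact,
    isCompact_Icc.of_isClosed_subset (isClosed_tsupport _) hts,
    hts.trans (Icc_subset_Ioo hα hγ)⟩

/-- The averages solve a transport equation with a difference of two profiles on the right. -/
theorem deriv_timeAverage_add {β : ℝ} (ha : 0 < a) (hab : a ≤ b) (hκ : ContDiff ℝ ∞ κ)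
    (hc : HasCompactSupport κ) (τ : ℝ) :
    2 * τ * deriv (timeAverage (-2 * β - 1) κ a b) τ +
        2 * β * timeAverage (-2 * β - 1) κ a b τ =
      a ^ (-2 * β) * κ (τ / a ^ 2) - b ^ (-2 * β) * κ (τ / b ^ 2) := by
  have hκ' : Continuous (deriv κ) := hκ.continuous_deriv (by simp)
  rw [(hasDerivAt_timeAverage ha hab hκ hc τ).deriv]
  have hint : ∀ (q : ℝ) {g : ℝ → ℝ}, Continuous g → ∀ τ,
      IntervalIntegrable (fun r => r ^ q * g (τ / r ^ 2)) volume a b := fun q g hg τ => by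
    refine ContinuousOn.intervalIntegrable ?_
    rw [uIcc_of_le hab]
    exact continuousOn_timeAverage_integrand ha hg q τ
  have i1 := (hint (-2 * β - 1 - 2) hκ' τ).const_mul (2 * τ)
  have i2 := (hint (-2 * β - 1) hκ.continuous τ).const_mul (2 * β)
  -- The combined integrand is the exact `r`-derivative of `-r^{-2β} κ(τ/r²)`; this is the reason
  -- for the exponent `-2β - 1` of the average.
  have key := intervalIntegral.integral_eq_sub_of_hasDerivAt (a := a) (b := b)
    (f := fun r => -(r ^ (-2 * β) * κ (τ / r ^ 2)))
    (f' := fun r => 2 * τ * (r ^ (-2 * β - 1 - 2) * deriv κ (τ / r ^ 2)) +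
      2 * β * (r ^ (-2 * β - 1) * κ (τ / r ^ 2))) (fun r hr => ?_) (i1.add i2)
  · rw [intervalIntegral.integral_add i1 i2, intervalIntegral.integral_const_mul,
      intervalIntegral.integral_const_mul] at key
    rw [timeAverage, timeAverage, key]
    ring
  · rw [uIcc_of_le hab] at hr
    have hr0 : 0 < r := ha.trans_le hr.1
    have h1 : HasDerivAt (fun r : ℝ => τ / r ^ 2) (-2 * τ / r ^ 3) r := by
      have := (hasDerivAt_const r τ).div (hasDerivAt_pow 2 r) (pow_ne_zero 2 hr0.ne')
      refine this.congr_deriv ?_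
      field_simp
      ring
    have h2 := ((Real.hasDerivAt_rpow_const (p := -2 * β) (Or.inl hr0.ne')).mul
      (((hκ.differentiable (by simp) _).hasDerivAt).comp r h1)).neg
    refine h2.congr_deriv ?_
    have e3 : r ^ (-2 * β - 1 - 2) = r ^ (-2 * β) / r ^ 3 := by
      rw [show -2 * β - 1 - 2 = -2 * β - (3 : ℕ) by push_cast; ring, Real.rpow_sub_natCast hr0.ne']
    rw [e3]
    simp only [Function.comp]
    field_simp
    ring

/-- The approximation of the indicator of `(1, 4)` is from inside: supports lying strictly within
`(1, 4)` make the averages over scales compactly supported in the open slab. -/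
theorem exists_timeTest_seq : ∃ κ : ℕ → ℝ → ℝ,
    (∀ j, ∃ c d, 1 < c ∧ 0 ≤ d ∧ d < 4 ∧ IsTimeTest c d (κ j)) ∧ (∀ j t, 0 ≤ κ j t) ∧
    (∀ j t, κ j t ≤ 1) ∧
    ∀ t, Tendsto (fun j => κ j t) atTop (𝓝 ((Ioo (1 : ℝ) 4).indicator 1 t)) := by
  have hε : ∀ j : ℕ, 0 < 1 / ((j : ℝ) + 1) ∧ 1 / ((j : ℝ) + 1) ≤ 1 := fun j => by
    refine ⟨by positivity, ?_⟩
    rw [div_le_one (by positivity)]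
    linarith [(Nat.cast_nonneg j : (0 : ℝ) ≤ j)]
  have hex := fun j : ℕ => exists_isTimeTest_eq_one
    (a := 1 + 1 / ((j : ℝ) + 1) / 2) (a' := 1 + 1 / ((j : ℝ) + 1))
    (b' := 4 - 1 / ((j : ℝ) + 1)) (b := 4 - 1 / ((j : ℝ) + 1) / 2)
    (by linarith [(hε j).1]) (by linarith [(hε j).2]) (by linarith [(hε j).1])
  choose κ hκ h0 h1 hle using hex
  refine ⟨κ, fun j => ⟨_, _, by linarith [(hε j).1], by linarith [(hε j).2],
    by linarith [(hε j).1], hκ j⟩, h0, hle, fun t => ?_⟩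
  by_cases ht : t ∈ Ioo (1 : ℝ) 4
  · rw [indicator_of_mem ht]
    have hmin : 0 < min (t - 1) (4 - t) := lt_min (by linarith [ht.1]) (by linarith [ht.2])
    refine tendsto_const_nhds.congr' ?_
    filter_upwards [(tendsto_one_div_add_atTop_nhds_zero_nat (𝕜 := ℝ)).eventually_lt_const hmin]
      with j hj
    exact (h1 j t ⟨by linarith [hj.trans_le (min_le_left _ _)],
      by linarith [hj.trans_le (min_le_right _ _)]⟩).symm
  · rw [indicator_of_notMem ht]
    refine tendsto_const_nhds.congr fun j => (image_eq_zero_of_notMem_tsupport fun hm => ht ?_).symm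
    obtain ⟨g1, g2⟩ := (hκ j).subset hm
    exact ⟨by linarith [(hε j).1], by linarith [(hε j).1]⟩

end TimeAverage

/-! ### The monotonicity formula. -/

/-- The indicator function of the time profile of a layer. -/
def layerProfile : ℝ → ℝ := (Ioo (1 : ℝ) 4).indicator 1

theorem measurable_layerProfile : Measurable layerProfile :=
  measurable_one.indicator measurableSet_Ioo

theorem layerProfile_nonneg (t : ℝ) : 0 ≤ layerProfile t :=
  indicator_nonneg (fun _ _ => zero_le_one) t

theorem layerProfile_le_one (t : ℝ) : layerProfile t ≤ 1 :=
  indicator_le_self' (f := (1 : ℝ → ℝ)) (fun _ _ => zero_le_one) t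

theorem layerProfile_div {c τ : ℝ} (hc : 0 < c) (h : c ^ 2 < τ ∧ τ < 4 * c ^ 2) :
    layerProfile (τ / c ^ 2) = 1 := by
  rw [layerProfile, indicator_of_mem, Pi.one_apply]
  exact ⟨by rw [lt_div_iff₀ (by positivity)]; linarith, by
    rw [div_lt_iff₀ (by positivity)]; linarith⟩

theorem layerProfile_div_of_not {c τ : ℝ} (hc : 0 < c) (h : ¬(c ^ 2 < τ ∧ τ < 4 * c ^ 2)) :
    layerProfile (τ / c ^ 2) = 0 := by
  rw [layerProfile, indicator_of_notMem]
  rintro ⟨h1, h2⟩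
  rw [lt_div_iff₀ (by positivity)] at h1
  rw [div_lt_iff₀ (by positivity)] at h2
  exact h ⟨by linarith, by linarith⟩

theorem setIntegral_layerProfile_mul {σ T a b c : ℝ} (f : SpaceTime n → ℝ) (ha : 0 < a)
    (hac : a ≤ c) (hcb : c ≤ b) :
    ∫ z in slab n σ T (a ^ 2) (4 * b ^ 2), layerProfile (σ * (z.1 - T) / c ^ 2) * f z =
      ∫ z in slab n σ T (c ^ 2) (4 * c ^ 2), f z := by
  have hc : 0 < c := ha.trans_le hac
  have hsub : slab n σ T (c ^ 2) (4 * c ^ 2) ⊆ slab n σ T (a ^ 2) (4 * b ^ 2) :=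
    slab_subset_slab (pow_le_pow_left₀ ha.le hac 2)
      (by linarith [pow_le_pow_left₀ hc.le hcb 2])
  rw [setIntegral_eq_of_subset_of_forall_sdiff_eq_zero measurableSet_slab hsub fun z hz => by
    rw [layerProfile_div_of_not hc hz.2, zero_mul]]
  refine setIntegral_congr_fun measurableSet_slab fun z hz => ?_
  rw [layerProfile_div hc hz, one_mul]

/-- Fubini turns the integral against the averaged profile into a positive superposition, over `r`,
of integrals over the layers of radius `r`. -/
theorem timeAverage_layerProfile_nonneg_integral {σ T a b p : ℝ} {f : SpaceTime n → ℝ}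
    (ha : 0 < a) (hab : a ≤ b) (hf : IntegrableOn f (slab n σ T (a ^ 2) (4 * b ^ 2)))
    (h0 : ∀ r ∈ Icc a b, 0 ≤ ∫ z in slab n σ T (r ^ 2) (4 * r ^ 2), f z) :
    0 ≤ ∫ z in slab n σ T (a ^ 2) (4 * b ^ 2),
      timeAverage p layerProfile a b (σ * (z.1 - T)) * f z := by
  have hint : Integrable (Function.uncurry fun (r : ℝ) (z : SpaceTime n) =>
      r ^ p * layerProfile (σ * (z.1 - T) / r ^ 2) * f z)
      ((volume.restrict (uIoc a b)).prod
        (volume.restrict (slab n σ T (a ^ 2) (4 * b ^ 2)))) := by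
    have hr := intervalIntegrable_iff.1 (intervalIntegrable_rpow_of_pos ha hab p)
    refine Integrable.mono (Integrable.mul_prod hr hf) ?_ ?_
    · refine AEStronglyMeasurable.mul (Measurable.aestronglyMeasurable ?_) hf.1.comp_snd
      exact (measurable_fst.pow_const p).mul (measurable_layerProfile.comp
        ((measurable_const.mul (measurable_snd.fst.sub_const T)).div (measurable_fst.pow_const 2)))
    · refine Eventually.of_forall fun q => ?_
      simp only [Function.uncurry]
      rw [norm_mul, norm_mul, norm_mul, Real.norm_of_nonneg (layerProfile_nonneg _)]
      exact mul_le_mul_of_nonneg_right (mul_le_of_le_one_right (norm_nonneg _)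
        (layerProfile_le_one _)) (norm_nonneg _)
  have hswap := intervalIntegral_integral_swap hint
  have e1 : ∀ z : SpaceTime n, timeAverage p layerProfile a b (σ * (z.1 - T)) * f z =
      ∫ r in a..b, r ^ p * layerProfile (σ * (z.1 - T) / r ^ 2) * f z := fun z => by
    rw [intervalIntegral.integral_mul_const, timeAverage]
  simp only [e1]
  rw [← hswap]
  refine intervalIntegral.integral_nonneg hab fun r hr => ?_
  have hr0 : 0 < r := ha.trans_le hr.1
  simp only [mul_assoc]
  rw [integral_const_mul, setIntegral_layerProfile_mul f ha hr.1 hr.2]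
  exact mul_nonneg (Real.rpow_nonneg hr0.le p) (h0 r hr)

namespace OneSidedSolution

variable {F : EuclideanSpace ℝ (Fin m) → ℝ} {β T σ L a b : ℝ} {x₀ : EuclideanSpace ℝ (Fin n)}
  {u : SpaceTime n → EuclideanSpace ℝ (Fin m)}
  {Du : Fin (n + 1) → SpaceTime n → EuclideanSpace ℝ (Fin m)}

theorem lt_sqrt_div_four {r : ℝ} (hr : 0 < r) : r < √L / 4 ↔ 4 * r ^ 2 < L / 4 := by
  rw [lt_div_iff₀ (by norm_num), Real.lt_sqrt (by positivity)]
  constructor <;> intro h <;> nlinarith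

/-- The averaged profile is inserted as time cutoff into the fundamental identity. By its transport
equation the coefficient of the energy density is a difference of the rescaled profiles at `a` and
`b`, which become the two weighted energies when the smooth profiles tend to the indicator. -/
theorem weightedEnergy_sub (h : OneSidedSolution F β T x₀ u Du σ L) (ha : 0 < a) (hab : a ≤ b)
    (hb : b < √L / 4) :
    weightedEnergy F β T x₀ u Du (slab n σ T (b ^ 2) (4 * b ^ 2)) b -
        weightedEnergy F β T x₀ u Du (slab n σ T (a ^ 2) (4 * a ^ 2)) a =
      ∫ z in slab n σ T (a ^ 2) (4 * b ^ 2),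
        timeAverage (-2 * β - 1) layerProfile a b (σ * (z.1 - T)) *
          dissipationDensity F β T x₀ u Du z := by
  have hb0 : 0 < b := ha.trans_le hab
  rw [lt_sqrt_div_four hb0] at hb
  have ha2 : 0 < a ^ 2 := by positivity
  have hab2 : a ^ 2 ≤ b ^ 2 := pow_le_pow_left₀ ha.le hab 2
  have iP := h.integrableOn_energyDensity ha2 hb
  have iK := h.integrableOn_dissipationDensity ha2 hb
  rw [h.weightedEnergy_eq ha2 hb (slab_subset_slab hab2 le_rfl),
    h.weightedEnergy_eq ha2 hb (slab_subset_slab le_rfl (by linarith))]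
  obtain ⟨κ, hκ, h0, h1, hl⟩ := exists_timeTest_seq
  change ∀ t, Tendsto (fun j => κ j t) atTop (𝓝 (layerProfile t)) at hl
  have hτ : Continuous fun z : SpaceTime n => σ * (z.1 - T) := by fun_prop
  have hκs : ∀ j, ContDiff ℝ ∞ (κ j) := fun j => by
    obtain ⟨c, d, -, -, -, h⟩ := hκ j
    exact h.smooth
  have hκc : ∀ j, HasCompactSupport (κ j) := fun j => by
    obtain ⟨c, d, -, -, -, h⟩ := hκ j
    exact h.compact
  have lim : ∀ c : ℝ, Tendsto (fun j => ∫ z in slab n σ T (a ^ 2) (4 * b ^ 2),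
      κ j (σ * (z.1 - T) / c ^ 2) * energyDensity F β T x₀ u Du z) atTop
      (𝓝 (∫ z in slab n σ T (a ^ 2) (4 * b ^ 2),
        layerProfile (σ * (z.1 - T) / c ^ 2) * energyDensity F β T x₀ u Du z)) := fun c =>
    tendsto_integral_bdd_mul (C := 1)
      (fun j => ((hκs j).continuous.comp (hτ.div_const _)).aestronglyMeasurable)
      (fun j => Eventually.of_forall fun z => by rw [abs_of_nonneg (h0 j _)]; exact h1 j _)
      (Eventually.of_forall fun z => hl _) iP
  have limZ := tendsto_integral_bdd_mul (ν := volume.restrict (slab n σ T (a ^ 2) (4 * b ^ 2)))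
    (a := fun j z => timeAverage (-2 * β - 1) (κ j) a b (σ * (z.1 - T)))
    (a₀ := fun z => timeAverage (-2 * β - 1) layerProfile a b (σ * (z.1 - T)))
    (fun j => ((contDiff_timeAverage ha hab (hκs j) (hκc j)).continuous.comp
      hτ).aestronglyMeasurable)
    (fun j => Eventually.of_forall fun z => abs_timeAverage_le ha hab (h0 j) (h1 j) _)
    (Eventually.of_forall fun z => tendsto_timeAverage ha hab
      (fun j => (hκs j).continuous.measurable) h0 h1 hl _) iK
  have i1 : ∀ (c : ℝ) j, IntegrableOn (fun z : SpaceTime n => κ j (σ * (z.1 - T) / c ^ 2) *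
      energyDensity F β T x₀ u Du z) (slab n σ T (a ^ 2) (4 * b ^ 2)) := fun c j =>
    iP.bdd_mul (c := 1) ((hκs j).continuous.comp (hτ.div_const _)).aestronglyMeasurable
      (Eventually.of_forall fun z => by rw [Real.norm_of_nonneg (h0 j _)]; exact h1 j _)
  have i2 : ∀ j, IntegrableOn (fun z : SpaceTime n =>
      timeAverage (-2 * β - 1) (κ j) a b (σ * (z.1 - T)) *
      dissipationDensity F β T x₀ u Du z) (slab n σ T (a ^ 2) (4 * b ^ 2)) := fun j =>
    iK.bdd_mul ((contDiff_timeAverage ha hab (hκs j) (hκc j)).continuous.comp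
      hτ).aestronglyMeasurable
      (Eventually.of_forall fun z => abs_timeAverage_le ha hab (h0 j) (h1 j) _)
  have key : ∀ j, a ^ (-2 * β) * (∫ z in slab n σ T (a ^ 2) (4 * b ^ 2),
        κ j (σ * (z.1 - T) / a ^ 2) * energyDensity F β T x₀ u Du z) -
      b ^ (-2 * β) * (∫ z in slab n σ T (a ^ 2) (4 * b ^ 2),
        κ j (σ * (z.1 - T) / b ^ 2) * energyDensity F β T x₀ u Du z) +
      (∫ z in slab n σ T (a ^ 2) (4 * b ^ 2),
        timeAverage (-2 * β - 1) (κ j) a b (σ * (z.1 - T)) *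
          dissipationDensity F β T x₀ u Du z) = 0 := fun j => by
    obtain ⟨c, d, hc, hd0, hd, hj⟩ := hκ j
    -- With `1 < c` and `d < 4` the average is supported in `[c a², d b²]`, strictly inside `(a²,
    -- 4b²)`.
    have := h.integral_slab_eq_zero ha2 hb (isTimeTest_timeAverage (p := -2 * β - 1) ha hab hj
      (by linarith) hd0 (lt_mul_of_one_lt_left ha2 hc)
      (mul_lt_mul_of_pos_right hd (by positivity)))
    have i3 : IntegrableOn (fun z : SpaceTime n => a ^ (-2 * β) *
        (κ j (σ * (z.1 - T) / a ^ 2) * energyDensity F β T x₀ u Du z) -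
        b ^ (-2 * β) * (κ j (σ * (z.1 - T) / b ^ 2) * energyDensity F β T x₀ u Du z))
        (slab n σ T (a ^ 2) (4 * b ^ 2)) := ((i1 a j).const_mul _).sub ((i1 b j).const_mul _)
    rw [← integral_const_mul, ← integral_const_mul,
      ← integral_sub ((i1 a j).const_mul _) ((i1 b j).const_mul _), ← integral_add i3 (i2 j),
      ← this]
    refine integral_congr_ae (Eventually.of_forall fun z => ?_)
    simp only
    rw [deriv_timeAverage_add ha hab hj.smooth hj.compact]
    ring
  have hlim := (((lim a).const_mul (a ^ (-2 * β))).sub ((lim b).const_mul (b ^ (-2 * β)))).add limZ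
  simp only [key] at hlim
  have := tendsto_nhds_unique hlim tendsto_const_nhds
  rw [setIntegral_layerProfile_mul _ ha le_rfl hab,
    setIntegral_layerProfile_mul _ ha hab le_rfl] at this
  linarith

theorem integrableOn_timeAverage_mul {f : SpaceTime n → ℝ} (ha : 0 < a) (hab : a ≤ b) (p : ℝ)
    {S : Set (SpaceTime n)} (hf : IntegrableOn f S) :
    IntegrableOn (fun z => timeAverage p layerProfile a b (σ * (z.1 - T)) * f z) S := by
  obtain ⟨κ, hκ, h0, h1, hl⟩ := exists_timeTest_seq
  have hκs : ∀ j, ContDiff ℝ ∞ (κ j) := fun j => by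
    obtain ⟨c, d, -, -, -, h⟩ := hκ j
    exact h.smooth
  have hκc : ∀ j, HasCompactSupport (κ j) := fun j => by
    obtain ⟨c, d, -, -, -, h⟩ := hκ j
    exact h.compact
  have hm : Measurable (timeAverage p layerProfile a b) :=
    measurable_of_tendsto_metrizable
      (fun j => (contDiff_timeAverage ha hab (hκs j) (hκc j)).continuous.measurable)
      (tendsto_pi_nhds.2 fun τ => tendsto_timeAverage (κ₀ := layerProfile) ha hab
        (fun j => (hκs j).continuous.measurable) h0 h1 hl τ)
  refine hf.bdd_mul (hm.comp (measurable_const.mul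
    (measurable_fst.sub_const T))).aestronglyMeasurable (Eventually.of_forall fun z =>
    abs_timeAverage_le ha hab layerProfile_nonneg layerProfile_le_one _)

/-- The reaction part of the dissipation is nonnegative after averaging over scales, by the sign
condition on each layer, and is dropped. -/
theorem integral_homogeneityDefect_le (h : OneSidedSolution F β T x₀ u Du σ L) (ha : 0 < a)
    (hab : a ≤ b) (hb : b < √L / 4) :
    ∫ z in slab n σ T (a ^ 2) (4 * b ^ 2),
        timeAverage (-2 * β - 1) layerProfile a b (σ * (z.1 - T)) *
          (weight T x₀ z * ‖homogeneityDefect β T x₀ u Du z‖ ^ 2) ≤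
      weightedEnergy F β T x₀ u Du (slab n σ T (b ^ 2) (4 * b ^ 2)) b -
        weightedEnergy F β T x₀ u Du (slab n σ T (a ^ 2) (4 * a ^ 2)) a := by
  rw [h.weightedEnergy_sub ha hab hb]
  have hb0 : 0 < b := ha.trans_le hab
  have hb' := (lt_sqrt_div_four hb0).1 hb
  have ha2 : 0 < a ^ 2 := by positivity
  have iN := h.integrableOn_homogeneityDefect_sq ha2 hb'
  have iR := (h.integrableOn_reaction ha2 hb').const_mul 2
  have hpos := timeAverage_layerProfile_nonneg_integral (p := -2 * β - 1) ha hab iR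
    fun r hr => by
      rw [integral_const_mul]
      exact mul_nonneg zero_le_two
        (h.nonneg r ⟨ha.trans_le hr.1, hr.2.trans_lt hb⟩).2
  unfold dissipationDensity
  simp only [mul_add]
  rw [integral_add (integrableOn_timeAverage_mul ha hab _ iN)
    (integrableOn_timeAverage_mul ha hab _ iR)]
  linarith

theorem monotoneOn_weightedEnergy (h : OneSidedSolution F β T x₀ u Du σ L) :
    MonotoneOn (fun r => weightedEnergy F β T x₀ u Du (slab n σ T (r ^ 2) (4 * r ^ 2)) r)
      (Ioo 0 (√L / 4)) := by
  intro a ha b hb hab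
  have := h.integral_homogeneityDefect_le ha.1 hab hb.2
  have h2 : 0 ≤ ∫ z in slab n σ T (a ^ 2) (4 * b ^ 2),
      timeAverage (-2 * β - 1) layerProfile a b (σ * (z.1 - T)) *
          (weight T x₀ z * ‖homogeneityDefect β T x₀ u Du z‖ ^ 2) :=
    integral_nonneg fun z => mul_nonneg (timeAverage_nonneg ha.1 hab layerProfile_nonneg _)
      (mul_nonneg (weight_nonneg T x₀ z) (sq_nonneg _))
  simp only
  linarith

theorem exists_abs_weightedEnergy_le (h : OneSidedSolution F β T x₀ u Du σ L) :
    ∃ C, ∀ r ∈ Ioo 0 (√L / 4),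
      |weightedEnergy F β T x₀ u Du (slab n σ T (r ^ 2) (4 * r ^ 2)) r| ≤ C := by
  obtain ⟨C, hC⟩ := h.growth
  refine ⟨C + |β / 2| * C, fun r hr => ?_⟩
  obtain ⟨-, h2, h3, h4⟩ := hC r hr
  have hr0 : 0 ≤ r ^ (-2 * β) := Real.rpow_nonneg hr.1.le _
  rw [weightedEnergy]
  have e : ∫ z in slab n σ T (r ^ 2) (4 * r ^ 2), energy F u Du z * heatKernel T x₀ z =
      (∫ z in slab n σ T (r ^ 2) (4 * r ^ 2), gradSq Du z * heatKernel T x₀ z) -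
      ∫ z in slab n σ T (r ^ 2) (4 * r ^ 2), 2 * F (u z) * heatKernel T x₀ z := by
    rw [← integral_sub h2 h3]
    refine integral_congr_ae (Eventually.of_forall fun z => ?_)
    simp only [ParabolicSystem.energy]
    ring
  rw [e]
  set A := ∫ z in slab n σ T (r ^ 2) (4 * r ^ 2), 1 / (T - z.1) * ‖u z‖ ^ 2 * heatKernel T x₀ z
  set B := ∫ z in slab n σ T (r ^ 2) (4 * r ^ 2), gradSq Du z * heatKernel T x₀ z
  set D := ∫ z in slab n σ T (r ^ 2) (4 * r ^ 2), 2 * F (u z) * heatKernel T x₀ z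
  have hA := mul_nonneg hr0 (abs_nonneg A)
  have hB := mul_nonneg hr0 (abs_nonneg B)
  have hD := mul_nonneg hr0 (abs_nonneg D)
  have h5 : |r ^ (-2 * β) * (B - D)| ≤ C := by
    rw [abs_mul, abs_of_nonneg hr0]
    nlinarith [mul_le_mul_of_nonneg_left (abs_sub B D) hr0]
  have h6 : |β / 2 * r ^ (-2 * β) * A| ≤ |β / 2| * C := by
    rw [mul_assoc, abs_mul, abs_mul, abs_of_nonneg hr0]
    exact mul_le_mul_of_nonneg_left (by linarith) (abs_nonneg _)
  exact (abs_sub _ _).trans (add_le_add h5 h6)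

/-- A monotone function that is bounded below has a finite one-sided limit; the lower bound comes
from the growth estimate. -/
theorem exists_tendsto_weightedEnergy (h : OneSidedSolution F β T x₀ u Du σ L) :
    ∃ M, Tendsto (fun r => weightedEnergy F β T x₀ u Du (slab n σ T (r ^ 2) (4 * r ^ 2)) r)
      (𝓝[>] 0) (𝓝 M) := by
  have hL := h.pos
  obtain ⟨C, hC⟩ := h.exists_abs_weightedEnergy_le
  refine ⟨_, MonotoneOn.tendsto_nhdsWithin_Ioo_right (y := √L / 4)
    (nonempty_Ioo.2 (by positivity)) h.monotoneOn_weightedEnergy ⟨-C, ?_⟩⟩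
  rintro _ ⟨r, hr, rfl⟩
  exact neg_le_of_abs_le (hC r hr)

/-- The homogeneity defect in a core layer is controlled by the drop of the weighted energy. -/
theorem exists_homogeneityDefect_le (h : OneSidedSolution F β T x₀ u Du σ L) :
    ∃ C, 0 ≤ C ∧ ∀ r > 0, √2 * r < √L / 4 →
      ∫ z in slab n σ T (2 * r ^ 2) (4 * r ^ 2),
        weight T x₀ z * ‖homogeneityDefect β T x₀ u Du z‖ ^ 2 ≤
      C * r ^ (2 * β) * (weightedEnergy F β T x₀ u Du
          (slab n σ T ((√2 * r) ^ 2) (4 * (√2 * r) ^ 2)) (√2 * r) -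
        weightedEnergy F β T x₀ u Du (slab n σ T (r ^ 2) (4 * r ^ 2)) r) := by
  set c : ℝ := ∫ x in (1 : ℝ)..√2, x ^ (-2 * β - 1) with hc
  have h12 : (1 : ℝ) < √2 := Real.lt_sqrt_of_sq_lt (by norm_num)
  have hc0 : 0 < c := intervalIntegral.intervalIntegral_pos_of_pos_on
    (intervalIntegrable_rpow_of_pos one_pos h12.le _)
    (fun x hx => Real.rpow_pos_of_pos (one_pos.trans hx.1) _) h12
  refine ⟨1 / c, by positivity, fun r hr hrL => ?_⟩
  have hr2 : r ≤ √2 * r := by nlinarith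
  have hs : (√2 * r) ^ 2 = 2 * r ^ 2 := by rw [mul_pow, Real.sq_sqrt zero_le_two]
  have hb' := (lt_sqrt_div_four (by positivity)).1 hrL
  have hle := h.integral_homogeneityDefect_le hr hr2 hrL
  -- On the core layer the averaged profile is constant. The substitution `x ↦ r x` evaluates it,
  -- with `c` independent of `r`.
  have hcr : ∫ x in r..√2 * r, x ^ (-2 * β - 1) = r ^ (-2 * β) * c := by
    have := intervalIntegral.mul_integral_comp_mul_left (a := 1) (b := √2)
      (f := fun x => x ^ (-2 * β - 1)) (c := r)
    rw [mul_one, mul_comm r √2] at this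
    rw [← this, hc, ← intervalIntegral.integral_const_mul,
      ← intervalIntegral.integral_const_mul]
    refine intervalIntegral.integral_congr fun x hx => ?_
    rw [uIcc_of_le h12.le] at hx
    rw [Real.mul_rpow hr.le (by linarith [hx.1]), Real.rpow_sub hr, Real.rpow_one]
    field_simp
  have iN := h.integrableOn_homogeneityDefect_sq (by positivity : 0 < r ^ 2) hb'
  have hsub : slab n σ T (2 * r ^ 2) (4 * r ^ 2) ⊆ slab n σ T (r ^ 2) (4 * (√2 * r) ^ 2) :=
    slab_subset_slab (by nlinarith [sq_nonneg r]) (by rw [hs]; nlinarith [sq_nonneg r])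
  have hmono : r ^ (-2 * β) * c * (∫ z in slab n σ T (2 * r ^ 2) (4 * r ^ 2),
        weight T x₀ z * ‖homogeneityDefect β T x₀ u Du z‖ ^ 2) ≤
      ∫ z in slab n σ T (r ^ 2) (4 * (√2 * r) ^ 2),
        timeAverage (-2 * β - 1) layerProfile r (√2 * r) (σ * (z.1 - T)) *
          (weight T x₀ z * ‖homogeneityDefect β T x₀ u Du z‖ ^ 2) := by
    rw [← integral_const_mul]
    refine le_trans (le_of_eq ?_) (setIntegral_mono_set
      (integrableOn_timeAverage_mul hr hr2 _ iN) (Eventually.of_forall fun z => ?_)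
      hsub.eventuallyLE)
    · refine setIntegral_congr_fun measurableSet_slab fun z hz => ?_
      congr 1
      rw [← hcr, timeAverage]
      rw [intervalIntegral.integral_of_le hr2, intervalIntegral.integral_of_le hr2,
        integral_Ioc_eq_integral_Ioo, integral_Ioc_eq_integral_Ioo]
      -- For `r < x < √2 r` and `2r² < τ < 4r²` one has `x² < τ < 4x²`, so every scale `x` in the
      -- range sees the time `τ`.
      refine setIntegral_congr_fun measurableSet_Ioo fun x hx => ?_
      have hx0 : 0 < x := hr.trans hx.1
      rw [layerProfile_div hx0, mul_one]
      have g1 : x ^ 2 < (√2 * r) ^ 2 := pow_lt_pow_left₀ hx.2 hx0.le two_ne_zero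
      have g2 : r ^ 2 < x ^ 2 := pow_lt_pow_left₀ hx.1 hr.le two_ne_zero
      rw [hs] at g1
      exact ⟨g1.trans hz.1, hz.2.trans (by linarith)⟩
    · exact mul_nonneg (timeAverage_nonneg hr hr2 layerProfile_nonneg _)
        (mul_nonneg (weight_nonneg T x₀ z) (sq_nonneg _))
  have hfin := hmono.trans hle
  have hrβ : 0 < r ^ (2 * β) := Real.rpow_pos_of_pos hr _
  have hinv : r ^ (-2 * β) = (r ^ (2 * β))⁻¹ := by rw [← Real.rpow_neg hr.le]; ring_nf
  rw [hinv] at hfin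
  have := mul_le_mul_of_nonneg_left hfin (by positivity : 0 ≤ 1 / c * r ^ (2 * β))
  refine le_trans (le_of_eq ?_) this
  field_simp

end OneSidedSolution

/-! ### Parabolic dilations and the weighted measure. -/

/-- The parabolic dilation centred at `(T, x₀)`. -/
def parabolicDilation (T : ℝ) (x₀ : EuclideanSpace ℝ (Fin n)) (ρ : ℝ) (z : SpaceTime n) :
    SpaceTime n := (T + ρ ^ 2 * z.1, x₀ + ρ • z.2)

/-- The inverse of the parabolic dilation. -/
def parabolicDilationInv (T : ℝ) (x₀ : EuclideanSpace ℝ (Fin n)) (ρ : ℝ) (z : SpaceTime n) :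
    SpaceTime n := ((ρ ^ 2)⁻¹ * (z.1 - T), ρ⁻¹ • (z.2 - x₀))

section Dilation

variable {T σ α γ : ℝ} {x₀ : EuclideanSpace ℝ (Fin n)} {ρ : ℝ}

theorem contDiff_parabolicDilation : ContDiff ℝ ∞ (parabolicDilation T x₀ ρ) := by
  unfold parabolicDilation
  fun_prop

theorem contDiff_parabolicDilationInv : ContDiff ℝ ∞ (parabolicDilationInv T x₀ ρ) := by
  unfold parabolicDilationInv
  fun_prop

theorem parabolicDilationInv_dilation (hρ : 0 < ρ) (z : SpaceTime n) :
    parabolicDilationInv T x₀ ρ (parabolicDilation T x₀ ρ z) = z := by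
  have := hρ.ne'
  refine Prod.ext ?_ ?_
  · simp only [parabolicDilationInv, parabolicDilation]
    field_simp
    ring
  · simp [parabolicDilationInv, parabolicDilation, smul_smul, this]

theorem parabolicDilation_dilationInv (hρ : 0 < ρ) (z : SpaceTime n) :
    parabolicDilation T x₀ ρ (parabolicDilationInv T x₀ ρ z) = z := by
  have := hρ.ne'
  refine Prod.ext ?_ ?_
  · simp only [parabolicDilationInv, parabolicDilation]
    field_simp
    ring
  · simp [parabolicDilationInv, parabolicDilation, smul_smul, this]

/-- The parabolic dilation as a homeomorphism. -/
def dilationHomeomorph (T : ℝ) (x₀ : EuclideanSpace ℝ (Fin n)) (hρ : 0 < ρ) :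
    SpaceTime n ≃ₜ SpaceTime n where
  toFun := parabolicDilation T x₀ ρ
  invFun := parabolicDilationInv T x₀ ρ
  left_inv := parabolicDilationInv_dilation hρ
  right_inv := parabolicDilation_dilationInv hρ
  continuous_toFun := contDiff_parabolicDilation.continuous
  continuous_invFun := contDiff_parabolicDilationInv.continuous

theorem measurableEmbedding_parabolicDilation (hρ : 0 < ρ) :
    MeasurableEmbedding (parabolicDilation T x₀ ρ) :=
  (dilationHomeomorph T x₀ hρ).measurableEmbedding

theorem map_parabolicDilation (hρ : 0 < ρ) :
    Measure.map (parabolicDilation T x₀ ρ) volume =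
      ENNReal.ofReal (ρ ^ (n + 2))⁻¹ • (volume : Measure (SpaceTime n)) := by
  have h1 : Measure.map (Prod.map (fun t : ℝ => ρ ^ 2 * t)
      (fun x : EuclideanSpace ℝ (Fin n) => ρ • x)) volume =
      ENNReal.ofReal (ρ ^ (n + 2))⁻¹ • (volume : Measure (SpaceTime n)) := by
    rw [Measure.volume_eq_prod, ← Measure.map_prod_map _ _ (by fun_prop) (by fun_prop),
      Real.map_volume_mul_left (by positivity), Measure.map_addHaar_smul _ hρ.ne',
      Measure.prod_smul_left, Measure.prod_smul_right, smul_smul]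
    congr 1
    rw [finrank_euclideanSpace_fin, ← ENNReal.ofReal_mul (by positivity),
      abs_of_pos (by positivity), abs_of_pos (by positivity), pow_add, mul_inv, mul_comm]
  have h2 : parabolicDilation T x₀ ρ = (fun z => (T, x₀) + z) ∘
      Prod.map (fun t : ℝ => ρ ^ 2 * t) (fun x : EuclideanSpace ℝ (Fin n) => ρ • x) := by
    ext z <;> simp [parabolicDilation]
  rw [h2, ← Measure.map_map (by fun_prop) (by fun_prop), h1, Measure.map_smul,
    map_add_left_eq_self]

theorem setLIntegral_comp_dilation (hρ : 0 < ρ) (S : Set (SpaceTime n))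
    (g : SpaceTime n → ℝ≥0∞) :
    ∫⁻ z in parabolicDilation T x₀ ρ ⁻¹' S, g (parabolicDilation T x₀ ρ z) =
      ENNReal.ofReal (ρ ^ (n + 2))⁻¹ * ∫⁻ z in S, g z := by
  have he := measurableEmbedding_parabolicDilation (T := T) (x₀ := x₀) hρ
  rw [← he.lintegral_map, ← he.restrict_map, map_parabolicDilation hρ, Measure.restrict_smul,
    lintegral_smul_measure, smul_eq_mul]

theorem setIntegral_comp_dilation {E : Type*} [NormedAddCommGroup E] [NormedSpace ℝ E]
    (hρ : 0 < ρ) (S : Set (SpaceTime n)) (g : SpaceTime n → E) :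
    ∫ z in parabolicDilation T x₀ ρ ⁻¹' S, g (parabolicDilation T x₀ ρ z) =
      (ρ ^ (n + 2))⁻¹ • ∫ z in S, g z := by
  have he := measurableEmbedding_parabolicDilation (T := T) (x₀ := x₀) hρ
  rw [← he.setIntegral_map, map_parabolicDilation hρ, Measure.restrict_smul,
    integral_smul_measure, ENNReal.toReal_ofReal (by positivity)]

theorem aestronglyMeasurable_comp_dilation {E : Type*} [TopologicalSpace E] (hρ : 0 < ρ)
    {S : Set (SpaceTime n)} {g : SpaceTime n → E}
    (hg : AEStronglyMeasurable g (volume.restrict S)) :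
    AEStronglyMeasurable (fun z => g (parabolicDilation T x₀ ρ z))
      (volume.restrict (parabolicDilation T x₀ ρ ⁻¹' S)) := by
  have he := measurableEmbedding_parabolicDilation (T := T) (x₀ := x₀) hρ
  refine AEStronglyMeasurable.comp_measurable ?_ he.measurable
  rw [← he.restrict_map, map_parabolicDilation hρ, Measure.restrict_smul]
  exact hg.smul_measure _

theorem weight_dilation (hρ : 0 < ρ) (z : SpaceTime n) :
    weight T x₀ (parabolicDilation T x₀ ρ z) = (ρ ^ (n + 2))⁻¹ * weight 0 0 z := by
  have h1 : |4 * Real.pi * (T - (T + ρ ^ 2 * z.1))| = ρ ^ 2 * |4 * Real.pi * (0 - z.1)| := by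
    rw [← abs_of_pos (by positivity : 0 < ρ ^ 2), ← abs_mul, abs_of_pos (by positivity : 0 < ρ ^ 2)]
    congr 1
    ring
  have h2 : -‖x₀ + ρ • z.2 - x₀‖ ^ 2 / (4 * (T - (T + ρ ^ 2 * z.1))) =
      -‖z.2 - 0‖ ^ 2 / (4 * (0 - z.1)) := by
    rw [add_sub_cancel_left, norm_smul, Real.norm_of_nonneg hρ.le, sub_zero, mul_pow,
      show 4 * (T - (T + ρ ^ 2 * z.1)) = ρ ^ 2 * (4 * (0 - z.1)) by ring, ← mul_neg,
      mul_div_mul_left _ _ (by positivity)]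
  have h3 : (ρ ^ 2) ^ (-(n : ℝ) / 2 - 1) = (ρ ^ (n + 2))⁻¹ := by
    rw [← Real.rpow_natCast ρ 2, ← Real.rpow_mul hρ.le, ← Real.rpow_natCast, ← Real.rpow_neg hρ.le]
    congr 1
    push_cast
    ring
  simp only [weight, parabolicDilation]
  rw [h1, h2, Real.mul_rpow (by positivity) (abs_nonneg _), h3]
  ring

/-- The measure with density `W` is invariant: the factor `ρ^{-(n+2)}` from the homogeneity of the
weight equals the one from the change of variables. -/
theorem setLIntegral_weight_comp_dilation (hρ : 0 < ρ) (S : Set (SpaceTime n))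
    (g : SpaceTime n → ℝ≥0∞) :
    ∫⁻ z in parabolicDilation T x₀ ρ ⁻¹' S,
        ENNReal.ofReal (weight 0 0 z) * g (parabolicDilation T x₀ ρ z) =
      ∫⁻ z in S, ENNReal.ofReal (weight T x₀ z) * g z := by
  have hr : 0 < ρ ^ (n + 2) := by positivity
  have key := setLIntegral_comp_dilation (T := T) (x₀ := x₀) hρ S
    fun z => ENNReal.ofReal (weight T x₀ z) * g z
  simp only [weight_dilation hρ, ENNReal.ofReal_mul (inv_nonneg.2 hr.le), mul_assoc] at key
  rw [lintegral_const_mul' _ _ ENNReal.ofReal_ne_top] at key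
  exact (ENNReal.mul_right_inj (by simpa using hr) ENNReal.ofReal_ne_top).1 key

theorem weight_pos {z : SpaceTime n} (hz : T - z.1 ≠ 0) : 0 < weight T x₀ z := by
  have := Real.pi_pos
  rw [weight]
  positivity

/-- The weight is bounded below on bounded sets away from the time `T`. -/
theorem exists_le_weight {c R : ℝ} (hσ : σ = 1 ∨ σ = -1) (hc : 0 < c) (C : ℝ) :
    ∃ ε > 0, ∀ z : SpaceTime n, σ * z.1 ∈ Icc c C → ‖z.2‖ ≤ R → ε ≤ weight 0 0 z := by
  have hσ0 : ∀ z : SpaceTime n, σ * z.1 ∈ Icc c C → z.1 ≠ 0 := fun z hz h0 => by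
    rw [h0, mul_zero] at hz
    linarith [hz.1]
  have hsub : ∀ z : SpaceTime n, σ * z.1 ∈ Icc c C → ‖z.2‖ ≤ R →
      z ∈ ({t : ℝ | σ * t ∈ Icc c C} ∩ Icc (-C) C) ×ˢ
        Metric.closedBall (0 : EuclideanSpace ℝ (Fin n)) R := fun z hz hR => by
    refine ⟨⟨hz, ?_⟩, by simpa using hR⟩
    obtain ⟨h1, h2⟩ := hz
    rcases hσ with rfl | rfl <;> constructor <;> linarith
  have hK : IsCompact (({t : ℝ | σ * t ∈ Icc c C} ∩ Icc (-C) C) ×ˢ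
        Metric.closedBall (0 : EuclideanSpace ℝ (Fin n)) R) :=
    (isCompact_Icc.inter_left (isClosed_Icc.preimage (by fun_prop))).prod
      (isCompact_closedBall _ _)
  have hcont : ContinuousOn (weight (n := n) 0 0) (({t : ℝ | σ * t ∈ Icc c C} ∩ Icc (-C) C) ×ˢ
        Metric.closedBall (0 : EuclideanSpace ℝ (Fin n)) R) := fun z hz =>
    (contDiffAt_weight 0 (hσ0 z hz.1.1)).continuousAt.continuousWithinAt
  rcases eq_empty_or_nonempty (({t : ℝ | σ * t ∈ Icc c C} ∩ Icc (-C) C) ×ˢ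
        Metric.closedBall (0 : EuclideanSpace ℝ (Fin n)) R) with he | hne
  · exact ⟨1, one_pos, fun z hz hR => by
      have := hsub z hz hR
      rw [he] at this
      exact this.elim⟩
  · obtain ⟨z₀, hz₀, hmin⟩ := hK.exists_isMinOn hne hcont
    exact ⟨weight 0 0 z₀, weight_pos (by simpa using hσ0 z₀ hz₀.1.1),
      fun z hz hR => hmin (hsub z hz hR)⟩

/-- Bounds of a time distribution on dyadic layers, uniformly in the scale, give bounds on all
compact ranges of scaled times. -/
theorem exists_measure_scaled_le (q : ℝ) {c : ℝ} (hc : 0 < c) (C : ℝ) :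
    ∃ M : ℝ≥0∞, M ≠ ⊤ ∧ ∀ (ν : Measure ℝ) (b : ℝ≥0∞),
      (∀ᶠ r in 𝓝[>] (0 : ℝ), ν (Ioo (2 * r ^ 2) (4 * r ^ 2)) ≤ b * ENNReal.ofReal (r ^ (2 * q))) →
      ∀ᶠ ρ in 𝓝[>] (0 : ℝ), ν {τ | τ / ρ ^ 2 ∈ Icc c C} ≤
        M * b * ENNReal.ofReal (ρ ^ (2 * q)) := by
  refine IsCompact.induction_on (isCompact_Icc (a := c) (b := C))
    (p := fun s => ∃ M : ℝ≥0∞, M ≠ ⊤ ∧ ∀ (ν : Measure ℝ) (b : ℝ≥0∞),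
      (∀ᶠ r in 𝓝[>] (0 : ℝ), ν (Ioo (2 * r ^ 2) (4 * r ^ 2)) ≤ b * ENNReal.ofReal (r ^ (2 * q))) →
      ∀ᶠ ρ in 𝓝[>] (0 : ℝ), ν {τ | τ / ρ ^ 2 ∈ s} ≤
        M * b * ENNReal.ofReal (ρ ^ (2 * q))) ?_ ?_ ?_ ?_
  · exact ⟨0, by simp, fun ν b _ => by simp⟩
  · rintro s t hst ⟨M, hM, h⟩
    refine ⟨M, hM, fun ν b hb => (h ν b hb).mono fun ρ hρ => (measure_mono ?_).trans hρ⟩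
    exact fun τ hτ => hst hτ
  · rintro s t ⟨M, hM, h⟩ ⟨M', hM', h'⟩
    refine ⟨M + M', ENNReal.add_ne_top.2 ⟨hM, hM'⟩, fun ν b hb => ?_⟩
    filter_upwards [h ν b hb, h' ν b hb] with ρ h1 h2
    rw [add_mul, add_mul]
    refine le_trans ?_ (add_le_add h1 h2)
    refine (measure_mono ?_).trans (measure_union_le _ _)
    exact fun τ hτ => hτ
  · intro τ hτ
    have hτ0 : 0 < τ := hc.trans_le hτ.1
    -- With `l² = τ/3` the time `τ = 3l²` is the midpoint of `(2l², 4l²)`; the hypothesis on the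
    -- core layer of radius `lρ` then covers the scaled times near `τ`.
    have hl : √(τ / 3) ^ 2 = τ / 3 := Real.sq_sqrt (by positivity)
    have hl0 : 0 < √(τ / 3) := Real.sqrt_pos.2 (by positivity)
    set l := √(τ / 3)
    refine ⟨Ioo (2 * l ^ 2) (4 * l ^ 2), mem_nhdsWithin_of_mem_nhds
      (Ioo_mem_nhds (by rw [hl]; linarith) (by rw [hl]; linarith)),
      ENNReal.ofReal (l ^ (2 * q)), ENNReal.ofReal_ne_top, fun ν b hb => ?_⟩
    have hlim : Tendsto (fun ρ => l * ρ) (𝓝[>] (0 : ℝ)) (𝓝[>] 0) := by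
      refine tendsto_nhdsWithin_iff.2 ⟨?_, ?_⟩
      · have : Tendsto (fun ρ => l * ρ) (𝓝 (0 : ℝ)) (𝓝 (l * 0)) := tendsto_id.const_mul l
        rw [mul_zero] at this
        exact this.mono_left nhdsWithin_le_nhds
      · filter_upwards [self_mem_nhdsWithin] with ρ hρ using mul_pos hl0 hρ
    filter_upwards [hlim.eventually hb, self_mem_nhdsWithin] with ρ h1 hρ
    have hρ0 : (0 : ℝ) < ρ := hρ
    have e : {τ | τ / ρ ^ 2 ∈ Ioo (2 * l ^ 2) (4 * l ^ 2)} =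
        Ioo (2 * (l * ρ) ^ 2) (4 * (l * ρ) ^ 2) := by
      ext x
      simp only [mem_ofPred_eq, mem_Ioo]
      rw [lt_div_iff₀ (by positivity), div_lt_iff₀ (by positivity), mul_pow, mul_assoc, mul_assoc]
    rw [e]
    refine h1.trans (le_of_eq ?_)
    rw [Real.mul_rpow hl0.le hρ0.le, ENNReal.ofReal_mul (Real.rpow_nonneg hl0.le _)]
    ring

end Dilation

/-! ### Local bounds for the rescaled functions. -/

/-- Bounded sets of points on the side `σ` of the time `0`, away from the time `0`. -/
def timeBox (n : ℕ) (σ c C R : ℝ) : Set (SpaceTime n) := {z | σ * z.1 ∈ Icc c C ∧ ‖z.2‖ ≤ R}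

theorem isClosed_timeBox {σ c C R : ℝ} : IsClosed (timeBox n σ c C R) :=
  (isClosed_Icc.preimage (by fun_prop : Continuous fun z : SpaceTime n => σ * z.1)).inter
    (isClosed_le (continuous_snd.norm) continuous_const)

theorem measurableSet_timeBox {σ c C R : ℝ} : MeasurableSet (timeBox n σ c C R) :=
  isClosed_timeBox.measurableSet

/-- The weak gradient of the parabolic rescaling of `u`. -/
def rescaleGrad (β T : ℝ) (x₀ : EuclideanSpace ℝ (Fin n))
    (Du : Fin (n + 1) → SpaceTime n → EuclideanSpace ℝ (Fin m)) (ρ : ℝ) (k : Fin (n + 1))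
    (z : SpaceTime n) : EuclideanSpace ℝ (Fin m) :=
  (ρ ^ (-β) * if k = 0 then ρ ^ 2 else ρ) • Du k (parabolicDilation T x₀ ρ z)

section

variable {σ c C R β T ρ q : ℝ} {x₀ : EuclideanSpace ℝ (Fin n)}
  {u : SpaceTime n → EuclideanSpace ℝ (Fin m)}
  {Du : Fin (n + 1) → SpaceTime n → EuclideanSpace ℝ (Fin m)}

theorem rescale_eq (z : SpaceTime n) :
    rescale β T x₀ u ρ z = ρ ^ (-β) • u (parabolicDilation T x₀ ρ z) := rfl

/-- A spatial derivative lowers the degree of homogeneity by one, so the gradient is estimated by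
the same scaling lemma with `β - 1` in place of `β`. -/
theorem rescaleGrad_succ (hρ : 0 < ρ) (j : Fin n) (z : SpaceTime n) :
    rescaleGrad β T x₀ Du ρ j.succ z =
      ρ ^ (-(β - 1)) • Du j.succ (parabolicDilation T x₀ ρ z) := by
  rw [rescaleGrad, if_neg (Fin.succ_ne_zero j), neg_sub, sub_eq_add_neg, Real.rpow_add hρ,
    Real.rpow_one, mul_comm]

/-- The generator of the dilations commutes with them, so the defect scales like `u` itself. -/
theorem homogeneityDefect_rescale (z : SpaceTime n) :
    homogeneityDefect β 0 0 (rescale β T x₀ u ρ) (rescaleGrad β T x₀ Du ρ) z =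
      ρ ^ (-β) • homogeneityDefect β T x₀ u Du (parabolicDilation T x₀ ρ z) := by
  simp only [homogeneityDefect, dilationDeriv, rescaleGrad, rescale_eq, smul_sub, Finset.smul_sum,
    smul_smul]
  congr 1
  · refine Finset.sum_congr rfl fun k _ => ?_
    congr 1
    refine Fin.cases ?_ (fun j => ?_) k
    · simp [parabolicDilation]
      ring
    · simp [parabolicDilation]
      ring
  · rw [mul_comm]

theorem lintegral_weight_mul_enorm_sq {S : Set (SpaceTime n)}
    {v : SpaceTime n → EuclideanSpace ℝ (Fin m)}
    (hv : IntegrableOn (fun z => weight T x₀ z * ‖v z‖ ^ 2) S) :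
    ∫⁻ z in S, ENNReal.ofReal (weight T x₀ z) * ‖v z‖ₑ ^ 2 =
      ENNReal.ofReal (∫ z in S, weight T x₀ z * ‖v z‖ ^ 2) := by
  rw [ofReal_integral_eq_lintegral_ofReal hv (Eventually.of_forall fun z =>
    mul_nonneg (weight_nonneg T x₀ z) (sq_nonneg _))]
  refine lintegral_congr fun z => ?_
  rw [ENNReal.ofReal_mul (weight_nonneg T x₀ z), ENNReal.ofReal_pow (norm_nonneg _),
    ofReal_norm]

theorem ofReal_rpow_neg_mul_rpow (hρ : 0 < ρ) (q : ℝ) :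
    ‖ρ ^ (-q)‖ₑ ^ 2 * ENNReal.ofReal (ρ ^ (2 * q)) = 1 := by
  have h1 : 0 < ρ ^ (-q) := Real.rpow_pos_of_pos hρ _
  rw [Real.enorm_of_nonneg h1.le, ← ENNReal.ofReal_pow h1.le,
    ← ENNReal.ofReal_mul (by positivity), ← Real.rpow_natCast, ← Real.rpow_mul hρ.le,
    ← Real.rpow_add hρ]
  norm_num
  ring_nf
  simp

/-- Weighted bounds on dyadic layers give `L²` bounds for the rescaled functions. -/
theorem exists_lintegral_rescale_le (n m : ℕ) (hσ : σ = 1 ∨ σ = -1) (hc : 0 < c) (C R q : ℝ) :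
    ∃ M : ℝ≥0∞, M ≠ ⊤ ∧ ∀ (T : ℝ) (x₀ : EuclideanSpace ℝ (Fin n))
      (v : SpaceTime n → EuclideanSpace ℝ (Fin m)) (b : ℝ≥0∞),
      (∀ᶠ r in 𝓝[>] (0 : ℝ), ∫⁻ z in slab n σ T (2 * r ^ 2) (4 * r ^ 2),
        ENNReal.ofReal (weight T x₀ z) * ‖v z‖ₑ ^ 2 ≤ b * ENNReal.ofReal (r ^ (2 * q))) →
      ∀ᶠ ρ in 𝓝[>] (0 : ℝ), ∫⁻ z in timeBox n σ c C R,
        ‖ρ ^ (-q) • v (parabolicDilation T x₀ ρ z)‖ₑ ^ 2 ≤ M * b := by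
  obtain ⟨ε, hε, hW⟩ := exists_le_weight (n := n) (R := R) hσ hc C
  have hε' : 0 < ENNReal.ofReal ε := ENNReal.ofReal_pos.2 hε
  have hinv : (ENNReal.ofReal ε)⁻¹ ≠ ⊤ := ENNReal.inv_ne_top.2 hε'.ne'
  set τ : ℝ → SpaceTime n → ℝ := fun T z => σ * (z.1 - T) with hτ
  have hτm : ∀ T, Measurable (τ T) := fun T =>
    measurable_const.mul (measurable_fst.sub_const T)
  -- Projecting the weighted measure to the time axis reduces the covering by dyadic layers to a
  -- statement about measures on `ℝ`.
  set ν : (T : ℝ) → (SpaceTime n → ℝ≥0∞) → Measure ℝ := fun T g =>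
    (volume.withDensity g).map (τ T) with hν
  have hνa : ∀ (T : ℝ) (g : SpaceTime n → ℝ≥0∞) (s : Set ℝ), MeasurableSet s →
      ν T g s = ∫⁻ z in τ T ⁻¹' s, g z := fun T g s hs => by
    rw [hν, Measure.map_apply (hτm T) hs, withDensity_apply _ (hτm T hs)]
  obtain ⟨M, hM⟩ : ∃ M : ℝ≥0∞, M ≠ ⊤ ∧ ∀ (ν : Measure ℝ) (b : ℝ≥0∞),
      (∀ᶠ r in 𝓝[>] (0 : ℝ), ν (Ioo (2 * r ^ 2) (4 * r ^ 2)) ≤ b * ENNReal.ofReal (r ^ (2 * q))) →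
      ∀ᶠ ρ in 𝓝[>] (0 : ℝ), ν {τ | τ / ρ ^ 2 ∈ Icc c C} ≤
        M * b * ENNReal.ofReal (ρ ^ (2 * q)) := exists_measure_scaled_le q hc C
  refine ⟨(ENNReal.ofReal ε)⁻¹ * M, ENNReal.mul_ne_top hinv hM.1, fun T x₀ v b hb => ?_⟩
  set g : SpaceTime n → ℝ≥0∞ := fun z => ENNReal.ofReal (weight T x₀ z) * ‖v z‖ₑ ^ 2 with hg
  have hb' : ∀ᶠ r in 𝓝[>] (0 : ℝ), ν T g (Ioo (2 * r ^ 2) (4 * r ^ 2)) ≤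
      b * ENNReal.ofReal (r ^ (2 * q)) := hb.mono fun r hr => by
    rw [hνa T g _ measurableSet_Ioo]
    exact hr
  filter_upwards [hM.2 (ν T g) b hb', self_mem_nhdsWithin] with ρ h1 hρ
  have hρ0 : (0 : ℝ) < ρ := hρ
  have hms : MeasurableSet {τ : ℝ | τ / ρ ^ 2 ∈ Icc c C} :=
    measurableSet_Icc.preimage (measurable_id.div_const _)
  rw [hνa T g _ hms] at h1
  set S := τ T ⁻¹' {τ : ℝ | τ / ρ ^ 2 ∈ Icc c C}
  have hsub : timeBox n σ c C R ⊆ parabolicDilation T x₀ ρ ⁻¹' S := fun z hz => by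
    change σ * (T + ρ ^ 2 * z.1 - T) / ρ ^ 2 ∈ Icc c C
    rw [show σ * (T + ρ ^ 2 * z.1 - T) = ρ ^ 2 * (σ * z.1) by ring,
      mul_div_cancel_left₀ _ (by positivity)]
    exact hz.1
  -- The weight centred at the origin is at least `ε` on the box, so it can be inserted at the cost
  -- of `1/ε`; its invariance then moves the integral back to the original variables.
  have hpt : ∀ z ∈ timeBox n σ c C R, ‖ρ ^ (-q) • v (parabolicDilation T x₀ ρ z)‖ₑ ^ 2 ≤
      ‖ρ ^ (-q)‖ₑ ^ 2 * (ENNReal.ofReal ε)⁻¹ * (ENNReal.ofReal (weight 0 0 z) *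
        ‖v (parabolicDilation T x₀ ρ z)‖ₑ ^ 2) := fun z hz => by
    rw [enorm_smul, mul_pow, mul_assoc]
    refine mul_le_mul_right ?_ _
    rw [← mul_assoc]
    refine le_mul_of_one_le_left zero_le ?_
    rw [← ENNReal.inv_mul_cancel hε'.ne' ENNReal.ofReal_ne_top]
    exact mul_le_mul_right (ENNReal.ofReal_le_ofReal (hW z hz.1 hz.2)) _
  calc ∫⁻ z in timeBox n σ c C R, ‖ρ ^ (-q) • v (parabolicDilation T x₀ ρ z)‖ₑ ^ 2
      ≤ ∫⁻ z in timeBox n σ c C R, ‖ρ ^ (-q)‖ₑ ^ 2 * (ENNReal.ofReal ε)⁻¹ *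
          (ENNReal.ofReal (weight 0 0 z) * ‖v (parabolicDilation T x₀ ρ z)‖ₑ ^ 2) :=
        setLIntegral_mono' measurableSet_timeBox hpt
    _ ≤ ∫⁻ z in parabolicDilation T x₀ ρ ⁻¹' S, ‖ρ ^ (-q)‖ₑ ^ 2 * (ENNReal.ofReal ε)⁻¹ *
          (ENNReal.ofReal (weight 0 0 z) * ‖v (parabolicDilation T x₀ ρ z)‖ₑ ^ 2) :=
        lintegral_mono_set hsub
    _ = ‖ρ ^ (-q)‖ₑ ^ 2 * (ENNReal.ofReal ε)⁻¹ * ∫⁻ z in S, g z := by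
        rw [lintegral_const_mul' _ _ (ENNReal.mul_ne_top (by simp) hinv),
          setLIntegral_weight_comp_dilation hρ0 S fun z => ‖v z‖ₑ ^ 2]
    _ ≤ ‖ρ ^ (-q)‖ₑ ^ 2 * (ENNReal.ofReal ε)⁻¹ * (M * b * ENNReal.ofReal (ρ ^ (2 * q))) :=
        mul_le_mul_right h1 _
    _ = (‖ρ ^ (-q)‖ₑ ^ 2 * ENNReal.ofReal (ρ ^ (2 * q))) * ((ENNReal.ofReal ε)⁻¹ * M * b) := by
        ring
    _ = (ENNReal.ofReal ε)⁻¹ * M * b := by rw [ofReal_rpow_neg_mul_rpow hρ0, one_mul]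

/-- The definition of the defect is solved for `2t ∂_t v`, namely defect plus `β v` minus `x·∇v`. On
the box `|t| ≥ c` and `‖x‖ ≤ R`; the factors `3` and `n` come from Cauchy-Schwarz for three terms
and for the `n` partial derivatives. -/
theorem norm_timeDeriv_sq_le {z : SpaceTime n} (hσ : σ = 1 ∨ σ = -1) (hc : 0 < c)
    (hz : z ∈ timeBox n σ c C R) (v : SpaceTime n → EuclideanSpace ℝ (Fin m))
    (Dv : Fin (n + 1) → SpaceTime n → EuclideanSpace ℝ (Fin m)) :
    ‖Dv 0 z‖ ^ 2 ≤ (3 * (1 + β ^ 2 + n * R ^ 2) / (4 * c ^ 2)) *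
      (‖homogeneityDefect β 0 0 v Dv z‖ ^ 2 + ‖v z‖ ^ 2 + ∑ j : Fin n, ‖Dv j.succ z‖ ^ 2) := by
  have hR : 0 ≤ R := (norm_nonneg _).trans hz.2
  have ht : c ≤ |z.1| := by
    refine hz.1.1.trans ((le_abs_self _).trans (le_of_eq ?_))
    rw [abs_mul]
    rcases hσ with rfl | rfl <;> simp
  have e : (2 * z.1) • Dv 0 z = homogeneityDefect β 0 0 v Dv z + β • v z -
      ∑ j : Fin n, z.2 j • Dv j.succ z := by
    simp [homogeneityDefect, dilationDeriv, Fin.sum_univ_succ]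
  have hsum : ‖∑ j : Fin n, z.2 j • Dv j.succ z‖ ≤ R * ∑ j : Fin n, ‖Dv j.succ z‖ := by
    rw [Finset.mul_sum]
    refine (norm_sum_le _ _).trans (Finset.sum_le_sum fun j _ => ?_)
    rw [norm_smul]
    exact mul_le_mul_of_nonneg_right ((PiLp.norm_apply_le z.2 j).trans hz.2) (norm_nonneg _)
  have h1 : 2 * c * ‖Dv 0 z‖ ≤ ‖homogeneityDefect β 0 0 v Dv z‖ + |β| * ‖v z‖ +
      R * ∑ j : Fin n, ‖Dv j.succ z‖ := by
    have h2 : ‖(2 * z.1) • Dv 0 z‖ = 2 * |z.1| * ‖Dv 0 z‖ := by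
      rw [norm_smul, norm_mul, Real.norm_two, Real.norm_eq_abs]
    have h3 : 2 * c * ‖Dv 0 z‖ ≤ 2 * |z.1| * ‖Dv 0 z‖ :=
      mul_le_mul_of_nonneg_right (by linarith) (norm_nonneg _)
    rw [← h2, e] at h3
    refine h3.trans ((norm_sub_le _ _).trans (add_le_add ((norm_add_le _ _).trans ?_) hsum))
    rw [norm_smul, Real.norm_eq_abs]
  have hcs : (∑ j : Fin n, ‖Dv j.succ z‖) ^ 2 ≤ n * ∑ j : Fin n, ‖Dv j.succ z‖ ^ 2 := by
    have := sq_sum_le_card_mul_sum_sq (s := Finset.univ) (f := fun j : Fin n => ‖Dv j.succ z‖)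
    simpa using this
  set N := ‖homogeneityDefect β 0 0 v Dv z‖
  set s := ∑ j : Fin n, ‖Dv j.succ z‖
  set Q := ∑ j : Fin n, ‖Dv j.succ z‖ ^ 2 with hQ
  have hQ0 : 0 ≤ Q := Finset.sum_nonneg fun _ _ => sq_nonneg _
  have hsq := pow_le_pow_left₀ (by positivity) h1 2
  have h4 : (N + |β| * ‖v z‖ + R * s) ^ 2 ≤ 3 * (N ^ 2 + (|β| * ‖v z‖) ^ 2 + (R * s) ^ 2) := by
    nlinarith [sq_nonneg (N - |β| * ‖v z‖), sq_nonneg (N - R * s),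
      sq_nonneg (|β| * ‖v z‖ - R * s)]
  have h5 : (R * s) ^ 2 ≤ n * R ^ 2 * Q := by
    rw [mul_pow]
    nlinarith [mul_le_mul_of_nonneg_left hcs (sq_nonneg R)]
  have h6 : (|β| * ‖v z‖) ^ 2 = β ^ 2 * ‖v z‖ ^ 2 := by rw [mul_pow, sq_abs]
  have hn : (0 : ℝ) ≤ n * R ^ 2 := by positivity
  rw [div_mul_eq_mul_div, le_div_iff₀ (by positivity)]
  have hN : 0 ≤ N ^ 2 := sq_nonneg _
  have hv : 0 ≤ ‖v z‖ ^ 2 := sq_nonneg _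
  have h7 : N ^ 2 + β ^ 2 * ‖v z‖ ^ 2 + n * R ^ 2 * Q ≤
      (1 + β ^ 2 + n * R ^ 2) * (N ^ 2 + ‖v z‖ ^ 2 + Q) := by
    nlinarith [mul_nonneg (sq_nonneg β) hN, mul_nonneg (sq_nonneg β) hQ0, mul_nonneg hn hN,
      mul_nonneg hn hv]
  nlinarith

end

namespace OneSidedSolution

variable {F : EuclideanSpace ℝ (Fin m) → ℝ} {β T σ L c C R : ℝ} {x₀ : EuclideanSpace ℝ (Fin n)}
  {u : SpaceTime n → EuclideanSpace ℝ (Fin m)}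
  {Du : Fin (n + 1) → SpaceTime n → EuclideanSpace ℝ (Fin m)}

theorem eventually_mem (h : OneSidedSolution F β T x₀ u Du σ L) :
    ∀ᶠ r in 𝓝[>] (0 : ℝ), r ∈ Ioo 0 (√L / 4) :=
  Ioo_mem_nhdsGT (by have := h.pos; positivity)

theorem integral_core_le {f : SpaceTime n → ℝ} (hf0 : ∀ z, 0 ≤ f z) {r : ℝ}
    (hf : IntegrableOn f (slab n σ T (r ^ 2) (4 * r ^ 2))) :
    ∫ z in slab n σ T (2 * r ^ 2) (4 * r ^ 2), f z ≤
      ∫ z in slab n σ T (r ^ 2) (4 * r ^ 2), f z :=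
  setIntegral_mono_set hf (Eventually.of_forall hf0)
    (slab_subset_slab (by nlinarith [sq_nonneg r]) le_rfl).eventuallyLE

theorem ofReal_le_of_rpow_mul_le {r q I B : ℝ} (hr : 0 < r) (hB : 0 ≤ B)
    (h : r ^ (-(2 * q)) * I ≤ B) :
    ENNReal.ofReal I ≤ ENNReal.ofReal B * ENNReal.ofReal (r ^ (2 * q)) := by
  have hp : 0 < r ^ (2 * q) := Real.rpow_pos_of_pos hr _
  rw [Real.rpow_neg hr.le] at h
  rw [← ENNReal.ofReal_mul hB]
  refine ENNReal.ofReal_le_ofReal ?_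
  rwa [inv_mul_le_iff₀ hp, mul_comm] at h

theorem exists_layer_sq_le (h : OneSidedSolution F β T x₀ u Du σ L) :
    ∃ b : ℝ≥0∞, b ≠ ⊤ ∧ ∀ᶠ r in 𝓝[>] (0 : ℝ), ∫⁻ z in slab n σ T (2 * r ^ 2) (4 * r ^ 2),
      ENNReal.ofReal (weight T x₀ z) * ‖u z‖ₑ ^ 2 ≤ b * ENNReal.ofReal (r ^ (2 * β)) := by
  obtain ⟨B, hB⟩ := h.growth
  refine ⟨ENNReal.ofReal |B|, ENNReal.ofReal_ne_top, ?_⟩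
  filter_upwards [h.eventually_mem] with r hr
  obtain ⟨h1, -, -, h4⟩ := hB r hr
  have hr2 : 0 < r ^ 2 := by have := hr.1; positivity
  have e : ∀ z ∈ slab n σ T (r ^ 2) (4 * r ^ 2),
      1 / (T - z.1) * ‖u z‖ ^ 2 * heatKernel T x₀ z = weight T x₀ z * ‖u z‖ ^ 2 := fun z hz => by
    rw [weight_eq (time_ne_of_mem_slab hr2.le hz)]
    ring
  have h1' : IntegrableOn (fun z => weight T x₀ z * ‖u z‖ ^ 2)
      (slab n σ T (r ^ 2) (4 * r ^ 2)) := h1.congr_fun e measurableSet_slab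
  rw [setIntegral_congr_fun measurableSet_slab e] at h4
  rw [lintegral_weight_mul_enorm_sq (h1'.mono_set
    (slab_subset_slab (by linarith) le_rfl))]
  refine ofReal_le_of_rpow_mul_le hr.1 (abs_nonneg B) ?_
  have hp : 0 ≤ r ^ (-2 * β) := Real.rpow_nonneg hr.1.le _
  rw [show -(2 * β) = -2 * β by ring]
  have hcore := integral_core_le (σ := σ) (T := T) (r := r)
    (fun z => mul_nonneg (weight_nonneg T x₀ z) (sq_nonneg ‖u z‖)) h1'
  have g1 := mul_le_mul_of_nonneg_left (hcore.trans (le_abs_self _)) hp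
  have g2 := mul_nonneg hp (abs_nonneg
    (∫ z in slab n σ T (r ^ 2) (4 * r ^ 2), gradSq Du z * heatKernel T x₀ z))
  have g3 := mul_nonneg hp (abs_nonneg
    (∫ z in slab n σ T (r ^ 2) (4 * r ^ 2), 2 * F (u z) * heatKernel T x₀ z))
  linarith [le_abs_self B]

/-- Since `|G| = |T - t| W ≥ r² W` on the layer, passing from `G` to `W` gains a factor `r²`, which
changes the exponent from `β` to `β - 1`. The sign `-σ` makes `G` positive. -/
theorem exists_layer_grad_le (h : OneSidedSolution F β T x₀ u Du σ L) (j : Fin n) :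
    ∃ b : ℝ≥0∞, b ≠ ⊤ ∧ ∀ᶠ r in 𝓝[>] (0 : ℝ), ∫⁻ z in slab n σ T (2 * r ^ 2) (4 * r ^ 2),
      ENNReal.ofReal (weight T x₀ z) * ‖Du j.succ z‖ₑ ^ 2 ≤
        b * ENNReal.ofReal (r ^ (2 * (β - 1))) := by
  obtain ⟨B, hB⟩ := h.growth
  have hL := h.pos
  refine ⟨ENNReal.ofReal |B|, ENNReal.ofReal_ne_top, ?_⟩
  filter_upwards [h.eventually_mem] with r hr
  obtain ⟨-, h2, -, h4⟩ := hB r hr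
  have hr2 : 0 < r ^ 2 := by have := hr.1; positivity
  have hr4 := (lt_sqrt_div_four hr.1).1 hr.2
  have hG := (h.layerIntegrable hr2 hr4).grad
  have hDm := h.aestronglyMeasurable_grad hr2.le (by linarith : 4 * r ^ 2 ≤ L) j.succ
  have hj : IntegrableOn (fun z => weight T x₀ z * ‖Du j.succ z‖ ^ 2)
      (slab n σ T (r ^ 2) (4 * r ^ 2)) := by
    refine Integrable.mono' hG ((measurable_weight T x₀).aestronglyMeasurable.mul
      (hDm.norm.pow 2)) (Eventually.of_forall fun z => ?_)
    rw [Real.norm_of_nonneg (mul_nonneg (weight_nonneg T x₀ z) (sq_nonneg _))]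
    exact mul_le_mul_of_nonneg_left (norm_sq_le_gradSq Du j z) (weight_nonneg T x₀ z)
  rw [lintegral_weight_mul_enorm_sq (hj.mono_set (slab_subset_slab (by linarith) le_rfl))]
  refine ofReal_le_of_rpow_mul_le hr.1 (abs_nonneg B) ?_
  have hp : 0 ≤ r ^ (-2 * β) := Real.rpow_nonneg hr.1.le _
  have hexp : r ^ (-(2 * (β - 1))) = r ^ (-2 * β) * r ^ 2 := by
    rw [show -(2 * (β - 1)) = -2 * β + (2 : ℕ) by push_cast; ring, Real.rpow_add hr.1,
      Real.rpow_natCast]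
  have hσ2 : |-σ| = 1 := by rcases h.sign with rfl | rfl <;> norm_num
  have hcore := integral_core_le (σ := σ) (T := T) (r := r)
    (fun z => mul_nonneg (weight_nonneg T x₀ z) (sq_nonneg ‖Du j.succ z‖)) hj
  have hle : r ^ 2 * ∫ z in slab n σ T (r ^ 2) (4 * r ^ 2), weight T x₀ z * ‖Du j.succ z‖ ^ 2 ≤
      |∫ z in slab n σ T (r ^ 2) (4 * r ^ 2), gradSq Du z * heatKernel T x₀ z| := by
    calc r ^ 2 * ∫ z in slab n σ T (r ^ 2) (4 * r ^ 2), weight T x₀ z * ‖Du j.succ z‖ ^ 2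
        ≤ ∫ z in slab n σ T (r ^ 2) (4 * r ^ 2), -σ * (gradSq Du z * heatKernel T x₀ z) := by
          rw [← integral_const_mul]
          refine setIntegral_mono_on (hj.const_mul _) (h2.const_mul _) measurableSet_slab
            fun z hz => ?_
          have hs : -σ * (T - z.1) = σ * (z.1 - T) := by ring
          rw [heatKernel_eq, show -σ * (gradSq Du z * ((T - z.1) * weight T x₀ z)) =
            (-σ * (T - z.1)) * (weight T x₀ z * gradSq Du z) by ring, hs]
          exact mul_le_mul hz.1.le (mul_le_mul_of_nonneg_left (norm_sq_le_gradSq Du j z)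
            (weight_nonneg T x₀ z)) (mul_nonneg (weight_nonneg T x₀ z) (sq_nonneg _))
            (hr2.le.trans hz.1.le)
      _ ≤ |∫ z in slab n σ T (r ^ 2) (4 * r ^ 2), gradSq Du z * heatKernel T x₀ z| := by
          rw [integral_const_mul]
          refine (le_abs_self _).trans (le_of_eq ?_)
          rw [abs_mul, hσ2, one_mul]
  have g1 := mul_le_mul_of_nonneg_left hle hp
  have g2 := mul_nonneg hp (abs_nonneg (∫ z in slab n σ T (r ^ 2) (4 * r ^ 2),
    1 / (T - z.1) * ‖u z‖ ^ 2 * heatKernel T x₀ z))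
  have g3 := mul_nonneg hp (abs_nonneg
    (∫ z in slab n σ T (r ^ 2) (4 * r ^ 2), 2 * F (u z) * heatKernel T x₀ z))
  have g4 := mul_le_mul_of_nonneg_left hcore (mul_nonneg hp hr2.le)
  rw [hexp]
  linarith [le_abs_self B]

/-- The weighted energies at the scales `√2 r` and `r` converge to the same limit, so the drop that
controls the defect is eventually as small as desired. -/
theorem eventually_layer_defect_le (h : OneSidedSolution F β T x₀ u Du σ L) {ε : ℝ}
    (hε : 0 < ε) :
    ∀ᶠ r in 𝓝[>] (0 : ℝ), ∫⁻ z in slab n σ T (2 * r ^ 2) (4 * r ^ 2),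
      ENNReal.ofReal (weight T x₀ z) * ‖homogeneityDefect β T x₀ u Du z‖ₑ ^ 2 ≤
        ENNReal.ofReal ε * ENNReal.ofReal (r ^ (2 * β)) := by
  obtain ⟨K, hK0, hK⟩ := h.exists_homogeneityDefect_le
  obtain ⟨M, hM⟩ := h.exists_tendsto_weightedEnergy
  have hlim : Tendsto (fun r => √2 * r) (𝓝[>] (0 : ℝ)) (𝓝[>] 0) := by
    refine tendsto_nhdsWithin_iff.2 ⟨?_, ?_⟩
    · have : Tendsto (fun r => √2 * r) (𝓝 (0 : ℝ)) (𝓝 (√2 * 0)) := tendsto_id.const_mul _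
      rw [mul_zero] at this
      exact this.mono_left nhdsWithin_le_nhds
    · filter_upwards [self_mem_nhdsWithin] with r hr using
        mul_pos (Real.sqrt_pos.2 two_pos) hr
  have hdiff := ((hM.comp hlim).sub hM).const_mul K
  simp only [sub_self, mul_zero] at hdiff
  filter_upwards [hdiff.eventually_lt_const hε, h.eventually_mem, hlim.eventually h.eventually_mem]
    with r h1 hr hr'
  have hr2 : 0 < r ^ 2 := by have := hr.1; positivity
  have hi := h.integrableOn_homogeneityDefect_sq hr2 ((lt_sqrt_div_four hr.1).1 hr.2)
  rw [lintegral_weight_mul_enorm_sq (hi.mono_set (slab_subset_slab (by linarith) le_rfl)),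
    ← ENNReal.ofReal_mul hε.le]
  refine ENNReal.ofReal_le_ofReal ((hK r hr.1 hr'.2).trans ?_)
  have hp : 0 ≤ r ^ (2 * β) := Real.rpow_nonneg hr.1.le _
  have := mul_le_mul_of_nonneg_right h1.le hp
  simp only [Function.comp] at this
  linarith

/-- Rescaled compact sets are eventually contained in the domain of the solution. -/
theorem eventually_timeBox_subset (h : OneSidedSolution F β T x₀ u Du σ L) (hc : 0 < c)
    (C R : ℝ) :
    ∀ᶠ ρ in 𝓝[>] (0 : ℝ), timeBox n σ c C R ⊆ parabolicDilation T x₀ ρ ⁻¹' slab n σ T 0 L := by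
  have hlim : Tendsto (fun ρ : ℝ => ρ ^ 2 * C) (𝓝[>] 0) (𝓝 0) := by
    have : Tendsto (fun ρ : ℝ => ρ ^ 2 * C) (𝓝 0) (𝓝 (0 ^ 2 * C)) :=
      (tendsto_id.pow 2).mul_const C
    rw [zero_pow two_ne_zero, zero_mul] at this
    exact this.mono_left nhdsWithin_le_nhds
  filter_upwards [hlim.eventually_lt_const h.pos, self_mem_nhdsWithin] with ρ h1 hρ z hz
  have hρ0 : (0 : ℝ) < ρ := hρ
  have e : σ * (T + ρ ^ 2 * z.1 - T) = ρ ^ 2 * (σ * z.1) := by ring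
  change 0 < σ * (T + ρ ^ 2 * z.1 - T) ∧ σ * (T + ρ ^ 2 * z.1 - T) < L
  rw [e]
  exact ⟨mul_pos (by positivity) (hc.trans_le hz.1.1),
    (mul_le_mul_of_nonneg_left hz.1.2 (by positivity)).trans_lt h1⟩

theorem eventually_aestronglyMeasurable (h : OneSidedSolution F β T x₀ u Du σ L) (hc : 0 < c)
    (C R : ℝ) :
    ∀ᶠ ρ in 𝓝[>] (0 : ℝ), AEStronglyMeasurable (rescale β T x₀ u ρ)
        (volume.restrict (timeBox n σ c C R)) ∧
      ∀ k, AEStronglyMeasurable (rescaleGrad β T x₀ Du ρ k)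
        (volume.restrict (timeBox n σ c C R)) := by
  filter_upwards [h.eventually_timeBox_subset hc C R, self_mem_nhdsWithin] with ρ h1 hρ
  have hmono := Measure.restrict_mono h1 (le_refl (volume : Measure (SpaceTime n)))
  exact ⟨((aestronglyMeasurable_comp_dilation hρ h.memH1.memLp.1).mono_measure hmono).const_smul
      (ρ ^ (-β)),
    fun k => ((aestronglyMeasurable_comp_dilation hρ
      (h.memH1.memLp_grad k).1).mono_measure hmono).const_smul
        (ρ ^ (-β) * if k = 0 then ρ ^ 2 else ρ)⟩

/-- The constant `M` of the scaling estimate depends on the box only, not on the layer bound; the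
latter can thus be chosen arbitrarily small afterwards. -/
theorem tendsto_lintegral_defect (h : OneSidedSolution F β T x₀ u Du σ L) (hc : 0 < c)
    (C R : ℝ) :
    Tendsto (fun ρ => ∫⁻ z in timeBox n σ c C R, ‖homogeneityDefect β 0 0 (rescale β T x₀ u ρ)
      (rescaleGrad β T x₀ Du ρ) z‖ₑ ^ 2) (𝓝[>] (0 : ℝ)) (𝓝 0) := by
  obtain ⟨M, hM, hle⟩ := exists_lintegral_rescale_le n m h.sign hc C R β
  rw [ENNReal.tendsto_nhds_zero]
  intro δ hδ
  simp only [homogeneityDefect_rescale]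
  obtain ⟨ε, hε, hεδ⟩ : ∃ ε : ℝ, 0 < ε ∧ M * ENNReal.ofReal ε ≤ δ := by
    have hlim : Tendsto (fun ε : ℝ => M * ENNReal.ofReal ε) (𝓝[>] 0) (𝓝 0) := by
      have : Tendsto (fun ε : ℝ => M * ENNReal.ofReal ε) (𝓝 0) (𝓝 (M * ENNReal.ofReal 0)) :=
        ENNReal.Tendsto.const_mul (ENNReal.tendsto_ofReal tendsto_id) (Or.inr hM)
      rw [ENNReal.ofReal_zero, mul_zero] at this
      exact this.mono_left nhdsWithin_le_nhds
    obtain ⟨ε, h1, h2⟩ := ((ENNReal.tendsto_nhds_zero.1 hlim δ hδ).and self_mem_nhdsWithin).exists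
    exact ⟨ε, h2, h1⟩
  exact (hle T x₀ _ _ (h.eventually_layer_defect_le hε)).mono fun ρ hρ => hρ.trans hεδ

/-- The rescaled functions are bounded in `H¹` on bounded sets away from the time `0`. -/
theorem exists_rescale_bound (h : OneSidedSolution F β T x₀ u Du σ L) (hc : 0 < c) (C R : ℝ) :
    ∃ B : ℝ≥0∞, B ≠ ⊤ ∧ ∀ᶠ ρ in 𝓝[>] (0 : ℝ),
      ∫⁻ z in timeBox n σ c C R, ‖rescale β T x₀ u ρ z‖ₑ ^ 2 ≤ B ∧
      ∀ k, ∫⁻ z in timeBox n σ c C R, ‖rescaleGrad β T x₀ Du ρ k z‖ₑ ^ 2 ≤ B := by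
  obtain ⟨M, hM, hle⟩ := exists_lintegral_rescale_le n m h.sign hc C R β
  obtain ⟨M', hM', hle'⟩ := exists_lintegral_rescale_le n m h.sign hc C R (β - 1)
  obtain ⟨b, hb, hu⟩ := h.exists_layer_sq_le
  choose b' hb' hg using h.exists_layer_grad_le
  -- For the time derivative it is enough that the defect is eventually bounded; the bound `1` is
  -- arbitrary.
  have hN := ENNReal.tendsto_nhds_zero.1 (h.tendsto_lintegral_defect hc C R) 1 one_pos
  set K : ℝ := 3 * (1 + β ^ 2 + n * R ^ 2) / (4 * c ^ 2) with hK
  have hK0 : 0 ≤ K := by positivity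
  set B₀ : ℝ≥0∞ := ENNReal.ofReal K * (1 + M * b + ∑ j, M' * b' j) with hB₀
  have hB₀' : B₀ ≠ ⊤ := ENNReal.mul_ne_top ENNReal.ofReal_ne_top (ENNReal.add_ne_top.2
    ⟨ENNReal.add_ne_top.2 ⟨ENNReal.one_ne_top, ENNReal.mul_ne_top hM hb⟩,
      ENNReal.sum_ne_top.2 fun j _ => ENNReal.mul_ne_top hM' (hb' j)⟩)
  refine ⟨M * b + B₀ + ∑ j, M' * b' j, ENNReal.add_ne_top.2 ⟨ENNReal.add_ne_top.2
    ⟨ENNReal.mul_ne_top hM hb, hB₀'⟩,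
    ENNReal.sum_ne_top.2 fun j _ => ENNReal.mul_ne_top hM' (hb' j)⟩, ?_⟩
  have hgev : ∀ᶠ ρ in 𝓝[>] (0 : ℝ), ∀ j : Fin n, ∫⁻ z in timeBox n σ c C R,
      ‖ρ ^ (-(β - 1)) • Du j.succ (parabolicDilation T x₀ ρ z)‖ₑ ^ 2 ≤ M' * b' j :=
    eventually_all.2 fun j => hle' T x₀ _ _ (hg j)
  filter_upwards [hle T x₀ _ _ hu, hgev, hN, h.eventually_aestronglyMeasurable hc C R,
    self_mem_nhdsWithin] with ρ h1 h2 h3 hm hρ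
  have hρ0 : (0 : ℝ) < ρ := hρ
  simp only [← rescaleGrad_succ hρ0] at h2
  have hNm : AEStronglyMeasurable (homogeneityDefect β 0 0 (rescale β T x₀ u ρ)
      (rescaleGrad β T x₀ Du ρ)) (volume.restrict (timeBox n σ c C R)) :=
    (aestronglyMeasurable_dilationDeriv hm.2).sub (hm.1.const_smul β)
  have h0 : ∫⁻ z in timeBox n σ c C R, ‖rescaleGrad β T x₀ Du ρ 0 z‖ₑ ^ 2 ≤ B₀ := by
    calc ∫⁻ z in timeBox n σ c C R, ‖rescaleGrad β T x₀ Du ρ 0 z‖ₑ ^ 2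
        ≤ ∫⁻ z in timeBox n σ c C R, ENNReal.ofReal K *
          (‖homogeneityDefect β 0 0 (rescale β T x₀ u ρ) (rescaleGrad β T x₀ Du ρ) z‖ₑ ^ 2 +
            ‖rescale β T x₀ u ρ z‖ₑ ^ 2 +
            ∑ j : Fin n, ‖rescaleGrad β T x₀ Du ρ j.succ z‖ₑ ^ 2) := by
          refine setLIntegral_mono' measurableSet_timeBox fun z hz => ?_
          have := norm_timeDeriv_sq_le (β := β) h.sign hc hz (rescale β T x₀ u ρ)
            (rescaleGrad β T x₀ Du ρ)
          simp only [← ofReal_norm, ← ENNReal.ofReal_pow (norm_nonneg _)]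
          rw [← ENNReal.ofReal_sum_of_nonneg fun _ _ => sq_nonneg _,
            ← ENNReal.ofReal_add (sq_nonneg _) (sq_nonneg _),
            ← ENNReal.ofReal_add (by positivity) (Finset.sum_nonneg fun _ _ => sq_nonneg _),
            ← ENNReal.ofReal_mul hK0]
          exact ENNReal.ofReal_le_ofReal this
      _ = ENNReal.ofReal K * ((∫⁻ z in timeBox n σ c C R, ‖homogeneityDefect β 0 0
            (rescale β T x₀ u ρ) (rescaleGrad β T x₀ Du ρ) z‖ₑ ^ 2) +
          (∫⁻ z in timeBox n σ c C R, ‖rescale β T x₀ u ρ z‖ₑ ^ 2) +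
          ∑ j : Fin n, ∫⁻ z in timeBox n σ c C R,
            ‖rescaleGrad β T x₀ Du ρ j.succ z‖ₑ ^ 2) := by
          rw [lintegral_const_mul' _ _ ENNReal.ofReal_ne_top,
            lintegral_add_left' (f := fun z => ‖homogeneityDefect β 0 0 (rescale β T x₀ u ρ)
              (rescaleGrad β T x₀ Du ρ) z‖ₑ ^ 2 + ‖rescale β T x₀ u ρ z‖ₑ ^ 2)
              ((hNm.enorm.pow_const 2).add (hm.1.enorm.pow_const 2)),
            lintegral_add_left' (hNm.enorm.pow_const 2),
            lintegral_finsetSum' _ fun j _ => (hm.2 j.succ).enorm.pow_const 2]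
      _ ≤ B₀ := by
          refine mul_le_mul_right (add_le_add (add_le_add h3 h1) ?_) _
          exact Finset.sum_le_sum fun j _ => h2 j
  refine ⟨h1.trans ?_, fun k => ?_⟩
  · rw [add_assoc]
    exact le_self_add
  · refine Fin.cases ?_ (fun j => ?_) k
    · refine h0.trans ?_
      rw [add_right_comm]
      exact le_add_self
    · refine (h2 j).trans (le_trans ?_ le_add_self)
      exact Finset.single_le_sum (f := fun j => M' * b' j) (fun _ _ => zero_le)
        (Finset.mem_univ j)

end OneSidedSolution

/-! ### Weak gradients of rescaled functions on the two sides of time `0`. -/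

/-- The points on the side `σ` of the time `0`. -/
def sideSet (n : ℕ) (σ : ℝ) : Set (SpaceTime n) := {z | 0 < σ * z.1}

theorem isOpen_sideSet {σ : ℝ} : IsOpen (sideSet n σ) :=
  isOpen_Ioi.preimage (by fun_prop : Continuous fun z : SpaceTime n => σ * z.1)

section Rescale

variable {T ρ σ : ℝ} {x₀ : EuclideanSpace ℝ (Fin n)}

theorem pd_comp_dilation {ψ : SpaceTime n → ℝ} (hψ : ContDiff ℝ ∞ ψ) (k : Fin (n + 1))
    (z : SpaceTime n) :
    pd k (fun z => ψ (parabolicDilation T x₀ ρ z)) z =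
      (if k = 0 then ρ ^ 2 else ρ) * pd k ψ (parabolicDilation T x₀ ρ z) := by
  have h1 : HasFDerivAt (parabolicDilation T x₀ ρ)
      (((ρ ^ 2) • ContinuousLinearMap.fst ℝ ℝ (EuclideanSpace ℝ (Fin n))).prod
        (ρ • ContinuousLinearMap.snd ℝ ℝ (EuclideanSpace ℝ (Fin n)))) z := by
    refine HasFDerivAt.prodMk ?_ ?_
    · exact (((hasFDerivAt_fst (𝕜 := ℝ) (p := z)).const_mul (ρ ^ 2)).const_add T)
    · exact (((hasFDerivAt_snd (𝕜 := ℝ) (p := z)).const_smul ρ).const_add x₀)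
  have h2 := ((hψ.differentiable (by simp) (parabolicDilation T x₀ ρ z)).hasFDerivAt).comp z h1
  have h3 : pd k (fun z => ψ (parabolicDilation T x₀ ρ z)) z = _ :=
    congrArg (fun A : SpaceTime n →L[ℝ] ℝ => A (dir k)) h2.fderiv
  rw [h3, pd]
  refine Fin.cases ?_ (fun j => ?_) k
  · have e : ((ρ ^ 2, 0) : SpaceTime n) = (ρ ^ 2) • ((1, 0) : SpaceTime n) := by simp
    simp [dir]
    rw [e, map_smul, smul_eq_mul]
  · have e : ((0, ρ • EuclideanSpace.single j 1) : SpaceTime n) =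
        ρ • ((0, EuclideanSpace.single j 1) : SpaceTime n) := by simp
    simp only [dir, Fin.cons_succ, ContinuousLinearMap.comp_apply, ContinuousLinearMap.prod_apply,
      _root_.smul_apply, ContinuousLinearMap.coe_fst', ContinuousLinearMap.coe_snd',
      smul_zero, Fin.succ_ne_zero, if_false]
    rw [e, map_smul, smul_eq_mul]

theorem IsTest.comp_dilationInv {S : Set (SpaceTime n)} {φ : SpaceTime n → ℝ} (hρ : 0 < ρ)
    (hφ : IsTest (parabolicDilation T x₀ ρ ⁻¹' S) φ) :
    IsTest S fun z => φ (parabolicDilationInv T x₀ ρ z) := by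
  refine ⟨hφ.smooth.comp contDiff_parabolicDilationInv,
    hφ.compact.comp_homeomorph (dilationHomeomorph T x₀ hρ).symm, fun z hz => ?_⟩
  have h1 := hφ.subset (tsupport_comp_subset_preimage φ
    (f := parabolicDilationInv T x₀ ρ) contDiff_parabolicDilationInv.continuous hz)
  rwa [mem_preimage, parabolicDilation_dilationInv hρ] at h1

/-- Change of variables: the test function is transported by the inverse dilation, and the chain
rule factors `ρ²` in time and `ρ` in space are exactly those in `rescaleGrad`. -/
theorem HasWeakGrad.rescale {S : Set (SpaceTime n)} {u : SpaceTime n → EuclideanSpace ℝ (Fin m)}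
    {Du : Fin (n + 1) → SpaceTime n → EuclideanSpace ℝ (Fin m)} (h : HasWeakGrad S u Du)
    (hρ : 0 < ρ) (β : ℝ) :
    HasWeakGrad (parabolicDilation T x₀ ρ ⁻¹' S) (ParabolicSystem.rescale β T x₀ u ρ)
      (rescaleGrad β T x₀ Du ρ) := by
  intro k φ hφ
  have hψ := hφ.comp_dilationInv hρ
  set ψ : SpaceTime n → ℝ := fun z => φ (parabolicDilationInv T x₀ ρ z) with hψdef
  have hφψ : ∀ z, φ z = ψ (parabolicDilation T x₀ ρ z) := fun z => by
    rw [hψdef]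
    simp only
    rw [parabolicDilationInv_dilation hρ]
  have hpd : ∀ z, pd k φ z =
      (if k = 0 then ρ ^ 2 else ρ) * pd k ψ (parabolicDilation T x₀ ρ z) := fun z => by
    rw [← pd_comp_dilation hψ.smooth, ← funext hφψ]
  have e1 : ∀ z, pd k φ z • ParabolicSystem.rescale β T x₀ u ρ z =
      (ρ ^ (-β) * if k = 0 then ρ ^ 2 else ρ) •
        (fun w => pd k ψ w • u w) (parabolicDilation T x₀ ρ z) := fun z => by
    rw [hpd, rescale_eq, smul_smul, smul_smul]
    congr 1
    ring
  have e2 : ∀ z, φ z • rescaleGrad β T x₀ Du ρ k z = (ρ ^ (-β) * if k = 0 then ρ ^ 2 else ρ) •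
        (fun w => ψ w • Du k w) (parabolicDilation T x₀ ρ z) := fun z => by
    rw [hφψ, rescaleGrad, smul_comm]
  simp only [e1, e2]
  rw [integral_smul, integral_smul, setIntegral_comp_dilation hρ S fun w => pd k ψ w • u w,
    setIntegral_comp_dilation hρ S fun w => ψ w • Du k w, h k ψ hψ, smul_neg, smul_neg]

end Rescale

section Side

variable {σ : ℝ} {D S : Set (SpaceTime n)} {φ : SpaceTime n → ℝ}

/-- The support of `φ` avoids the hyperplane `t = 0`, so cutting `φ` off there produces no jump:
locally the restricted function is either `φ` or zero. A test function can therefore be split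
between the two sides. -/
theorem indicator_sideSet_eventuallyEq (hσ : σ ≠ 0) (hφ : IsTest D φ) (hD : ∀ z ∈ D, z.1 ≠ 0)
    (z : SpaceTime n) :
    (z ∈ sideSet n σ ∧ (sideSet n σ).indicator φ =ᶠ[𝓝 z] φ) ∨
      (z ∉ D ∩ sideSet n σ ∧ (sideSet n σ).indicator φ =ᶠ[𝓝 z] 0) := by
  rcases lt_trichotomy (σ * z.1) 0 with h | h | h
  · refine Or.inr ⟨fun hz => (lt_asymm h hz.2), ?_⟩
    have : {z : SpaceTime n | σ * z.1 < 0} ∈ 𝓝 z :=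
      (isOpen_Iio.preimage (by fun_prop : Continuous fun z : SpaceTime n => σ * z.1)).mem_nhds h
    filter_upwards [this] with w hw
    exact indicator_of_notMem (show w ∉ sideSet n σ from fun hw' => lt_asymm hw hw') φ
  · have hz0 : z.1 = 0 := (mul_eq_zero.1 h).resolve_left hσ
    refine Or.inr ⟨fun hz => hD z hz.1 hz0, ?_⟩
    have hzt : z ∉ tsupport φ := fun hm => hD z (hφ.subset hm) hz0
    filter_upwards [(isClosed_tsupport φ).isOpen_compl.mem_nhds hzt] with w hw
    have : φ w = 0 := image_eq_zero_of_notMem_tsupport hw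
    simp [indicator, this]
  · refine Or.inl ⟨h, ?_⟩
    filter_upwards [isOpen_sideSet.mem_nhds (show z ∈ sideSet n σ from h)] with w hw
    exact indicator_of_mem hw φ

theorem IsTest.indicator_sideSet (hσ : σ ≠ 0) (hφ : IsTest D φ) (hD : ∀ z ∈ D, z.1 ≠ 0)
    (hS : D ∩ sideSet n σ ⊆ S) : IsTest S ((sideSet n σ).indicator φ) := by
  have hts : tsupport ((sideSet n σ).indicator φ) ⊆ tsupport φ :=
    closure_mono fun z hz => by
      simp only [Function.mem_support] at hz ⊢
      exact fun h0 => hz (by simp [indicator, h0])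
  refine ⟨contDiff_iff_contDiffAt.2 fun z => ?_, hφ.compact.of_isClosed_subset
    (isClosed_tsupport _) hts, fun z hz => ?_⟩
  · rcases indicator_sideSet_eventuallyEq hσ hφ hD z with ⟨-, h⟩ | ⟨-, h⟩
    · exact hφ.smooth.contDiffAt.congr_of_eventuallyEq h
    · exact contDiffAt_const.congr_of_eventuallyEq h
  · rcases indicator_sideSet_eventuallyEq hσ hφ hD z with ⟨h1, -⟩ | ⟨-, h⟩
    · exact hS ⟨hφ.subset (hts hz), h1⟩
    · exact absurd hz (notMem_tsupport_iff_eventuallyEq.2 h)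

theorem pd_indicator_sideSet (hσ : σ ≠ 0) (hφ : IsTest D φ) (hD : ∀ z ∈ D, z.1 ≠ 0)
    (k : Fin (n + 1)) {z : SpaceTime n} (hz : z ∈ D ∩ sideSet n σ) :
    pd k ((sideSet n σ).indicator φ) z = pd k φ z := by
  rcases indicator_sideSet_eventuallyEq hσ hφ hD z with ⟨-, h⟩ | ⟨h1, -⟩
  · rw [pd, h.fderiv_eq, pd]
  · exact absurd hz h1

theorem pd_indicator_sideSet_eq_zero (hσ : σ ≠ 0) (hφ : IsTest D φ) (hD : ∀ z ∈ D, z.1 ≠ 0)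
    (k : Fin (n + 1)) {z : SpaceTime n} (hz : z ∉ D ∩ sideSet n σ) :
    pd k ((sideSet n σ).indicator φ) z = 0 := by
  refine pd_eq_zero_of_notMem_tsupport k fun hm => hz ?_
  exact (hφ.indicator_sideSet hσ hD subset_rfl).subset hm

/-- A weak gradient in a set containing one side of `D` is a weak gradient on this side of `D`. -/
theorem HasWeakGrad.integral_side {v : SpaceTime n → EuclideanSpace ℝ (Fin m)}
    {Dv : Fin (n + 1) → SpaceTime n → EuclideanSpace ℝ (Fin m)} (h : HasWeakGrad S v Dv)
    (hSm : MeasurableSet S) (hDm : MeasurableSet D) (hσ : σ ≠ 0) (hD : ∀ z ∈ D, z.1 ≠ 0)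
    (hS : D ∩ sideSet n σ ⊆ S) (k : Fin (n + 1)) (hφ : IsTest D φ) :
    ∫ z in D ∩ sideSet n σ, pd k φ z • v z = -∫ z in D ∩ sideSet n σ, φ z • Dv k z := by
  have hm : MeasurableSet (D ∩ sideSet n σ) := hDm.inter isOpen_sideSet.measurableSet
  have key := h k _ (hφ.indicator_sideSet hσ hD hS)
  rw [setIntegral_eq_of_subset_of_forall_sdiff_eq_zero hSm hS fun z hz => by
      rw [pd_indicator_sideSet_eq_zero hσ hφ hD k hz.2, zero_smul],
    setIntegral_eq_of_subset_of_forall_sdiff_eq_zero hSm hS fun z hz => by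
      rw [image_eq_zero_of_notMem_tsupport fun hm => hz.2
        ((hφ.indicator_sideSet hσ hD subset_rfl).subset hm), zero_smul]] at key
  rw [setIntegral_congr_fun hm fun z hz => by
      beta_reduce
      rw [← pd_indicator_sideSet hσ hφ hD k hz], key]
  congr 1
  refine setIntegral_congr_fun hm fun z hz => ?_
  beta_reduce
  rw [indicator_of_mem hz.2]

theorem eq_union_sides (hD : ∀ z ∈ D, z.1 ≠ 0) :
    D = (D ∩ sideSet n 1) ∪ (D ∩ sideSet n (-1)) := by
  ext z
  constructor
  · intro hz
    rcases lt_or_gt_of_ne (hD z hz) with h | h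
    · exact Or.inr ⟨hz, show 0 < -1 * z.1 by linarith⟩
    · exact Or.inl ⟨hz, show 0 < 1 * z.1 by linarith⟩
  · rintro (h | h) <;> exact h.1

theorem disjoint_sides : Disjoint (D ∩ sideSet n 1) (D ∩ sideSet n (-1)) := by
  refine disjoint_left.2 fun z h1 h2 => ?_
  have g1 : 0 < 1 * z.1 := h1.2
  have g2 : 0 < -1 * z.1 := h2.2
  linarith

theorem hasWeakGrad_of_sides {v : SpaceTime n → EuclideanSpace ℝ (Fin m)}
    {Dv : Fin (n + 1) → SpaceTime n → EuclideanSpace ℝ (Fin m)} (hDm : MeasurableSet D)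
    (hD : ∀ z ∈ D, z.1 ≠ 0) (hv : MemLp v 2 (volume.restrict D))
    (hDv : ∀ k, MemLp (Dv k) 2 (volume.restrict D))
    (h : ∀ σ : ℝ, σ = 1 ∨ σ = -1 → ∀ k φ, IsTest D φ →
      ∫ z in D ∩ sideSet n σ, pd k φ z • v z = -∫ z in D ∩ sideSet n σ, φ z • Dv k z) :
    HasWeakGrad D v Dv := by
  intro k φ hφ
  have hm : MeasurableSet (D ∩ sideSet n (-1)) := hDm.inter isOpen_sideSet.measurableSet
  have split : ∀ g : SpaceTime n → EuclideanSpace ℝ (Fin m), IntegrableOn g D →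
      ∫ z in D, g z = (∫ z in D ∩ sideSet n 1, g z) + ∫ z in D ∩ sideSet n (-1), g z :=
    fun g hg => by
      rw [← setIntegral_union disjoint_sides hm (hg.mono_set inter_subset_left)
        (hg.mono_set inter_subset_left), ← eq_union_sides hD]
  rw [split _ (integrable_smul_of_memLp (hφ.memLp_pd k) hv),
    split _ (integrable_smul_of_memLp hφ.memLp (hDv k)), h 1 (Or.inl rfl) k φ hφ,
    h (-1) (Or.inr rfl) k φ hφ, neg_add]

end Side

/-! ### Boundedness in `H¹`. -/

section H1

variable {D : Set (SpaceTime n)}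

theorem memLp_two_of_lintegral_le {α : Type*} {mα : MeasurableSpace α} {ν : Measure α}
    {f : α → EuclideanSpace ℝ (Fin m)} (hf : AEStronglyMeasurable f ν) {B : ℝ≥0∞} (hB : B ≠ ⊤)
    (h : ∫⁻ z, ‖f z‖ₑ ^ 2 ∂ν ≤ B) : ∃ hm : MemLp f 2 ν, ‖hm.toLp f‖ ^ 2 ≤ B.toReal := by
  have h2 : eLpNorm f 2 ν ^ 2 = ∫⁻ x, ‖f x‖ₑ ^ 2 ∂ν := by
    have := eLpNorm_nnreal_pow_eq_lintegral (f := f) (μ := ν) (p := 2) (by norm_num)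
    simpa using this
  rw [← h2] at h
  have hlt : eLpNorm f 2 ν < ⊤ := by
    have := h.trans_lt hB.lt_top
    simpa using ENNReal.pow_lt_top_iff.1 this
  have hm : MemLp f 2 ν := ⟨hf, hlt⟩
  refine ⟨hm, ?_⟩
  rw [Lp.norm_toLp, ← ENNReal.toReal_pow]
  exact ENNReal.toReal_mono hB h

theorem exists_H1_of_memLp {v : SpaceTime n → EuclideanSpace ℝ (Fin m)}
    {Dv : Fin (n + 1) → SpaceTime n → EuclideanSpace ℝ (Fin m)}
    (hw : HasWeakGrad D v Dv) {b : ℝ} (hv : MemLp v 2 (volume.restrict D))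
    (hvb : ‖hv.toLp v‖ ^ 2 ≤ b) (hDv : ∀ k, MemLp (Dv k) 2 (volume.restrict D))
    (hDvb : ∀ k, ‖(hDv k).toLp (Dv k)‖ ^ 2 ≤ b) :
    ∃ w : H1 D m, Represents w v ∧ ‖w‖ ≤ √((n + 2) * b) := by
  let p : PiLp 2 fun _ : Fin (n + 2) => Lp (EuclideanSpace ℝ (Fin m)) 2 (volume.restrict D) :=
    WithLp.toLp 2 (Fin.cons (hv.toLp v) fun k => (hDv k).toLp (Dv k))
  have h0 : p 0 = hv.toLp v := rfl
  have hs : ∀ k : Fin (n + 1), p k.succ = (hDv k).toLp (Dv k) := fun k => rfl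
  have hp : p ∈ H1 D m := by
    intro k φ hφ
    beta_reduce
    rw [h0, hs]
    have e1 : ∫ z in D, pd k φ z • hv.toLp v z = ∫ z in D, pd k φ z • v z :=
      integral_congr_ae (by filter_upwards [hv.coeFn_toLp] with z hz; rw [hz])
    have e2 : ∫ z in D, φ z • (hDv k).toLp (Dv k) z = ∫ z in D, φ z • Dv k z :=
      integral_congr_ae (by filter_upwards [(hDv k).coeFn_toLp] with z hz; rw [hz])
    rw [e1, e2]
    exact hw k φ hφ
  refine ⟨⟨p, hp⟩, hv.coeFn_toLp, ?_⟩
  change ‖p‖ ≤ _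
  rw [PiLp.norm_eq_of_L2]
  refine Real.sqrt_le_sqrt ?_
  have : ∀ i : Fin (n + 2), ‖p i‖ ^ 2 ≤ b := fun i => by
    refine Fin.cases hvb (fun k => ?_) i
    rw [hs]
    exact hDvb k
  -- There are `n + 2` components: the function, its time derivative and its `n` space derivatives.
  refine (Finset.sum_le_card_nsmul _ _ b fun i _ => this i).trans (le_of_eq ?_)
  simp

end H1

section Cover

variable {t₁ t₂ T : ℝ} {D : Set (SpaceTime n)}

theorem ne_zero_of_mem_limitDomain {z : SpaceTime n} (hz : z ∈ limitDomain n t₁ t₂ T) :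
    z.1 ≠ 0 := by
  rcases hz with h | h
  · exact h.2.ne
  · exact h.2.ne'

theorem exists_subset_timeBox (hD : IsCompact D) (h0 : ∀ z ∈ D, z.1 ≠ 0) :
    ∃ c C R : ℝ, 0 < c ∧ ∀ σ : ℝ, σ = 1 ∨ σ = -1 → D ∩ sideSet n σ ⊆ timeBox n σ c C R := by
  rcases D.eq_empty_or_nonempty with rfl | hne
  · exact ⟨1, 1, 1, one_pos, by simp⟩
  obtain ⟨z₀, hz₀, hmin⟩ := hD.exists_isMinOn hne (f := fun z : SpaceTime n => |z.1|)
    (by fun_prop)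
  obtain ⟨z₁, hz₁, hmax⟩ := hD.exists_isMaxOn hne (f := fun z : SpaceTime n => |z.1|)
    (by fun_prop)
  obtain ⟨z₂, hz₂, hR⟩ := hD.exists_isMaxOn hne (f := fun z : SpaceTime n => ‖z.2‖)
    continuous_snd.norm.continuousOn
  refine ⟨|z₀.1|, |z₁.1|, ‖z₂.2‖, abs_pos.2 (h0 z₀ hz₀), fun σ hσ z hz => ?_⟩
  have e : σ * z.1 = |z.1| := by
    rw [← abs_of_pos (show 0 < σ * z.1 from hz.2), abs_mul]
    rcases hσ with rfl | rfl <;> simp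
  refine ⟨?_, hR hz.1⟩
  rw [e]
  exact ⟨hmin hz.1, hmax hz.1⟩

variable {F : EuclideanSpace ℝ (Fin m) → ℝ} {β : ℝ} {x₀ : EuclideanSpace ℝ (Fin n)}
  {u : SpaceTime n → EuclideanSpace ℝ (Fin m)}
  {Du : Fin (n + 1) → SpaceTime n → EuclideanSpace ℝ (Fin m)}

/-- On the two sides of the time `T` where `limitDomain` is nonempty, `u` is a solution. -/
def TwoSidedSolution (F : EuclideanSpace ℝ (Fin m) → ℝ) (β t₁ t₂ T : ℝ)
    (x₀ : EuclideanSpace ℝ (Fin n)) (u : SpaceTime n → EuclideanSpace ℝ (Fin m))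
    (Du : Fin (n + 1) → SpaceTime n → EuclideanSpace ℝ (Fin m)) : Prop :=
  ∀ σ : ℝ, σ = 1 ∨ σ = -1 →
    (sideSet n σ ⊆ limitDomain n t₁ t₂ T ∧ ∃ L, OneSidedSolution F β T x₀ u Du σ L) ∨
      limitDomain n t₁ t₂ T ∩ sideSet n σ = ∅

theorem TwoSidedSolution.exists_side_bound (h : TwoSidedSolution F β t₁ t₂ T x₀ u Du)
    (hD : CompactlyInside D (limitDomain n t₁ t₂ T)) {σ : ℝ} (hσ : σ = 1 ∨ σ = -1) :
    ∃ B : ℝ≥0∞, B ≠ ⊤ ∧ ∀ᶠ ρ in 𝓝[>] (0 : ℝ),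
      (AEStronglyMeasurable (rescale β T x₀ u ρ) (volume.restrict (D ∩ sideSet n σ)) ∧
        ∫⁻ z in D ∩ sideSet n σ, ‖rescale β T x₀ u ρ z‖ₑ ^ 2 ≤ B) ∧
      (∀ k, AEStronglyMeasurable (rescaleGrad β T x₀ Du ρ k)
          (volume.restrict (D ∩ sideSet n σ)) ∧
        ∫⁻ z in D ∩ sideSet n σ, ‖rescaleGrad β T x₀ Du ρ k z‖ₑ ^ 2 ≤ B) ∧
      ∀ k φ, IsTest D φ → ∫ z in D ∩ sideSet n σ, pd k φ z • rescale β T x₀ u ρ z =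
        -∫ z in D ∩ sideSet n σ, φ z • rescaleGrad β T x₀ Du ρ k z := by
  have hDU : D ⊆ limitDomain n t₁ t₂ T := subset_closure.trans hD.2.2
  rcases h σ hσ with ⟨-, L, hL⟩ | he
  · obtain ⟨c, C, R, hc, hbox⟩ := exists_subset_timeBox hD.2.1
      fun z hz => ne_zero_of_mem_limitDomain (hD.2.2 hz)
    have hsub : D ∩ sideSet n σ ⊆ timeBox n σ c C R :=
      (inter_subset_inter_left _ subset_closure).trans (hbox σ hσ)
    have hmono := Measure.restrict_mono hsub (le_refl (volume : Measure (SpaceTime n)))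
    obtain ⟨B, hB, hev⟩ := hL.exists_rescale_bound hc C R
    refine ⟨B, hB, ?_⟩
    filter_upwards [hev, hL.eventually_aestronglyMeasurable hc C R,
      hL.eventually_timeBox_subset hc C R, self_mem_nhdsWithin] with ρ h1 h2 h3 hρ
    refine ⟨⟨h2.1.mono_measure hmono, (lintegral_mono_set hsub).trans h1.1⟩,
      fun k => ⟨(h2.2 k).mono_measure hmono, (lintegral_mono_set hsub).trans (h1.2 k)⟩,
      fun k φ hφ => ?_⟩
    exact (hL.memH1.weakGrad.rescale hρ β).integral_side
      (measurableSet_slab.preimage contDiff_parabolicDilation.continuous.measurable)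
      hD.1.measurableSet (by rcases hσ with rfl | rfl <;> norm_num)
      (fun z hz => ne_zero_of_mem_limitDomain (hDU hz)) (hsub.trans h3) k hφ
  · have hem : D ∩ sideSet n σ = ∅ :=
      subset_empty_iff.1 ((inter_subset_inter_left _ hDU).trans he.le)
    refine ⟨0, by simp, Eventually.of_forall fun ρ => ?_⟩
    simp [hem]

/-- A set compactly inside the limit domain stays away from `t = 0` and splits into its two sides.
The one-sided bounds add up, and so do the one-sided weak derivative formulas. -/
theorem TwoSidedSolution.eventuallyBoundedH1 (h : TwoSidedSolution F β t₁ t₂ T x₀ u Du)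
    (hD : CompactlyInside D (limitDomain n t₁ t₂ T)) {ρ : ℕ → ℝ} (hρ : ∀ k, 0 < ρ k)
    (hρ0 : Tendsto ρ atTop (𝓝 0)) : EventuallyBoundedH1 D fun k => rescale β T x₀ u (ρ k) := by
  have hρ' : Tendsto ρ atTop (𝓝[>] 0) :=
    tendsto_nhdsWithin_iff.2 ⟨hρ0, Eventually.of_forall hρ⟩
  have hD0 : ∀ z ∈ D, z.1 ≠ 0 := fun z hz =>
    ne_zero_of_mem_limitDomain (hD.2.2 (subset_closure hz))
  obtain ⟨B, hB, h1⟩ := h.exists_side_bound hD (Or.inl rfl : (1 : ℝ) = 1 ∨ (1 : ℝ) = -1)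
  obtain ⟨B', hB', h2⟩ := h.exists_side_bound hD (Or.inr rfl : (-1 : ℝ) = 1 ∨ (-1 : ℝ) = -1)
  obtain ⟨k₀, hk₀⟩ := eventually_atTop.1 ((hρ'.eventually h1).and (hρ'.eventually h2))
  refine ⟨k₀, √((n + 2) * (B + B').toReal), fun k hk => ?_⟩
  obtain ⟨⟨a1, a2, a3⟩, b1, b2, b3⟩ := hk₀ k hk
  have hfin : B + B' ≠ ⊤ := ENNReal.add_ne_top.2 ⟨hB, hB'⟩
  have glue : ∀ f : SpaceTime n → EuclideanSpace ℝ (Fin m),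
      (AEStronglyMeasurable f (volume.restrict (D ∩ sideSet n 1)) ∧
        ∫⁻ z in D ∩ sideSet n 1, ‖f z‖ₑ ^ 2 ≤ B) →
      (AEStronglyMeasurable f (volume.restrict (D ∩ sideSet n (-1))) ∧
        ∫⁻ z in D ∩ sideSet n (-1), ‖f z‖ₑ ^ 2 ≤ B') →
      ∃ hm : MemLp f 2 (volume.restrict D), ‖hm.toLp f‖ ^ 2 ≤ (B + B').toReal :=
    fun f hf hf' => by
      refine memLp_two_of_lintegral_le ?_ hfin ?_
      · rw [eq_union_sides hD0]
        exact aestronglyMeasurable_union_iff.2 ⟨hf.1, hf'.1⟩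
      · rw [eq_union_sides hD0]
        exact (lintegral_union_le _ _ _).trans (add_le_add hf.2 hf'.2)
  obtain ⟨hv, hvb⟩ := glue _ a1 b1
  choose hDv hDvb using fun k => glue _ (a2 k) (b2 k)
  refine exists_H1_of_memLp (hasWeakGrad_of_sides hD.1.measurableSet hD0 hv hDv ?_) hv hvb hDv hDvb
  rintro σ (rfl | rfl)
  · exact a3
  · exact b3

end Cover

/-! ### Homogeneity of blow-up limits. -/

/-- The derivative `2t ∂_t χ + x · ∇χ` of a function along the parabolic dilations. -/
def euler (χ : SpaceTime n → ℝ) (z : SpaceTime n) : ℝ := ∑ k, dilationField 0 0 k z * pd k χ z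

section Euler

variable {χ : SpaceTime n → ℝ}

theorem sum_dilationField_smul_dir (z : SpaceTime n) :
    ∑ k, dilationField 0 0 k z • dir k = (2 * z.1, z.2) := by
  rw [Fin.sum_univ_succ]
  refine Prod.ext ?_ ?_
  · simp [dir, Prod.fst_sum]
  · ext i
    simp [dir, Prod.snd_sum, Finset.sum_apply, Pi.single_apply]

theorem euler_eq (χ : SpaceTime n → ℝ) (z : SpaceTime n) :
    euler χ z = fderiv ℝ χ z (2 * z.1, z.2) := by
  rw [← sum_dilationField_smul_dir, map_sum, euler]
  exact Finset.sum_congr rfl fun k _ => by rw [map_smul, smul_eq_mul, pd]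

theorem continuous_euler (hχ : ContDiff ℝ ∞ χ) : Continuous (euler χ) :=
  continuous_finsetSum _ fun k _ =>
    (contDiff_dilationField 0 0 k).continuous.mul (contDiff_pd hχ k).continuous

theorem hasCompactSupport_euler (hc : HasCompactSupport χ) : HasCompactSupport (euler χ) := by
  refine hc.mono' fun z hz => ?_
  by_contra hn
  refine hz ?_
  rw [euler]
  exact Finset.sum_eq_zero fun k _ => by rw [pd_eq_zero_of_notMem_tsupport k hn, mul_zero]

theorem euler_comp_dilation (hχ : ContDiff ℝ ∞ χ) (l : ℝ) (z : SpaceTime n) :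
    euler (fun z => χ (parabolicDilation 0 0 l z)) z = euler χ (parabolicDilation 0 0 l z) := by
  refine Finset.sum_congr rfl fun k _ => ?_
  rw [pd_comp_dilation hχ, ← mul_assoc]
  congr 1
  refine Fin.cases ?_ (fun j => ?_) k
  · simp [parabolicDilation]
    ring
  · simp [parabolicDilation, Fin.succ_ne_zero]
    ring

/-- The velocity of the curve of dilations of `z` at parameter `l` is `l⁻¹` times the dilation field
at the dilated point, which produces the Euler derivative. -/
theorem hasDerivAt_comp_dilation (hχ : ContDiff ℝ ∞ χ) {l : ℝ} (hl : 0 < l) (p : ℝ)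
    (z : SpaceTime n) :
    HasDerivAt (fun l => l ^ p * χ (parabolicDilation 0 0 l z))
      (l ^ (p - 1) * (p * χ (parabolicDilation 0 0 l z) + euler χ (parabolicDilation 0 0 l z)))
      l := by
  have h1 : HasDerivAt (fun l : ℝ => parabolicDilation 0 0 l z)
      (2 * l * z.1, z.2) l := by
    refine HasDerivAt.prodMk ?_ ?_
    · have := ((hasDerivAt_pow 2 l).mul_const z.1).const_add 0
      simpa using this
    · have := ((hasDerivAt_id l).smul_const z.2).const_add 0
      simpa using this
  have h2 := ((hχ.differentiable (by simp) (parabolicDilation 0 0 l z)).hasFDerivAt).comp_hasDerivAt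
    l h1
  have h3 := (Real.hasDerivAt_rpow_const (p := p) (Or.inl hl.ne')).mul h2
  refine h3.congr_deriv ?_
  have e : ((2 * l * z.1, z.2) : SpaceTime n) = l⁻¹ • (2 * (parabolicDilation 0 0 l z).1,
      (parabolicDilation 0 0 l z).2) := by
    refine Prod.ext ?_ ?_
    · simp [parabolicDilation]
      field_simp
    · simp [parabolicDilation, smul_smul, hl.ne']
  rw [e, map_smul, ← euler_eq, Real.rpow_sub hl, Real.rpow_one, smul_eq_mul]
  simp only [Function.comp]
  field_simp

theorem IsTest.comp_dilation {S : Set (SpaceTime n)} (hχ : IsTest S χ) {l : ℝ} (hl : 0 < l) :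
    IsTest (parabolicDilation 0 0 l ⁻¹' S) fun z => χ (parabolicDilation 0 0 l z) :=
  ⟨hχ.smooth.comp contDiff_parabolicDilation,
    hχ.compact.comp_homeomorph (dilationHomeomorph 0 0 hl), fun _ hz =>
    hχ.subset (tsupport_comp_subset_preimage χ contDiff_parabolicDilation.continuous hz)⟩

end Euler

section Defect

variable {χ : SpaceTime n → ℝ} {S K : Set (SpaceTime n)} {β : ℝ}
  {v : SpaceTime n → EuclideanSpace ℝ (Fin m)}
  {Dv : Fin (n + 1) → SpaceTime n → EuclideanSpace ℝ (Fin m)}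

/-- The formal adjoint of the Euler derivative is minus itself minus the divergence `n + 2`;
together with the term `-βv` of the defect this gives the coefficient `β + n + 2`. -/
theorem integral_test_defect (hw : HasWeakGrad S v Dv) (hS : MeasurableSet S) (hKS : K ⊆ S)
    (hv : MemLp v 2 (volume.restrict K)) (hDv : ∀ k, MemLp (Dv k) 2 (volume.restrict K))
    (hχ : IsTest K χ) :
    ∫ z in K, ((β + n + 2) * χ z + euler χ z) • v z =
      -∫ z in K, χ z • homogeneityDefect β 0 0 v Dv z := by
  have hθ : ∀ k, IsTest K fun z => χ z * dilationField 0 0 k z := fun k =>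
    hχ.mul (contDiff_dilationField 0 0 k)
  have key : ∀ k, ∫ z in K, pd k (fun z => χ z * dilationField 0 0 k z) z • v z =
      -∫ z in K, (χ z * dilationField 0 0 k z) • Dv k z := fun k => by
    have h1 := hw k _ (⟨(hθ k).smooth, (hθ k).compact, (hθ k).subset.trans hKS⟩ : IsTest S _)
    rwa [setIntegral_eq_of_subset_of_forall_sdiff_eq_zero hS hKS fun z hz => by
        rw [pd_eq_zero_of_notMem_tsupport k fun hm => hz.2 ((hθ k).subset hm), zero_smul],
      setIntegral_eq_of_subset_of_forall_sdiff_eq_zero hS hKS fun z hz => by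
        rw [image_eq_zero_of_notMem_tsupport (f := fun z => χ z * dilationField 0 0 k z)
          fun hm => hz.2 ((hθ k).subset hm), zero_smul]] at h1
  have i1 : ∀ k, IntegrableOn (fun z => pd k (fun z => χ z * dilationField 0 0 k z) z • v z) K :=
    fun k => integrable_smul_of_memLp ((hθ k).memLp_pd k) hv
  have i2 : ∀ k, IntegrableOn (fun z => (χ z * dilationField 0 0 k z) • Dv k z) K :=
    fun k => integrable_smul_of_memLp (hθ k).memLp (hDv k)
  have i3 : IntegrableOn (fun z => χ z • v z) K := integrable_smul_of_memLp hχ.memLp hv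
  have e1 : ∀ z, ((β + n + 2) * χ z + euler χ z) • v z =
      (∑ k, pd k (fun z => χ z * dilationField 0 0 k z) z • v z) + β • (χ z • v z) := fun z => by
    rw [← Finset.sum_smul, smul_smul, ← add_smul]
    congr 1
    simp only [pd_mul hχ.smooth (contDiff_dilationField 0 0 _), Finset.sum_add_distrib,
      ← Finset.mul_sum]
    rw [sum_pd_dilationField, euler]
    simp only [mul_comm (pd _ χ z)]
    ring
  have e2 : ∀ z, χ z • homogeneityDefect β 0 0 v Dv z =
      (∑ k, (χ z * dilationField 0 0 k z) • Dv k z) - β • (χ z • v z) := fun z => by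
    rw [homogeneityDefect, dilationDeriv, smul_sub, Finset.smul_sum, smul_comm β]
    simp only [smul_smul]
  have i4 : IntegrableOn (fun z => β • (χ z • v z)) K := i3.smul β
  simp only [e1, e2]
  rw [integral_add (integrable_finsetSum _ fun k _ => i1 k) i4,
    integral_sub (integrable_finsetSum _ fun k _ => i2 k) i4,
    integral_finsetSum _ fun k _ => i1 k, integral_finsetSum _ fun k _ => i2 k]
  simp only [key, Finset.sum_neg_distrib]
  abel

theorem hasDerivAt_integral_dilation (hK : volume K ≠ ⊤) (hv : MemLp v 2 (volume.restrict K))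
    (hχ : ContDiff ℝ ∞ χ) (hc : HasCompactSupport χ) (p : ℝ) {l : ℝ} (hl : 0 < l) :
    HasDerivAt (fun l => ∫ z in K, (l ^ p * χ (parabolicDilation 0 0 l z)) • v z)
      (∫ z in K, (l ^ (p - 1) * (p * χ (parabolicDilation 0 0 l z) +
        euler χ (parabolicDilation 0 0 l z))) • v z) l := by
  have : IsFiniteMeasure (volume.restrict K) := ⟨by simpa using hK.lt_top⟩
  have hvi : Integrable v (volume.restrict K) := hv.integrable (by norm_num)
  obtain ⟨M, hM⟩ := hc.exists_bound_of_continuous hχ.continuous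
  obtain ⟨M', hM'⟩ := (hasCompactSupport_euler hc).exists_bound_of_continuous (continuous_euler hχ)
  have hpos : ∀ x ∈ Icc (l / 2) (2 * l), 0 < x := fun x hx => lt_of_lt_of_le (by linarith) hx.1
  obtain ⟨P, hP⟩ := (isCompact_Icc (a := l / 2) (b := 2 * l)).exists_bound_of_continuousOn
    (f := fun x : ℝ => x ^ (p - 1))
    (continuousOn_id.rpow_const fun x hx => Or.inl (hpos x hx).ne')
  have hcd : ∀ x : ℝ, Continuous (parabolicDilation (n := n) 0 0 x) := fun x =>
    contDiff_parabolicDilation.continuous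
  have hFm : ∀ x : ℝ, AEStronglyMeasurable (fun z => (x ^ p * χ (parabolicDilation 0 0 x z)) • v z)
      (volume.restrict K) := fun x =>
    (continuous_const.mul (hχ.continuous.comp (hcd x))).aestronglyMeasurable.smul hv.1
  refine (hasDerivAt_integral_of_dominated_loc_of_deriv_le (μ := volume.restrict K)
    (F := fun l z => (l ^ p * χ (parabolicDilation 0 0 l z)) • v z)
    (F' := fun l z => (l ^ (p - 1) * (p * χ (parabolicDilation 0 0 l z) +
      euler χ (parabolicDilation 0 0 l z))) • v z)
    (bound := fun z => P * (|p| * M + M') * ‖v z‖)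
    (Ioo_mem_nhds (by linarith : l / 2 < l) (by linarith : l < 2 * l))
    (Eventually.of_forall hFm) ?_ ?_ ?_ (hvi.norm.const_mul _) ?_).2
  · refine Integrable.mono' (hvi.norm.const_mul (l ^ p * M)) (hFm l) (Eventually.of_forall fun z => ?_)
    rw [norm_smul, norm_mul, Real.norm_of_nonneg (Real.rpow_nonneg hl.le p)]
    exact mul_le_mul_of_nonneg_right (mul_le_mul_of_nonneg_left (hM _)
      (Real.rpow_nonneg hl.le p)) (norm_nonneg _)
  · exact (continuous_const.mul ((continuous_const.mul (hχ.continuous.comp (hcd l))).add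
      ((continuous_euler hχ).comp (hcd l)))).aestronglyMeasurable.smul hv.1
  · refine Eventually.of_forall fun z x hx => ?_
    rw [norm_smul, norm_mul]
    refine mul_le_mul_of_nonneg_right (mul_le_mul (hP x (Ioo_subset_Icc_self hx)) ?_
      (norm_nonneg _) ((norm_nonneg _).trans (hP x (Ioo_subset_Icc_self hx)))) (norm_nonneg _)
    refine (norm_add_le _ _).trans (add_le_add ?_ (hM' _))
    rw [norm_mul, Real.norm_eq_abs]
    exact mul_le_mul_of_nonneg_left (hM _) (abs_nonneg _)
  · exact Eventually.of_forall fun z x hx =>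
      (hasDerivAt_comp_dilation hχ (hpos x (Ioo_subset_Icc_self hx)) p z).smul_const (v z)

/-- The scaled averages of `v` vary slowly if the homogeneity defect is small. -/
theorem norm_integral_dilation_sub_le (hw : HasWeakGrad S v Dv) (hS : MeasurableSet S)
    (hKS : K ⊆ S) (hK : volume K ≠ ⊤) (hv : MemLp v 2 (volume.restrict K))
    (hDv : ∀ k, MemLp (Dv k) 2 (volume.restrict K))
    (hNi : IntegrableOn (homogeneityDefect β 0 0 v Dv) K) (hχ : ContDiff ℝ ∞ χ)
    (hc : HasCompactSupport χ) {a b P M : ℝ} (ha : 0 < a)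
    (hχK : ∀ l ∈ Icc a b, IsTest K fun z => χ (parabolicDilation 0 0 l z))
    (hP : ∀ l ∈ Icc a b, l ^ (β + n + 2 - 1) ≤ P) (hM : ∀ z, ‖χ z‖ ≤ M) {x y : ℝ}
    (hx : x ∈ Icc a b) (hy : y ∈ Icc a b) :
    ‖(∫ z in K, (y ^ (β + n + 2) * χ (parabolicDilation 0 0 y z)) • v z) -
        ∫ z in K, (x ^ (β + n + 2) * χ (parabolicDilation 0 0 x z)) • v z‖ ≤
      P * (M * ∫ z in K, ‖homogeneityDefect β 0 0 v Dv z‖) * ‖y - x‖ := by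
  refine Convex.norm_image_sub_le_of_norm_hasDerivWithin_le (s := Icc a b)
    (f := fun l => ∫ z in K, (l ^ (β + n + 2) * χ (parabolicDilation 0 0 l z)) • v z)
    (fun l hl => (hasDerivAt_integral_dilation hK hv hχ hc _
      (ha.trans_le hl.1)).hasDerivWithinAt) (fun l hl => ?_) (convex_Icc a b) hx hy
  have hl0 : 0 < l := ha.trans_le hl.1
  -- With the power `p = β + n + 2` the `l`-derivative is exactly a pairing with the defect, so the
  -- mean value inequality yields the claim.
  have h1 := integral_test_defect (β := β) hw hS hKS hv hDv (hχK l hl)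
  simp only [mul_smul]
  rw [integral_smul]
  simp only [euler_comp_dilation hχ] at h1
  rw [h1, norm_smul, norm_neg, Real.norm_of_nonneg (Real.rpow_nonneg hl0.le _)]
  refine mul_le_mul (hP l hl) ?_ (norm_nonneg _)
    ((Real.rpow_nonneg hl0.le _).trans (hP l hl))
  refine (norm_integral_le_integral_norm _).trans ?_
  rw [← integral_const_mul]
  refine integral_mono_of_nonneg (Eventually.of_forall fun z => norm_nonneg _)
    (hNi.norm.const_mul M) (Eventually.of_forall fun z => ?_)
  simp only [norm_smul]
  exact mul_le_mul_of_nonneg_right (hM _) (norm_nonneg _)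

end Defect

/-- Cauchy-Schwarz on a finite measure space bounds the `L¹` norm by the `L²` norm. -/
theorem tendsto_integral_norm_zero {α ι : Type*} {mα : MeasurableSpace α} {ν : Measure α}
    [IsFiniteMeasure ν] {l : Filter ι} {f : ι → α → EuclideanSpace ℝ (Fin m)}
    (hf : ∀ᶠ k in l, AEStronglyMeasurable (f k) ν)
    (h : Tendsto (fun k => ∫⁻ z, ‖f k z‖ₑ ^ 2 ∂ν) l (𝓝 0)) :
    (∀ᶠ k in l, Integrable (f k) ν) ∧ Tendsto (fun k => ∫ z, ‖f k z‖ ∂ν) l (𝓝 0) := by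
  have hle : ∀ᶠ k in l, ∫⁻ z, ‖f k z‖ₑ ∂ν ≤
      (∫⁻ z, ‖f k z‖ₑ ^ 2 ∂ν) ^ (1 / 2 : ℝ) * ν univ ^ (1 / 2 : ℝ) := by
    filter_upwards [hf] with k hk
    have h1 := eLpNorm_le_eLpNorm_mul_rpow_measure_univ (p := 1) (q := 2) (by norm_num) hk
    rw [eLpNorm_one_eq_lintegral_enorm, eLpNorm_eq_lintegral_rpow_enorm_toReal (by norm_num)
      (by norm_num)] at h1
    norm_num at h1 ⊢
    exact h1
  have hlim : Tendsto (fun k => (∫⁻ z, ‖f k z‖ₑ ^ 2 ∂ν) ^ (1 / 2 : ℝ) * ν univ ^ (1 / 2 : ℝ)) l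
      (𝓝 0) := by
    have h1 := (ENNReal.continuous_rpow_const (y := (1 / 2 : ℝ))).tendsto 0 |>.comp h
    have h2 := ENNReal.Tendsto.mul_const (b := ν univ ^ (1 / 2 : ℝ)) h1
      (Or.inr (ENNReal.rpow_ne_top_of_nonneg (by norm_num) (measure_ne_top ν univ)))
    simpa using h2
  have hlim2 : Tendsto (fun k => ∫⁻ z, ‖f k z‖ₑ ∂ν) l (𝓝 0) :=
    tendsto_of_tendsto_of_tendsto_of_le_of_le' tendsto_const_nhds hlim
      (Eventually.of_forall fun _ => zero_le) hle
  refine ⟨?_, ?_⟩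
  · filter_upwards [hf, hlim2.eventually_lt_const ENNReal.zero_lt_top] with k h1 h2
    exact ⟨h1, h2⟩
  · have h3 := (ENNReal.tendsto_toReal ENNReal.zero_ne_top).comp hlim2
    rw [ENNReal.toReal_zero] at h3
    refine h3.congr' ?_
    filter_upwards [hf] with k hk
    exact (integral_norm_eq_lintegral_enorm hk).symm

theorem isCompact_timeBox {σ c C R : ℝ} (hσ : σ = 1 ∨ σ = -1) (hc : 0 < c) :
    IsCompact (timeBox n σ c C R) := by
  refine ((isCompact_Icc (a := -C) (b := C)).prod (isCompact_closedBall
    (0 : EuclideanSpace ℝ (Fin n)) R)).of_isClosed_subset isClosed_timeBox fun z hz => ?_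
  obtain ⟨⟨h1, h2⟩, h3⟩ := hz
  refine ⟨?_, by simpa using h3⟩
  rcases hσ with rfl | rfl <;> constructor <;> linarith

theorem timeBox_subset_sideSet {σ c C R : ℝ} (hc : 0 < c) :
    timeBox n σ c C R ⊆ sideSet n σ := fun _ hz => hc.trans_le hz.1.1

/-- Weak convergence in `H¹` implies convergence of the integrals against test functions. -/
theorem WeaklyConvergesH1.tendsto_integral {D : Set (SpaceTime n)}
    {v : ℕ → SpaceTime n → EuclideanSpace ℝ (Fin m)} {v₀ : SpaceTime n → EuclideanSpace ℝ (Fin m)}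
    (h : WeaklyConvergesH1 D v v₀) {ψ : SpaceTime n → ℝ} (hψ : IsTest D ψ)
    (e : EuclideanSpace ℝ (Fin m)) :
    Tendsto (fun k => ⟪e, ∫ z in D, ψ z • v k z⟫) atTop (𝓝 ⟪e, ∫ z in D, ψ z • v₀ z⟫) := by
  obtain ⟨w, w₀, hw, hw₀, hL⟩ := h
  have hψe : MemLp (fun z => ψ z • e) 2 (volume.restrict D) := by
    have hc : Continuous fun z => ψ z • e := hψ.smooth.continuous.smul continuous_const
    exact (hc.memLp_of_hasCompactSupport (hψ.compact.smul_right)).restrict D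
  -- Pairing the function component with `ψ e` in `L²` is a continuous functional on `H¹`; no
  -- derivative is involved.
  let Λ : StrongDual ℝ (H1 D m) := (innerSL ℝ (hψe.toLp _)).comp
    ((PiLp.proj 2 (fun _ : Fin (n + 2) =>
      Lp (EuclideanSpace ℝ (Fin m)) 2 (volume.restrict D)) 0).comp (H1 D m).subtypeL)
  have hΛ : ∀ (w : H1 D m) (v : SpaceTime n → EuclideanSpace ℝ (Fin m)), Represents w v →
      Λ w = ⟪e, ∫ z in D, ψ z • v z⟫ := fun w v hv => by
    have hmem : MemLp v 2 (volume.restrict D) := (memLp_congr_ae hv).1 (Lp.memLp _)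
    rw [← integral_inner (integrable_smul_of_memLp hψ.memLp hmem)]
    change ⟪hψe.toLp _, w.1 0⟫ = _
    rw [L2.inner_def]
    refine integral_congr_ae ?_
    filter_upwards [hψe.coeFn_toLp, hv] with z h1 h2
    rw [h1, h2, real_inner_smul_left, real_inner_smul_right]
  rw [← hΛ w₀ v₀ hw₀]
  refine (hL Λ).congr' ?_
  filter_upwards [hw] with k hk using hΛ _ _ hk

namespace OneSidedSolution

variable {F : EuclideanSpace ℝ (Fin m) → ℝ} {β T σ L : ℝ} {x₀ : EuclideanSpace ℝ (Fin n)}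
  {u u₀ : SpaceTime n → EuclideanSpace ℝ (Fin m)}
  {Du : Fin (n + 1) → SpaceTime n → EuclideanSpace ℝ (Fin m)}

/-- Blow-up limits are homogeneous in the sense of distributions. -/
theorem integral_dilation_eq (h : OneSidedSolution F β T x₀ u Du σ L) {ρ : ℕ → ℝ}
    (hρ : Tendsto ρ atTop (𝓝[>] 0))
    (hconv : ∀ D : Set (SpaceTime n), CompactlyInside D (sideSet n σ) →
      WeaklyConvergesH1 D (fun k => rescale β T x₀ u (ρ k)) u₀)
    {χ : SpaceTime n → ℝ} (hχ : IsTest (sideSet n σ) χ) {l : ℝ} (hl : 0 < l) :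
    ∫ z, (l ^ (β + n + 2) * χ (parabolicDilation 0 0 l z)) • u₀ z = ∫ z, χ z • u₀ z := by
  have hσ0 : σ ≠ 0 := by rcases h.sign with rfl | rfl <;> norm_num
  obtain ⟨c, C, R, hc, hbox⟩ := exists_subset_timeBox hχ.compact fun z hz h0 => by
    have h1 : 0 < σ * z.1 := hχ.subset hz
    rw [h0, mul_zero] at h1
    exact lt_irrefl _ h1
  have hbox' : tsupport χ ⊆ timeBox n σ c C R := fun z hz =>
    hbox σ h.sign ⟨hz, hχ.subset hz⟩
  set a := min 1 l with ha_def
  set b := max 1 l with hb_def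
  have ha : 0 < a := lt_min one_pos hl
  have h1ab : (1 : ℝ) ∈ Icc a b := ⟨min_le_left _ _, le_max_left _ _⟩
  have hlab : l ∈ Icc a b := ⟨min_le_right _ _, le_max_right _ _⟩
  have hb : 0 < b := ha.trans_le (h1ab.1.trans h1ab.2)
  -- This box contains the supports of all dilated test functions with parameter between `1` and
  -- `l`, so a single compact set serves the whole path.
  set K := timeBox n σ (c / b ^ 2) (C / a ^ 2) (R / a) with hKdef
  have hc' : 0 < c / b ^ 2 := by positivity
  have hKc : IsCompact K := isCompact_timeBox h.sign hc'
  have hχK : ∀ x ∈ Icc a b, IsTest K fun z => χ (parabolicDilation 0 0 x z) := fun x hx => by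
    have hx0 : 0 < x := ha.trans_le hx.1
    have hcomp := (⟨hχ.smooth, hχ.compact, hbox'⟩ : IsTest (timeBox n σ c C R) χ).comp_dilation hx0
    refine ⟨hcomp.smooth, hcomp.compact, hcomp.subset.trans fun z hz => ?_⟩
    obtain ⟨⟨h1, h2⟩, h3⟩ := hz
    simp only [parabolicDilation, zero_add] at h1 h2 h3
    have hx2 : 0 < x ^ 2 := by positivity
    have e : σ * (x ^ 2 * z.1) = (σ * z.1) * x ^ 2 := by ring
    rw [e] at h1 h2
    have hz0 : 0 < σ * z.1 := pos_of_mul_pos_left (hc.trans_le h1) hx2.le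
    refine ⟨⟨?_, ?_⟩, ?_⟩
    · rw [div_le_iff₀ (by positivity)]
      exact h1.trans (mul_le_mul_of_nonneg_left (pow_le_pow_left₀ hx0.le hx.2 2) hz0.le)
    · rw [le_div_iff₀ (by positivity)]
      exact (mul_le_mul_of_nonneg_left (pow_le_pow_left₀ ha.le hx.1 2) hz0.le).trans h2
    · rw [norm_smul, Real.norm_of_nonneg hx0.le] at h3
      rw [le_div_iff₀ ha, mul_comm]
      exact (mul_le_mul_of_nonneg_right hx.1 (norm_nonneg _)).trans h3
  -- Weak convergence is given on open sets, whereas the defect estimate lives on the compact box;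
  -- an open `D` in between carries both, since all test functions are supported in `K`.
  obtain ⟨D, hDo, hKD, hDc, hDk⟩ := exists_open_between_and_isCompact_closure hKc
    (isOpen_sideSet (n := n) (σ := σ)) (timeBox_subset_sideSet hc')
  have hw := hconv D ⟨hDo, hDk, hDc⟩
  set ψ : ℝ → SpaceTime n → ℝ := fun x z => x ^ (β + n + 2) * χ (parabolicDilation 0 0 x z) with hψ
  have hψK : ∀ x ∈ Icc a b, IsTest K (ψ x) := fun x hx =>
    ⟨contDiff_const.mul (hχK x hx).smooth, (hχK x hx).compact.mul_left,
      tsupport_mul_subset_right.trans (hχK x hx).subset⟩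
  have hψD : ∀ x ∈ Icc a b, IsTest D (ψ x) := fun x hx =>
    ⟨(hψK x hx).smooth, (hψK x hx).compact, (hψK x hx).subset.trans hKD⟩
  have hDK : ∀ x ∈ Icc a b, ∀ f : SpaceTime n → EuclideanSpace ℝ (Fin m),
      ∫ z in D, ψ x z • f z = ∫ z in K, ψ x z • f z := fun x hx f =>
    setIntegral_eq_of_subset_of_forall_sdiff_eq_zero hDo.measurableSet hKD fun z hz => by
      rw [image_eq_zero_of_notMem_tsupport fun hm => hz.2 ((hψK x hx).subset hm), zero_smul]
  have hall : ∀ x ∈ Icc a b, ∫ z in D, ψ x z • u₀ z = ∫ z, ψ x z • u₀ z := fun x hx =>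
    setIntegral_eq_integral_of_forall_compl_eq_zero fun z hz => by
      rw [image_eq_zero_of_notMem_tsupport fun hm => hz ((hψD x hx).subset hm), zero_smul]
  have hfin : IsFiniteMeasure (volume.restrict K) := ⟨by simpa using hKc.measure_lt_top⟩
  obtain ⟨B, hB, hbd⟩ := h.exists_rescale_bound hc' (C / a ^ 2) (R / a)
  have hmeas := h.eventually_aestronglyMeasurable hc' (C / a ^ 2) (R / a)
  obtain ⟨hNi, hN⟩ := tendsto_integral_norm_zero (f := fun r => homogeneityDefect β 0 0
    (rescale β T x₀ u r) (rescaleGrad β T x₀ Du r)) (hmeas.mono fun r hr =>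
    (aestronglyMeasurable_dilationDeriv hr.2).sub (hr.1.const_smul β))
    (h.tendsto_lintegral_defect hc' (C / a ^ 2) (R / a))
  obtain ⟨M, hM⟩ := hχ.compact.exists_bound_of_continuous hχ.smooth.continuous
  obtain ⟨P, hP⟩ := (isCompact_Icc (a := a) (b := b)).exists_bound_of_continuousOn
    (f := fun x : ℝ => x ^ (β + n + 2 - 1))
    (continuousOn_id.rpow_const fun x hx => Or.inl (ha.trans_le hx.1).ne')
  have hdiff : ∀ᶠ r in 𝓝[>] (0 : ℝ),
      ‖(∫ z in K, ψ l z • rescale β T x₀ u r z) - ∫ z in K, ψ 1 z • rescale β T x₀ u r z‖ ≤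
        P * (M * ∫ z in K, ‖homogeneityDefect β 0 0 (rescale β T x₀ u r)
          (rescaleGrad β T x₀ Du r) z‖) * ‖l - 1‖ := by
    filter_upwards [hbd, hmeas, hNi, h.eventually_timeBox_subset hc' (C / a ^ 2) (R / a),
      self_mem_nhdsWithin] with r h1 h2 h3 h4 hr
    obtain ⟨hv, -⟩ := memLp_two_of_lintegral_le h2.1 hB h1.1
    have hDv := fun k => (memLp_two_of_lintegral_le (h2.2 k) hB (h1.2 k)).1
    exact norm_integral_dilation_sub_le (h.memH1.weakGrad.rescale hr β)
      (measurableSet_slab.preimage contDiff_parabolicDilation.continuous.measurable) h4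
      hKc.measure_lt_top.ne hv hDv h3 hχ.smooth hχ.compact ha hχK
      (fun x hx => (le_abs_self _).trans (hP x hx)) hM h1ab hlab
  have hzero : Tendsto (fun k => (∫ z in K, ψ l z • rescale β T x₀ u (ρ k) z) -
      ∫ z in K, ψ 1 z • rescale β T x₀ u (ρ k) z) atTop (𝓝 0) := by
    refine squeeze_zero_norm' (hρ.eventually hdiff) ?_
    have := (((hN.const_mul M).const_mul P).mul_const ‖l - 1‖).comp hρ
    simp only [mul_zero, zero_mul] at this
    exact this
  have hinner : ∀ e : EuclideanSpace ℝ (Fin m),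
      ⟪e, ∫ z in D, ψ l z • u₀ z⟫ = ⟪e, ∫ z in D, ψ 1 z • u₀ z⟫ := fun e => by
    have h1 := (hw.tendsto_integral (hψD l hlab) e).sub (hw.tendsto_integral (hψD 1 h1ab) e)
    have h2 : Tendsto (fun k => ⟪e, (∫ z in K, ψ l z • rescale β T x₀ u (ρ k) z) -
        ∫ z in K, ψ 1 z • rescale β T x₀ u (ρ k) z⟫) atTop (𝓝 ⟪e, 0⟫) :=
      tendsto_const_nhds.inner hzero
    simp only [inner_sub_right, inner_zero_right, ← hDK l hlab, ← hDK 1 h1ab] at h2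
    exact sub_eq_zero.1 (tendsto_nhds_unique h1 h2)
  have hfinal := ext_inner_left ℝ hinner
  rw [hall l hlab, hall 1 h1ab] at hfinal
  have h1 : ∀ z, ψ 1 z = χ z := fun z => by simp [hψ, parabolicDilation]
  simp only [h1] at hfinal
  exact hfinal

theorem locallyIntegrableOn_limit
    (hconv : ∀ D : Set (SpaceTime n), CompactlyInside D (sideSet n σ) → MemLp u₀ 2
      (volume.restrict D)) : LocallyIntegrableOn u₀ (sideSet n σ) := by
  intro z hz
  obtain ⟨D, hDo, hKD, hDc, hDk⟩ := exists_open_between_and_isCompact_closure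
    (isCompact_singleton (x := z)) (isOpen_sideSet (n := n) (σ := σ)) (singleton_subset_iff.2 hz)
  have hfin : IsFiniteMeasure (volume.restrict D) :=
    ⟨by simpa using (measure_mono subset_closure).trans_lt hDk.measure_lt_top⟩
  exact ⟨D, mem_nhdsWithin_of_mem_nhds (hDo.mem_nhds (singleton_subset_iff.1 hKD)),
    (hconv D ⟨hDo, hDk, hDc⟩).integrable (by norm_num)⟩

theorem preimage_sideSet_dilation {l : ℝ} (hl : 0 < l) :
    parabolicDilation 0 0 l ⁻¹' sideSet n σ = sideSet n σ := by
  ext z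
  change 0 < σ * (0 + l ^ 2 * z.1) ↔ 0 < σ * z.1
  rw [show σ * (0 + l ^ 2 * z.1) = l ^ 2 * (σ * z.1) by ring]
  exact mul_pos_iff_of_pos_left (by positivity)

theorem locallyIntegrableOn_comp_dilation {l : ℝ} (hl : 0 < l)
    (h : LocallyIntegrableOn u₀ (sideSet n σ)) :
    LocallyIntegrableOn (fun z => u₀ (parabolicDilation 0 0 l z)) (sideSet n σ) := by
  intro z hz
  have hz' : parabolicDilation 0 0 l z ∈ sideSet n σ := by
    rwa [← mem_preimage, preimage_sideSet_dilation hl]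
  obtain ⟨S, hS, hi⟩ := h _ hz'
  rw [isOpen_sideSet.nhdsWithin_eq hz'] at hS
  have he := measurableEmbedding_parabolicDilation (n := n) (T := 0) (x₀ := 0) hl
  refine ⟨parabolicDilation 0 0 l ⁻¹' S, mem_nhdsWithin_of_mem_nhds
    (contDiff_parabolicDilation.continuous.continuousAt hS), ?_⟩
  have := (he.integrableOn_map_iff (f := u₀) (μ := volume) (s := S)).1 (by
    rw [map_parabolicDilation hl, IntegrableOn, Measure.restrict_smul]
    exact hi.smul_measure ENNReal.ofReal_ne_top)
  exact this

/-- Blow-up limits are homogeneous. -/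
theorem ae_homogeneous (h : OneSidedSolution F β T x₀ u Du σ L) {ρ : ℕ → ℝ}
    (hρ : Tendsto ρ atTop (𝓝[>] 0))
    (hconv : ∀ D : Set (SpaceTime n), CompactlyInside D (sideSet n σ) →
      WeaklyConvergesH1 D (fun k => rescale β T x₀ u (ρ k)) u₀) {θ : ℝ} (hθ : 0 < θ) :
    ∀ᵐ z, z ∈ sideSet n σ → u₀ (parabolicDilation 0 0 θ z) = θ ^ β • u₀ z := by
  have hloc : LocallyIntegrableOn u₀ (sideSet n σ) := locallyIntegrableOn_limit fun D hD => by
    obtain ⟨w, w₀, -, hw₀, -⟩ := hconv D hD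
    exact (memLp_congr_ae hw₀).1 (Lp.memLp _)
  have hloc' := locallyIntegrableOn_comp_dilation hθ hloc
  have key := (isOpen_sideSet (n := n) (σ := σ)).ae_eq_zero_of_integral_contDiff_smul_eq_zero
    (hloc'.sub (hloc.smul (θ ^ β))) fun g hg hgc hgs => ?_
  · filter_upwards [key] with z hz hzs
    exact sub_eq_zero.1 (hz hzs)
  · have ht : IsTest (sideSet n σ) g := ⟨hg, hgc, hgs⟩
    -- The parameter is `θ⁻¹` because the change of variables moves the dilation from `u₀` onto `g`
    -- and inverts it. The Jacobian `θ^{-(n+2)}` then leaves the factor `θ^β`.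
    have h1 := h.integral_dilation_eq hρ hconv ht (inv_pos.2 hθ)
    have hint : ∀ f : SpaceTime n → EuclideanSpace ℝ (Fin m),
        LocallyIntegrableOn f (sideSet n σ) → Integrable fun z => g z • f z := fun f hf =>
      (integrableOn_iff_integrable_of_support_subset fun z hz => by
        by_contra hzs
        refine hz ?_
        simp only
        rw [image_eq_zero_of_notMem_tsupport fun hm => hzs (hgs hm), zero_smul]).1
          (ht.integrable_smul hf)
    have i1 := hint _ hloc'
    have i2 : Integrable fun z => g z • θ ^ β • u₀ z := hint _ (hloc.smul (θ ^ β))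
    have h2 := setIntegral_comp_dilation (T := 0) (x₀ := (0 : EuclideanSpace ℝ (Fin n))) hθ univ
      fun w => g (parabolicDilation 0 0 θ⁻¹ w) • u₀ w
    have h3 : ∀ z : SpaceTime n, parabolicDilation 0 0 θ⁻¹ (parabolicDilation 0 0 θ z) = z :=
      fun z => by simp [parabolicDilation, hθ.ne', smul_smul]
    simp only [preimage_univ, Measure.restrict_univ, h3] at h2
    simp only [mul_smul] at h1
    rw [integral_smul] at h1
    simp only [Pi.sub_apply, Pi.smul_apply, smul_sub]
    rw [integral_sub i1 i2, h2]
    simp only [smul_comm _ (θ ^ β)]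
    rw [integral_smul, ← h1, smul_smul, sub_eq_zero]
    congr 1
    rw [Real.inv_rpow hθ.le, ← Real.rpow_natCast, ← Real.rpow_neg hθ.le, ← Real.rpow_neg hθ.le,
      ← Real.rpow_add hθ]
    congr 1
    push_cast
    ring

end OneSidedSolution

/-! ### Both sides of `T` together. -/

section TwoSides

variable {F : EuclideanSpace ℝ (Fin m) → ℝ} {β t₁ t₂ T : ℝ} {x₀ : EuclideanSpace ℝ (Fin n)}
  {u u₀ : SpaceTime n → EuclideanSpace ℝ (Fin m)}
  {Du : Fin (n + 1) → SpaceTime n → EuclideanSpace ℝ (Fin m)}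

theorem oneSidedSolution_neg (h : t₁ < T) (hsol : IsVariationalSolution F t₁ T u Du)
    (hb : WeightedBounds F t₁ t₂ T x₀ u Du)
    (hcond : ∀ r ∈ Ioo 0 (√(T - t₁) / 4), NonnegCondition F β T x₀ u (layerMinus n T r))
    (hgrowth : GrowthEstimate F β T x₀ u Du (layerMinus n T) (√(T - t₁) / 4)) :
    OneSidedSolution F β T x₀ u Du (-1) (T - t₁) where
  sign := Or.inr rfl
  pos := sub_pos.2 h
  sol := by
    rw [show T + -1 * (T - t₁) = t₁ by ring, min_eq_right h.le, max_eq_left h.le]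
    exact hsol
  time δ hδ := (hb δ hδ).2.mono_set (by
    rw [slab_neg_one, sub_sub_cancel]
    exact subset_union_left)
  nonneg r hr := by
    rw [← layerMinus_eq_slab]
    exact hcond r hr
  growth := by
    simp only [← layerMinus_eq_slab]
    exact hgrowth

theorem oneSidedSolution_one (h : T < t₂) (hsol : IsVariationalSolution F T t₂ u Du)
    (hb : WeightedBounds F t₁ t₂ T x₀ u Du)
    (hcond : ∀ r ∈ Ioo 0 (√(t₂ - T) / 4), NonnegCondition F β T x₀ u (layerPlus n T r))
    (hgrowth : GrowthEstimate F β T x₀ u Du (layerPlus n T) (√(t₂ - T) / 4)) :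
    OneSidedSolution F β T x₀ u Du 1 (t₂ - T) where
  sign := Or.inl rfl
  pos := sub_pos.2 h
  sol := by
    rw [one_mul, add_sub_cancel, min_eq_left h.le, max_eq_right h.le]
    exact hsol
  time δ hδ := (hb δ hδ).2.mono_set (by
    rw [slab_one, add_sub_cancel]
    exact subset_union_right)
  nonneg r hr := by
    rw [← layerPlus_eq_slab]
    exact hcond r hr
  growth := by
    simp only [← layerPlus_eq_slab]
    exact hgrowth

theorem twoSidedSolution (hneg : t₁ < T → OneSidedSolution F β T x₀ u Du (-1) (T - t₁))
    (hone : T < t₂ → OneSidedSolution F β T x₀ u Du 1 (t₂ - T)) :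
    TwoSidedSolution F β t₁ t₂ T x₀ u Du := by
  rintro σ (rfl | rfl)
  · by_cases h : T < t₂
    · exact Or.inl ⟨fun z hz => Or.inr ⟨h, by rwa [sideSet, mem_ofPred_eq, one_mul] at hz⟩,
        _, hone h⟩
    · refine Or.inr (eq_empty_of_forall_notMem fun z hz => ?_)
      obtain ⟨⟨-, h1⟩ | ⟨h1, -⟩, h2⟩ := hz
      · rw [sideSet, mem_ofPred_eq, one_mul] at h2
        exact lt_asymm h1 h2
      · exact h h1
  · by_cases h : t₁ < T
    · refine Or.inl ⟨fun z hz => Or.inl ⟨h, ?_⟩, _, hneg h⟩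
      rw [sideSet, mem_ofPred_eq] at hz
      linarith
    · refine Or.inr (eq_empty_of_forall_notMem fun z hz => ?_)
      obtain ⟨⟨h1, -⟩ | ⟨-, h1⟩, h2⟩ := hz
      · exact h h1
      · rw [sideSet, mem_ofPred_eq] at h2
        linarith

theorem measurableSet_limitDomain : MeasurableSet (limitDomain n t₁ t₂ T) :=
  ((MeasurableSet.const _).inter (measurableSet_lt measurable_fst measurable_const)).union
    ((MeasurableSet.const _).inter (measurableSet_lt measurable_const measurable_fst))

/-- Sets compactly inside a nonempty side are compactly inside the whole limit domain, so the
convergence hypothesis restricts to each side. Dilations preserve the sides, and every point of the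
domain lies on one of them. -/
theorem TwoSidedSolution.ae_homogeneous (h : TwoSidedSolution F β t₁ t₂ T x₀ u Du) {ρ : ℕ → ℝ}
    (hρ : Tendsto ρ atTop (𝓝[>] 0))
    (hconv : ∀ D : Set (SpaceTime n), CompactlyInside D (limitDomain n t₁ t₂ T) →
      WeaklyConvergesH1 D (fun k => rescale β T x₀ u (ρ k)) u₀) {θ : ℝ} (hθ : 0 < θ) :
    ∀ᵐ z ∂(volume.restrict (limitDomain n t₁ t₂ T)),
      u₀ (θ ^ 2 * z.1, θ • z.2) = θ ^ β • u₀ z := by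
  have key : ∀ σ : ℝ, σ = 1 ∨ σ = -1 → ∀ᵐ z : SpaceTime n, z ∈ limitDomain n t₁ t₂ T →
      z ∈ sideSet n σ → u₀ (θ ^ 2 * z.1, θ • z.2) = θ ^ β • u₀ z := fun σ hσ => by
    rcases h σ hσ with ⟨hs, L, hL⟩ | he
    · filter_upwards [hL.ae_homogeneous hρ
        (fun D hD => hconv D ⟨hD.1, hD.2.1, hD.2.2.trans hs⟩) hθ] with z hz _ hzs
      simpa [parabolicDilation] using hz hzs
    · exact Eventually.of_forall fun z h1 h2 =>
        absurd (show z ∈ limitDomain n t₁ t₂ T ∩ sideSet n σ from ⟨h1, h2⟩) (by simp [he])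
  rw [ae_restrict_iff' measurableSet_limitDomain]
  filter_upwards [key 1 (Or.inl rfl), key (-1) (Or.inr rfl)] with z h1 h2 hz
  have hz' := hz
  rcases hz' with ⟨-, h0⟩ | ⟨-, h0⟩
  · exact h2 hz (by rw [sideSet, mem_ofPred_eq]; linarith)
  · exact h1 hz (by rwa [sideSet, mem_ofPred_eq, one_mul])

end TwoSides

end ParabolicSystem

end

open ParabolicSystem in
theorem theorem3p3 {n m : ℕ} (hn : 0 < n) (hm : 0 < m)
    (F : EuclideanSpace ℝ (Fin m) → ℝ) (hF : ContDiff ℝ ∞ F)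
    (t₁ t₂ T β : ℝ) (ht : t₁ < t₂) (hT₁ : t₁ ≤ T) (hT₂ : T ≤ t₂)
    (x₀ : EuclideanSpace ℝ (Fin n))
    (u : SpaceTime n → EuclideanSpace ℝ (Fin m))
    (Du : Fin (n + 1) → SpaceTime n → EuclideanSpace ℝ (Fin m))
    (hsolMinus : t₁ < T → IsVariationalSolution F t₁ T u Du)
    (hsolPlus : T < t₂ → IsVariationalSolution F T t₂ u Du)
    (hbounds : WeightedBounds F t₁ t₂ T x₀ u Du)
    (hcondMinus : ∀ r ∈ Ioo 0 (√(T - t₁) / 4),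
      NonnegCondition F β T x₀ u (layerMinus n T r))
    (hcondPlus : ∀ r ∈ Ioo 0 (√(t₂ - T) / 4),
      NonnegCondition F β T x₀ u (layerPlus n T r))
    (hgrowthMinus : GrowthEstimate F β T x₀ u Du (layerMinus n T) (√(T - t₁) / 4))
    (hgrowthPlus : GrowthEstimate F β T x₀ u Du (layerPlus n T) (√(t₂ - T) / 4))
    (ρ : ℕ → ℝ) (hρ : ∀ k, 0 < ρ k) (hρ0 : Tendsto ρ atTop (𝓝 0)) :
    (t₁ < T →
      MonotoneOn (fun r => weightedEnergy F β T x₀ u Du (layerMinus n T r) r)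
        (Ioo 0 (√(T - t₁) / 4)) ∧
      ∃ M : ℝ, Tendsto (fun r => weightedEnergy F β T x₀ u Du (layerMinus n T r) r)
        (𝓝[>] 0) (𝓝 M)) ∧
    (T < t₂ →
      MonotoneOn (fun r => weightedEnergy F β T x₀ u Du (layerPlus n T r) r)
        (Ioo 0 (√(t₂ - T) / 4)) ∧
      ∃ M : ℝ, Tendsto (fun r => weightedEnergy F β T x₀ u Du (layerPlus n T r) r)
        (𝓝[>] 0) (𝓝 M)) ∧
    (∀ D : Set (SpaceTime n), CompactlyInside D (limitDomain n t₁ t₂ T) →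
      EventuallyBoundedH1 D (fun k => rescale β T x₀ u (ρ k))) ∧
    (∀ (σ : ℕ → ℕ) (u₀ : SpaceTime n → EuclideanSpace ℝ (Fin m)), StrictMono σ →
      (∀ D : Set (SpaceTime n), CompactlyInside D (limitDomain n t₁ t₂ T) →
        WeaklyConvergesH1 D (fun k => rescale β T x₀ u (ρ (σ k))) u₀) →
      ∀ θ : ℝ, 0 < θ → ∀ᵐ z ∂(volume.restrict (limitDomain n t₁ t₂ T)),
        u₀ (θ ^ 2 * z.1, θ • z.2) = θ ^ β • u₀ z) := by
  have hneg := fun h => oneSidedSolution_neg h (hsolMinus h) hbounds hcondMinus hgrowthMinus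
  have hone := fun h => oneSidedSolution_one h (hsolPlus h) hbounds hcondPlus hgrowthPlus
  have htwo := twoSidedSolution hneg hone
  refine ⟨fun h => ?_, fun h => ?_, fun D hD => htwo.eventuallyBoundedH1 hD hρ hρ0,
    fun σ u₀ hσ hconv θ hθ => htwo.ae_homogeneous ?_ hconv hθ⟩
  · simp only [layerMinus_eq_slab]
    exact ⟨(hneg h).monotoneOn_weightedEnergy, (hneg h).exists_tendsto_weightedEnergy⟩
  · simp only [layerPlus_eq_slab]
    exact ⟨(hone h).monotoneOn_weightedEnergy, (hone h).exists_tendsto_weightedEnergy⟩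
  · exact tendsto_nhdsWithin_iff.2
      ⟨hρ0.comp hσ.tendsto_atTop, Eventually.of_forall fun k => hρ _⟩
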